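/- **Definitions.** Graphs may have parallel edges but no loops. Let $G=(V,E)$ be an infinite, connected, locally finite graph with graph distance $d$ and balls $B(o,R)=\{y\in V: d(o,y)\le R\}$. For a probability measure $\nu$ on $[0,\infty)$ let $(w(e))_{e\in E}$ be i.i.d. with law $\nu$, and let $T(x,y)=\inf_{\pi}\sum_{e\in\pi}w(e)$ be the passage time, the infimum being over all edge paths $\pi$ from $x$ to $y$; $\tilde T$ is the passage time for the measure $\tilde\nu$. The measure $\tilde\nu$ is *strictly more variable* than $\nu$ if $\tilde\nu\ne\nu$ and $\int f\,d\tilde\nu\le\int f\,d\nu$ for every concave nondecreasing $f:\mathbb R\to\mathbb R$ for which both integrals converge absolutely. For $p\in[0,1]$ let $G_p$ be the random subgraph in which every edge is kept independently with probability $p$. Let $\underline{p_c}$ be the supremum of all $p\in[0,1]$ with $$\limsup_{R\to\infty}\ \sup_{o\in V}\ \frac1R\log\mathbb P\big(G_p\text{ contains an edge path from } o\text{ to } V\setminus B(o,R)\big)<0,$$ and let $\vec{\underline{p_c}}$ be defined in the same way, with only those paths allowed which are edge-geodesics (shortest paths) in $G$. A probability measure $\nu$ with $a:=\inf\operatorname{supp}\nu$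 is *exponential-subcritical* if either $a=0$ and $\nu(\{0\})<\underline{p_c}$, or $a>0$ and $\nu(\{a\})<\vec{\underline{p_c}}$. The graph $G$ has the *van den Berg–Kesten (vdBK) property* if for all probability measures $\nu,\tilde\nu$ on $[0,\infty)$ with finite mean such that $\nu$ is exponential-subcritical and $\tilde\nu$ is strictly more variable than $\nu$, $$\liminf_{d(x,y)\to\infty}\frac{\mathbb E\,T(x,y)-\mathbb E\,\tilde T(x,y)}{d(x,y)}>0 .$$ A *Cayley graph* of a finitely generated group $\Gamma$ is given by a finite set $S$ and a map $f:S\to\Gamma\setminus\{1\}$ whose image generates $\Gamma$. It has vertex set $\Gamma$ and is either the *unreduced* one, with edge set $\Gamma\times S$, where $(g,s)$ joins $g$ and $gf(s)$, or the *reduced* one, the simple graph obtained from the unreduced one by deleting parallel edges. **Theorem.** Let $\Gamma$ be an infinite, finitely generated, virtually free group (that is, with a free subgroup of finite index), not isomorphic to $\mathbb Z$ or to $\mathbb Z/2*\mathbb Z/2$. Suppose that $\Gamma$ has a finite-index subgroup with nontrivial center or has a nontrivial finite normal subgroup. Then every Cayley graph of $\Gamma$ has the vdBK property. In particular, let $k\ge1$,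 let $F_k$ be the free group on $k$ letters and let $F$ be a nontrivial finite group. If $\Gamma$ is a group that contains a subgroup of finite index isomorphic to $F_k\times F$, or if $\Gamma$ is isomorphic to a semidirect product $F\rtimes F_k$, then every Cayley graph of $\Gamma$ has the vdBK property. -/

import Mathlib

universe u v w

noncomputable section

open MeasureTheory Filter
open scoped NNReal ENNReal unitInterval

namespace FPP

/-- A graph on the vertex set `V` with edge set `E`: every edge has a set of two distinct
endpoints. Parallel edges are allowed, self-loops are not. -/
structure Multigraph (V : Type*) (E : Type*) where
  /-- the unordered pair of endpoints of an edge -/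
  boundary : E → Sym2 V
  not_isDiag : ∀ e, ¬ (boundary e).IsDiag

namespace Multigraph

variable {V : Type*} {E : Type*}

/-- Finite edge paths from `u` to `w`: alternating sequences of vertices and edges. -/
inductive Walk (G : Multigraph V E) : V → V → Type _
  | nil (u : V) : Walk G u u
  | cons {u v w : V} (e : E) (h : G.boundary e = s(u, v)) (p : Walk G v w) : Walk G u w

/-- The sequence of edges of a path. -/
def Walk.edges {G : Multigraph V E} : {u w : V} → Walk G u w → List E
  | _, _, .nil _ => []
  | _, _, .cons e _ p => e :: p.edges

/-- The number of edges of a path. -/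
def Walk.length {G : Multigraph V E} {u w : V} (p : Walk G u w) : ℕ := p.edges.length

/-- The total weight `T(π)` of a path for the edge weights `ω`. -/
def Walk.passageTime {G : Multigraph V E} {u w : V} (p : Walk G u w) (ω : E → ℝ≥0) : ℝ≥0 :=
  (p.edges.map ω).sum

/-- The graph distance `d(x, y)` (of a connected graph). -/
def dist (G : Multigraph V E) (x y : V) : ℕ := ⨅ p : Walk G x y, p.length

/-- The passage time `T(x, y)` (in a connected graph) for the edge weights `ω`. -/
def passageTime (G : Multigraph V E) (ω : E → ℝ≥0) (x y : V) : ℝ≥0 :=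
  ⨅ p : Walk G x y, p.passageTime ω

/-- A path is an edge-geodesic if no path with the same endpoints is shorter. -/
def Walk.IsGeodesic {G : Multigraph V E} {x y : V} (p : Walk G x y) : Prop :=
  ∀ q : Walk G x y, p.length ≤ q.length

/-- The expected passage time `𝔼 T(x, y)`, where the edge weights are independent with common
law `ν`, that is, the weight configuration has law the product measure `ν^E`. -/
def expectedPassageTime (G : Multigraph V E) (ν : Measure ℝ≥0) [IsProbabilityMeasure ν]
    (x y : V) : ℝ :=
  ∫ ω : E → ℝ≥0, (G.passageTime ω x y : ℝ) ∂(Measure.infinitePi fun _ : E => ν)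

/-- The event that the set `A` of open edges contains a path from `o` to the complement of the
ball `B(o, R)`. -/
def exitEvent (G : Multigraph V E) (o : V) (R : ℝ) : Set (Set E) :=
  {A | ∃ y, R < G.dist o y ∧ ∃ p : Walk G o y, ∀ e ∈ p.edges, e ∈ A}

/-- The event that the set `A` of open edges contains a path from `o` to the complement of the
ball `B(o, R)` which is an edge-geodesic of the whole graph. -/
def geodesicExitEvent (G : Multigraph V E) (o : V) (R : ℝ) : Set (Set E) :=
  {A | ∃ y, R < G.dist o y ∧ ∃ p : Walk G o y, p.IsGeodesic ∧ ∀ e ∈ p.edges, e ∈ A}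

/-- `limsup_{R → ∞} sup_o (1 / R) log P_p(D o R)`, an extended real, for events `D o R` of
Bernoulli bond percolation `G_p` with parameter `p` (every edge is open independently with
probability `p`). -/
def decayRate (_G : Multigraph V E) (D : V → ℝ → Set (Set E)) (p : I) : EReal :=
  limsup (fun R : ℝ => ⨆ o : V, ((R⁻¹ : ℝ) : EReal) *
    ENNReal.log (ProbabilityTheory.setBernoulli (Set.univ : Set E) p (D o R))) atTop

/-- The exponential percolation threshold. -/
def expThreshold (G : Multigraph V E) : I :=
  sSup {p : I | G.decayRate G.exitEvent p < 0}

/-- The exponential geodesic percolation threshold. -/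
def expGeodesicThreshold (G : Multigraph V E) : I :=
  sSup {p : I | G.decayRate G.geodesicExitEvent p < 0}

/-- `ν` is exponential-subcritical for `G`; here `sInf ν.support` is the infimum of the support
of `ν`. -/
def ExpSubcritical (G : Multigraph V E) (ν : Measure ℝ≥0) : Prop :=
  (sInf ν.support = 0 ∧ ν.real {0} < (G.expThreshold : ℝ)) ∨
    (0 < sInf ν.support ∧ ν.real {sInf ν.support} < (G.expGeodesicThreshold : ℝ))

end Multigraph

/-- `ν'` is more variable than `ν`. -/
def MoreVariable (ν' ν : Measure ℝ≥0) : Prop :=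
  ∀ f : ℝ → ℝ, ConcaveOn ℝ Set.univ f → Monotone f →
    Integrable (fun t : ℝ≥0 => f t) ν' → Integrable (fun t : ℝ≥0 => f t) ν →
      ∫ t : ℝ≥0, f t ∂ν' ≤ ∫ t : ℝ≥0, f t ∂ν

/-- `ν'` is strictly more variable than `ν`. -/
def StrictlyMoreVariable (ν' ν : Measure ℝ≥0) : Prop :=
  MoreVariable ν' ν ∧ ν' ≠ ν

/-- A measure on `[0, ∞)` has finite mean. -/
def HasFiniteMean (ν : Measure ℝ≥0) : Prop :=
  Integrable (fun t : ℝ≥0 => (t : ℝ)) ν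

/-- The van den Berg-Kesten property of an infinite, connected, locally finite graph. The limit
inferior is taken in the extended reals along the filter `d(x, y) → ∞` on pairs of vertices. -/
def Multigraph.VdBK {V : Type*} {E : Type*} (G : Multigraph V E) : Prop :=
  ∀ (ν ν' : Measure ℝ≥0) [IsProbabilityMeasure ν] [IsProbabilityMeasure ν'],
    HasFiniteMean ν → HasFiniteMean ν' → G.ExpSubcritical ν → StrictlyMoreVariable ν' ν →
      0 < liminf
        (fun q : V × V =>
          (((G.expectedPassageTime ν q.1 q.2 - G.expectedPassageTime ν' q.1 q.2)
            / (G.dist q.1 q.2 : ℝ) : ℝ) : EReal))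
        (comap (fun q : V × V => G.dist q.1 q.2) atTop)

section Cayley

variable {Γ : Type*} [Group Γ] {S : Type*}

/-- The unreduced Cayley graph of `Γ` for the family `f` of generators: the edge `(g, s)` joins
`g` and `g * f s`. -/
def unreducedCayley (f : S → Γ) (hf : ∀ s, f s ≠ 1) : Multigraph Γ (Γ × S) where
  boundary e := s(e.1, e.1 * f e.2)
  not_isDiag e := by simpa [eq_comm] using hf e.2

/-- The reduced Cayley graph of `Γ` for the family `f` of generators: the simple graph in which
`v ≠ w` are adjacent iff `w = v * (f s)^(±1)` for some `s`. -/
def reducedCayley (f : S → Γ) :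
    Multigraph Γ {e : Sym2 Γ // ¬ e.IsDiag ∧
      ∃ v w : Γ, e = s(v, w) ∧ ∃ s : S, w = v * f s ∨ w = v * (f s)⁻¹} where
  boundary e := e.1
  not_isDiag e := e.2.1

end Cayley

/-- Every Cayley graph of `Γ`, reduced or unreduced, for any finite family of nontrivial elements
generating `Γ`, has the van den Berg-Kesten property. -/
def EveryCayleyGraphVdBK (Γ : Type u) [Group Γ] : Prop :=
  ∀ (S : Type v) [Finite S] (f : S → Γ) (hf : ∀ s, f s ≠ 1),
    Subgroup.closure (Set.range f) = ⊤ →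
      (unreducedCayley f hf).VdBK ∧ (reducedCayley f).VdBK

/-- `Γ` has a free subgroup of finite index. -/
def VirtuallyFree (Γ : Type*) [Group Γ] : Prop :=
  ∃ H : Subgroup Γ, H.FiniteIndex ∧ IsFreeGroup H

end FPP

end

noncomputable section

open MeasureTheory Filter
open scoped NNReal ENNReal unitInterval

namespace FPP
namespace Multigraph

variable {V : Type*} {E : Type*} {G : Multigraph V E}

namespace Walk

/-- Concatenation of paths. -/
def append : {u v w : V} → Walk G u v → Walk G v w → Walk G u w
  | _, _, _, .nil _, q => q
  | _, _, _, .cons e h p, q => .cons e h (p.append q)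

/-- The reversed path. -/
def reverse : {u v : V} → Walk G u v → Walk G v u
  | _, _, .nil u => .nil u
  | _, _, .cons e h p => p.reverse.append (.cons e (h.trans Sym2.eq_swap) (.nil _))

@[simp] lemma nil_append {u v : V} (q : Walk G u v) : (Walk.nil u).append q = q := rfl

@[simp] lemma cons_append {u v w x : V} (e : E) (h : G.boundary e = s(u, v)) (p : Walk G v w)
    (q : Walk G w x) : (Walk.cons e h p).append q = .cons e h (p.append q) := rfl

@[simp] lemma append_nil {u v : V} (p : Walk G u v) : p.append (.nil v) = p := by
  induction p with
  | nil => rfl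
  | cons e h p ih => simp [ih]

lemma append_assoc {u v w x : V} (p : Walk G u v) (q : Walk G v w) (r : Walk G w x) :
    (p.append q).append r = p.append (q.append r) := by
  induction p with
  | nil => rfl
  | cons e h p ih => simp [ih]

@[simp] lemma edges_nil (u : V) : (Walk.nil u : Walk G u u).edges = [] := rfl

@[simp] lemma edges_cons {u v w : V} (e : E) (h : G.boundary e = s(u, v)) (p : Walk G v w) :
    (Walk.cons e h p).edges = e :: p.edges := rfl

@[simp] lemma edges_append {u v w : V} (p : Walk G u v) (q : Walk G v w) :
    (p.append q).edges = p.edges ++ q.edges := by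
  induction p with
  | nil => rfl
  | cons e h p ih => simp [ih]

@[simp] lemma edges_reverse {u v : V} (p : Walk G u v) : p.reverse.edges = p.edges.reverse := by
  induction p with
  | nil => rfl
  | cons e h p ih => simp [reverse, ih]

lemma reverse_append {u v w : V} (p : Walk G u v) (q : Walk G v w) :
    (p.append q).reverse = q.reverse.append p.reverse := by
  induction p with
  | nil => simp [reverse]
  | cons e h p ih => simp [reverse, ih, append_assoc]

@[simp] lemma reverse_reverse {u v : V} (p : Walk G u v) : p.reverse.reverse = p := by
  induction p with
  | nil => rfl
  | cons e h p ih => simp [reverse, reverse_append, ih]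

@[simp] lemma length_nil (u : V) : (Walk.nil u : Walk G u u).length = 0 := rfl

@[simp] lemma length_cons {u v w : V} (e : E) (h : G.boundary e = s(u, v)) (p : Walk G v w) :
    (Walk.cons e h p).length = p.length + 1 := rfl

@[simp] lemma length_append {u v w : V} (p : Walk G u v) (q : Walk G v w) :
    (p.append q).length = p.length + q.length := by simp [length]

@[simp] lemma length_reverse {u v : V} (p : Walk G u v) : p.reverse.length = p.length := by
  simp [length]

@[simp] lemma passageTime_nil (u : V) (ω : E → ℝ≥0) :
    (Walk.nil u : Walk G u u).passageTime ω = 0 := rfl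

@[simp] lemma passageTime_cons {u v w : V} (e : E) (h : G.boundary e = s(u, v)) (p : Walk G v w)
    (ω : E → ℝ≥0) : (Walk.cons e h p).passageTime ω = ω e + p.passageTime ω := by
  simp [passageTime]

@[simp] lemma passageTime_append {u v w : V} (p : Walk G u v) (q : Walk G v w) (ω : E → ℝ≥0) :
    (p.append q).passageTime ω = p.passageTime ω + q.passageTime ω := by
  simp [passageTime]

@[simp] lemma passageTime_reverse {u v : V} (p : Walk G u v) (ω : E → ℝ≥0) :
    p.reverse.passageTime ω = p.passageTime ω := by
  simp [passageTime, List.sum_reverse]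

lemma eq_of_length_eq_zero {u v : V} (p : Walk G u v) (h : p.length = 0) : u = v := by
  cases p with
  | nil => rfl
  | cons => simp at h

/-- The path visits the vertex set `A`. -/
def Visits {u v : V} (p : Walk G u v) (A : Set V) : Prop :=
  ∃ s ∈ A, ∃ (p₁ : Walk G u s) (p₂ : Walk G s v), p = p₁.append p₂

lemma Visits.mono {u v : V} {p : Walk G u v} {A B : Set V} (h : p.Visits A) (hAB : A ⊆ B) :
    p.Visits B := by
  obtain ⟨s, hs, h⟩ := h
  exact ⟨s, hAB hs, h⟩

lemma visits_end {u v : V} (p : Walk G u v) {A : Set V} (hv : v ∈ A) : p.Visits A :=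
  ⟨v, hv, p, .nil v, by simp⟩

lemma visits_start {u v : V} (p : Walk G u v) {A : Set V} (hu : u ∈ A) : p.Visits A :=
  ⟨u, hu, .nil u, p, by simp⟩

lemma visits_nil {u : V} {A : Set V} : (Walk.nil u : Walk G u u).Visits A ↔ u ∈ A := by
  refine ⟨?_, fun h => visits_start _ h⟩
  rintro ⟨s, hs, p₁, p₂, h⟩
  have := congrArg length h
  simp only [length_nil, length_append] at this
  have h1 := eq_of_length_eq_zero p₁ (by omega)
  rwa [h1]

lemma visits_cons {u v w : V} {e : E} {h : G.boundary e = s(u, v)} {p : Walk G v w} {A : Set V} :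
    (Walk.cons e h p).Visits A ↔ u ∈ A ∨ p.Visits A := by
  constructor
  · rintro ⟨s, hs, p₁, p₂, h'⟩
    cases p₁ with
    | nil => exact Or.inl hs
    | cons e' h₁ p₁ =>
      simp only [cons_append, cons.injEq] at h'
      obtain ⟨rfl, rfl, h'⟩ := h'
      exact Or.inr ⟨s, hs, p₁, p₂, eq_of_heq h'⟩
  · rintro (h' | ⟨s, hs, p₁, p₂, rfl⟩)
    · exact visits_start _ h'
    · exact ⟨s, hs, .cons e h p₁, p₂, rfl⟩

lemma visits_append {u v w : V} {p : Walk G u v} {q : Walk G v w} {A : Set V} :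
    (p.append q).Visits A ↔ p.Visits A ∨ q.Visits A := by
  induction p with
  | nil =>
    simp only [nil_append, visits_nil]
    exact ⟨Or.inr, fun h => h.elim (visits_start _) id⟩
  | cons e h p ih => rw [cons_append, visits_cons, visits_cons, ih, or_assoc]

lemma Visits.reverse {u v : V} {p : Walk G u v} {A : Set V} (h : p.Visits A) :
    p.reverse.Visits A := by
  obtain ⟨s, hs, p₁, p₂, rfl⟩ := h
  exact ⟨s, hs, p₂.reverse, p₁.reverse, reverse_append _ _⟩

/-- Splitting a path at its first visit to `A`. -/
lemma Visits.exists_first {u v : V} {p : Walk G u v} {A : Set V} (h : p.Visits A) :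
    ∃ s ∈ A, ∃ (p₁ : Walk G u s) (p₂ : Walk G s v), p = p₁.append p₂ ∧
      ∀ s' ∈ A, ∀ (q₁ : Walk G u s') (q₂ : Walk G s' s), p₁ = q₁.append q₂ → q₂.length = 0 := by
  induction p with
  | nil u =>
    refine ⟨u, visits_nil.1 h, .nil u, .nil u, rfl, fun s' _ q₁ q₂ hq => ?_⟩
    have := congrArg length hq
    simp only [length_nil, length_append] at this
    omega
  | @cons u v w e he p ih =>
    by_cases hu : u ∈ A
    · refine ⟨u, hu, .nil u, .cons e he p, rfl, fun s' _ q₁ q₂ hq => ?_⟩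
      have := congrArg length hq
      simp only [length_nil, length_append] at this
      omega
    · obtain ⟨s, hs, p₁, p₂, rfl, hmin⟩ := ih ((visits_cons.1 h).resolve_left hu)
      refine ⟨s, hs, .cons e he p₁, p₂, rfl, fun s' hs' q₁ q₂ hq => ?_⟩
      cases q₁ with
      | nil => exact absurd hs' hu
      | cons e' h₁ q₁ =>
        simp only [cons_append, cons.injEq] at hq
        obtain ⟨rfl, rfl, hq⟩ := hq
        exact hmin s' hs' q₁ q₂ (eq_of_heq hq)

lemma exists_split_of_mem_edges {u v : V} (p : Walk G u v) {e : E} (he : e ∈ p.edges) :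
    ∃ (t t' : V) (h : G.boundary e = s(t, t')) (p₁ : Walk G u t) (p₂ : Walk G t' v),
      p = p₁.append (.cons e h p₂) := by
  induction p with
  | nil => simp at he
  | @cons u v w e' he' p ih =>
    rcases List.mem_cons.1 he with rfl | he
    · exact ⟨u, v, he', .nil u, p, rfl⟩
    · obtain ⟨t, t', h, p₁, p₂, rfl⟩ := ih he
      exact ⟨t, t', h, .cons e' he' p₁, p₂, rfl⟩

lemma mem_of_visits_edge {u v : V} (p : Walk G u v) {e : E} (he : e ∈ p.edges) {t : V}
    (ht : t ∈ G.boundary e) : p.Visits {t} := by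
  obtain ⟨a, b, h, p₁, p₂, rfl⟩ := p.exists_split_of_mem_edges he
  rw [h, Sym2.mem_iff] at ht
  rw [visits_append, visits_cons]
  rcases ht with rfl | rfl
  · exact Or.inr (Or.inl rfl)
  · exact Or.inr (Or.inr (visits_start _ rfl))

/-- Every path contains, as a sublist of its edges, a path without repeated edges. -/
lemma exists_nodup {u v : V} (p : Walk G u v) :
    ∃ q : Walk G u v, q.edges.Nodup ∧ q.edges.Sublist p.edges := by
  induction p with
  | nil u => exact ⟨.nil u, by simp, by simp⟩
  | @cons u v w e he p ih =>
    obtain ⟨q, hq, hqp⟩ := ih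
    by_cases h : q.Visits {u}
    · obtain ⟨s, hs, q₁, q₂, rfl⟩ := h
      obtain rfl : s = u := hs
      rw [edges_append] at hq hqp
      exact ⟨q₂, (List.nodup_append.1 hq).2.1,
        ((List.sublist_append_right _ _).trans hqp).trans (List.sublist_cons_self _ _)⟩
    · refine ⟨.cons e he q, List.nodup_cons.2 ⟨fun hmem => h ?_, hq⟩, hqp.cons_cons _⟩
      exact q.mem_of_visits_edge hmem (by rw [he]; simp)

lemma passageTime_le_of_sublist {u v : V} {p q : Walk G u v} (h : q.edges.Sublist p.edges)
    (ω : E → ℝ≥0) : q.passageTime ω ≤ p.passageTime ω :=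
  (h.map ω).sum_le_sum (by simp)

lemma edges_injective {u v : V} : Function.Injective (edges : Walk G u v → List E) := by
  intro p q hpq
  induction p with
  | nil u =>
    cases q with
    | nil => rfl
    | cons => simp at hpq
  | @cons u v w e he p ih =>
    cases q with
    | nil => simp at hpq
    | @cons _ v' _ e' he' q =>
      simp only [edges_cons, List.cons.injEq] at hpq
      obtain ⟨rfl, hpq⟩ := hpq
      obtain rfl : v = v' := by
        have := he.symm.trans he'
        rwa [Sym2.congr_right] at this
      rw [ih hpq]

instance {u v : V} [Countable E] : Countable (Walk G u v) := edges_injective.countable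

/-- A function that grows along each edge of a path by at most the weight bounds the passage time
from below. -/
lemma sub_le_passageTime {u v : V} (p : Walk G u v) (ω : E → ℝ≥0) (Φ : V → ℝ)
    (h : ∀ e ∈ p.edges, ∀ s t, G.boundary e = s(s, t) → Φ t - Φ s ≤ ω e) :
    Φ v - Φ u ≤ p.passageTime ω := by
  induction p with
  | nil => simp
  | @cons u v w e he p ih =>
    have h1 := ih fun e' he' => h e' (List.mem_cons_of_mem _ he')
    have h2 := h e List.mem_cons_self u v he
    simp only [passageTime_cons, NNReal.coe_add]
    linarith

end Walk

/-- Any two vertices are joined by a path. -/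
def IsConnected (G : Multigraph V E) : Prop := ∀ u v, Nonempty (Walk G u v)

/-- The two vertices are joined by an edge. -/
def Adj (G : Multigraph V E) (u v : V) : Prop := ∃ e, G.boundary e = s(u, v)

lemma Adj.symm {u v : V} (h : G.Adj u v) : G.Adj v u := by
  obtain ⟨e, he⟩ := h
  exact ⟨e, he.trans Sym2.eq_swap⟩

/-- The path following a sequence of vertices. -/
lemma exists_walk_of_adj (c : ℕ → V) {i j : ℕ} (hij : i ≤ j)
    (h : ∀ k, i ≤ k → k < j → G.Adj (c k) (c (k + 1))) :
    ∃ p : Walk G (c i) (c j), ∀ A, p.Visits A → ∃ k, i ≤ k ∧ k ≤ j ∧ c k ∈ A := by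
  induction j, hij using Nat.le_induction with
  | base => exact ⟨.nil _, fun A hA => ⟨i, le_rfl, le_rfl, Walk.visits_nil.1 hA⟩⟩
  | succ j hij ih =>
    obtain ⟨p, hpA⟩ := ih fun k hk hk' => h k hk (by omega)
    obtain ⟨e, he⟩ := h j hij (by omega)
    refine ⟨p.append (.cons e he (.nil _)), fun A hA => ?_⟩
    rw [Walk.visits_append, Walk.visits_cons, Walk.visits_nil] at hA
    rcases hA with hA | hA | hA
    · obtain ⟨k, hk, hk', hkA⟩ := hpA A hA
      exact ⟨k, hk, by omega, hkA⟩
    · exact ⟨j, hij, by omega, hA⟩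
    · exact ⟨j + 1, by omega, le_rfl, hA⟩

lemma dist_le {u v : V} (p : Walk G u v) : G.dist u v ≤ p.length :=
  ciInf_le ⟨0, fun _ _ => Nat.zero_le _⟩ p

lemma IsConnected.exists_length_eq (hG : G.IsConnected) (u v : V) :
    ∃ p : Walk G u v, p.length = G.dist u v := by
  have := hG u v
  exact Nat.sInf_mem (Set.range_nonempty _)

@[simp] lemma dist_self (u : V) : G.dist u u = 0 :=
  Nat.le_zero.1 (dist_le (Walk.nil u))

lemma dist_comm (u v : V) : G.dist u v = G.dist v u := by
  unfold dist
  refine Function.Surjective.iInf_congr (Walk.reverse : Walk G u v → Walk G v u)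
    (fun p => ⟨p.reverse, by simp⟩) fun p => by simp

lemma IsConnected.dist_triangle (hG : G.IsConnected) (u v w : V) :
    G.dist u w ≤ G.dist u v + G.dist v w := by
  obtain ⟨p, hp⟩ := hG.exists_length_eq u v
  obtain ⟨q, hq⟩ := hG.exists_length_eq v w
  simpa [hp, hq] using dist_le (p.append q)

lemma dist_le_one_of_boundary {e : E} {u v : V} (h : G.boundary e = s(u, v)) :
    G.dist u v ≤ 1 :=
  dist_le (Walk.cons e h (.nil v))

lemma Walk.Visits.exists_dist_le {u v : V} {p : Walk G u v} {A : Set V} (h : p.Visits A) :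
    ∃ s ∈ A, G.dist u s ≤ p.length ∧ G.dist s v ≤ p.length := by
  obtain ⟨s, hs, p₁, p₂, rfl⟩ := h
  have h1 := dist_le p₁
  have h2 := dist_le p₂
  exact ⟨s, hs, by rw [Walk.length_append]; omega, by rw [Walk.length_append]; omega⟩

/-- A path of minimal length, as a sequence of vertices and edges. -/
lemma Walk.exists_seq {u v : V} (p : Walk G u v) [Nonempty E] :
    ∃ (c : ℕ → V) (ce : ℕ → E), c 0 = u ∧ c p.length = v ∧
      ∀ k < p.length, G.boundary (ce k) = s(c k, c (k + 1)) := by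
  induction p with
  | nil u => exact ⟨fun _ => u, fun _ => Classical.arbitrary E, rfl, rfl, by simp⟩
  | @cons u v w e he p ih =>
    obtain ⟨c, ce, h0, hn, hc⟩ := ih
    refine ⟨fun k => k.casesOn u c, fun k => k.casesOn e ce, rfl, by simpa using hn, ?_⟩
    rintro (_ | k) hk
    · simpa [h0] using he
    · exact hc k (by simpa using hk)

/-- A sequence of vertices that realizes distances. -/
def IsGeodesicSeq (G : Multigraph V E) (c : ℕ → V) (n : ℕ) : Prop :=
  ∀ i j, i ≤ j → j ≤ n → G.dist (c i) (c j) = j - i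

lemma IsConnected.isGeodesicSeq (hG : G.IsConnected) {c : ℕ → V} {n : ℕ}
    (hc : ∀ k < n, G.dist (c k) (c (k + 1)) ≤ 1) (hn : n ≤ G.dist (c 0) (c n)) :
    G.IsGeodesicSeq c n := by
  have h : ∀ i j, i ≤ j → j ≤ n → G.dist (c i) (c j) ≤ j - i := by
    intro i j hij
    induction j, hij using Nat.le_induction with
    | base => simp
    | succ j hij ih =>
      intro hj
      have h1 := hG.dist_triangle (c i) (c j) (c (j + 1))
      have h2 := hc j (by omega)
      have h3 := ih (by omega)
      omega
  intro i j hij hj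
  have h1 := h 0 i (by omega) (by omega)
  have h2 := h i j hij hj
  have h3 := h j n hj le_rfl
  have h4 := hG.dist_triangle (c 0) (c i) (c n)
  have h5 := hG.dist_triangle (c i) (c j) (c n)
  omega

lemma IsConnected.adj_of_dist_eq_one (hG : G.IsConnected) {u v : V} (h : G.dist u v = 1) :
    G.Adj u v := by
  obtain ⟨p, hp⟩ := hG.exists_length_eq u v
  rw [h] at hp
  cases p with
  | nil => simp at hp
  | cons e he p =>
    have := p.eq_of_length_eq_zero (by simpa using hp)
    subst this
    exact ⟨e, he⟩

lemma IsConnected.exists_geodesicSeq (hG : G.IsConnected) (u v : V) :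
    ∃ c : ℕ → V, c 0 = u ∧ c (G.dist u v) = v ∧ G.IsGeodesicSeq c (G.dist u v) := by
  rcases isEmpty_or_nonempty E with hE | hE
  · obtain ⟨p, hp⟩ := hG.exists_length_eq u v
    cases p with
    | nil => exact ⟨fun _ => u, rfl, rfl, fun i j _ hj => by simp at hj ⊢; omega⟩
    | cons e => exact hE.elim e
  · obtain ⟨p, hp⟩ := hG.exists_length_eq u v
    obtain ⟨c, ce, h0, hn, hc⟩ := p.exists_seq
    rw [hp] at hn hc
    exact ⟨c, h0, hn, hG.isGeodesicSeq (fun k hk => dist_le_one_of_boundary (hc k hk))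
      (by rw [h0, hn])⟩

end Multigraph
end FPP

namespace FPP
namespace Multigraph

variable {V : Type*} {E : Type*} {G : Multigraph V E}

lemma Walk.passageTime_update [DecidableEq E] {u v : V} (p : Walk G u v) (hp : p.edges.Nodup) (ω : E → ℝ≥0)
    (e : E) (t : ℝ≥0) :
    p.passageTime (Function.update ω e t) =
      p.passageTime (Function.update ω e 0) + if e ∈ p.edges then t else 0 := by
  induction p with
  | nil => simp
  | @cons u v w e' he p ih =>
    rw [Walk.edges_cons, List.nodup_cons] at hp
    rw [Walk.passageTime_cons, Walk.passageTime_cons, ih hp.2]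
    by_cases h : e' = e
    · subst h
      simp [hp.1, add_comm]
    · simp [h, Ne.symm h, add_assoc]

lemma Walk.passageTime_congr {u v : V} (p : Walk G u v) {ω ω' : E → ℝ≥0}
    (h : ∀ e ∈ p.edges, ω e = ω' e) : p.passageTime ω = p.passageTime ω' := by
  unfold Walk.passageTime
  rw [List.map_congr_left h]

lemma Walk.passageTime_le_length_mul {u v : V} (p : Walk G u v) {ω : E → ℝ≥0} {B : ℝ}
    (h : ∀ e ∈ p.edges, (ω e : ℝ) ≤ B) : (p.passageTime ω : ℝ) ≤ p.length * B := by
  induction p with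
  | nil => simp
  | cons e he p ih =>
    have h1 := h e List.mem_cons_self
    have h2 := ih fun e' he' => h e' (List.mem_cons_of_mem _ he')
    rw [passageTime_cons, length_cons]
    push_cast
    linarith

/-- A path along a sequence of vertices whose passage time is controlled by a potential. -/
lemma exists_walk_of_potential (ω : E → ℝ≥0) (c : ℕ → V) (ce : ℕ → E) (Φ : V → ℝ) (κ : ℝ)
    {i j : ℕ} (hij : i ≤ j)
    (h : ∀ k, i ≤ k → k < j → G.boundary (ce k) = s(c k, c (k + 1)))
    (hω : ∀ k, i ≤ k → k < j → (ω (ce k) : ℝ) ≤ Φ (c (k + 1)) - Φ (c k) + κ) :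
    ∃ p : Walk G (c i) (c j), (∀ e ∈ p.edges, ∃ k, i ≤ k ∧ k < j ∧ e = ce k) ∧
      (p.passageTime ω : ℝ) ≤ Φ (c j) - Φ (c i) + ((j : ℝ) - i) * κ := by
  induction j, hij using Nat.le_induction with
  | base => exact ⟨.nil _, by simp, by simp⟩
  | succ j hij ih =>
    obtain ⟨p, hp, hpω⟩ := ih (fun k hk hk' => h k hk (by omega))
      fun k hk hk' => hω k hk (by omega)
    refine ⟨p.append (.cons (ce j) (h j hij (by omega)) (.nil _)), fun e he => ?_, ?_⟩
    · rw [Walk.edges_append, List.mem_append] at he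
      rcases he with he | he
      · obtain ⟨k, hk, hk', rfl⟩ := hp e he
        exact ⟨k, hk, by omega, rfl⟩
      · exact ⟨j, hij, by omega, by simpa using he⟩
    · have := hω j hij (by omega)
      simp only [Walk.passageTime_append, Walk.passageTime_cons, Walk.passageTime_nil]
      push_cast
      linarith

/-- A path that ends near the end of a cheap corridor of geodesic type, having visited a
neighbourhood of its beginning, can be replaced by one that ends with the corridor. -/
lemma exists_corridor_walk (ω : E → ℝ≥0) (e₀ : E) (c : ℕ → V) (ce : ℕ → E) (ℓ : ℕ)
    (hc : ∀ k < ℓ, G.boundary (ce k) = s(c k, c (k + 1))) (hce : ∀ k < ℓ, ce k ≠ e₀)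
    (Φ Ψ : V → ℝ) (κ B : ℝ) (hκ : 0 ≤ κ)
    (hΦ : ∀ e s t, G.boundary e = s(s, t) → Φ t - Φ s ≤ ω e)
    (hcost : ∀ k < ℓ, (ω (ce k) : ℝ) ≤ Φ (c (k + 1)) - Φ (c k) + κ)
    (hΨ : ∀ e s t, (∀ k < ℓ, e ≠ ce k) → G.boundary e = s(s, t) → Ψ t - Ψ s ≤ ω e)
    (A₀ A₁ : Set V)
    (hA₀ : ∀ s ∈ A₀, ∃ p : Walk G s (c 0), e₀ ∉ p.edges ∧ (p.passageTime ω : ℝ) ≤ B)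
    (hgap : ∀ s ∈ A₀, ∀ t ∈ A₁, Φ t - Φ (c 0) + B ≤ Ψ t - Ψ s)
    {x t : V} (ht : t ∈ A₁) (π : Walk G x t) (hπ : π.Visits A₀) (he₀ : e₀ ∉ π.edges) :
    ∃ ρ : Walk G x (c ℓ), e₀ ∉ ρ.edges ∧
      (ρ.passageTime ω : ℝ) + Φ t - Φ (c ℓ) ≤ π.passageTime ω + ℓ * κ := by
  by_cases h : π.Visits {v | ∃ k ≤ ℓ, v = c k}
  · obtain ⟨_, ⟨k, hk, rfl⟩, π₁, π₂, rfl⟩ := h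
    obtain ⟨p, hp, hpω⟩ := exists_walk_of_potential ω c ce Φ κ hk
      (fun i _ hi => hc i hi) (fun i _ hi => hcost i hi)
    simp only [Walk.edges_append, List.mem_append, not_or] at he₀
    refine ⟨π₁.append p, ?_, ?_⟩
    · rw [Walk.edges_append, List.mem_append, not_or]
      refine ⟨he₀.1, fun hmem => ?_⟩
      obtain ⟨i, -, hi, h'⟩ := hp _ hmem
      exact hce i hi h'.symm
    · have h1 := π₂.sub_le_passageTime ω Φ fun e _ => hΦ e
      simp only [Walk.passageTime_append, NNReal.coe_add]
      have h2 : (k : ℝ) * κ ≥ 0 := by positivity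
      linarith
  · obtain ⟨s, hs, π₁, π₂, rfl⟩ := hπ
    obtain ⟨q, hq, hqω⟩ := hA₀ s hs
    obtain ⟨p, hp, hpω⟩ := exists_walk_of_potential ω c ce Φ κ (Nat.zero_le ℓ)
      (fun i _ hi => hc i hi) (fun i _ hi => hcost i hi)
    simp only [Walk.edges_append, List.mem_append, not_or] at he₀
    refine ⟨π₁.append (q.append p), ?_, ?_⟩
    · simp only [Walk.edges_append, List.mem_append, not_or]
      refine ⟨he₀.1, hq, fun hmem => ?_⟩
      obtain ⟨i, -, hi, h'⟩ := hp _ hmem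
      exact hce i hi h'.symm
    · have h1 := π₂.sub_le_passageTime ω Ψ fun e he a b hab => by
        refine hΨ e a b (fun k hk hek => h ?_) hab
        rw [Walk.visits_append]
        refine Or.inr ((π₂.mem_of_visits_edge he (t := c k) (by rw [hek, hc k hk]; simp)).mono ?_)
        rintro _ rfl
        exact ⟨k, hk.le, rfl⟩
      have h2 := hgap s hs t ht
      simp only [Walk.passageTime_append, NNReal.coe_add, Nat.cast_zero, sub_zero] at hpω ⊢
      linarith

/-- The vertices at distance at most `D` from `v`. -/
def near (G : Multigraph V E) (v : V) (D : ℕ) : Set V := {s | G.dist s v ≤ D}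

/-- Two geodesics with common endpoints that agree near the ends but differ at an edge in the
middle, and that separate `x` from `y` in the sense that each path from `x` to `y` visits
neighbourhoods of certain vertices in the right order. -/
structure Tie (G : Multigraph V E) (x y : V) (D : ℕ) where
  /-- the length of the two geodesics -/
  N : ℕ
  /-- the length of the common initial part -/
  l : ℕ
  /-- the time at which the common final part begins -/
  r : ℕ
  /-- the time of the distinguished edge -/
  k₀ : ℕ
  /-- the vertices of the two geodesics -/
  P : Bool → ℕ → V
  /-- the edges of the two geodesics -/
  ed : Bool → ℕ → E
  l_le : l ≤ k₀
  lt_r : k₀ < r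
  r_le : r ≤ N
  boundary_ed : ∀ b, ∀ k < N, G.boundary (ed b k) = s(P b k, P b (k + 1))
  geodesic : ∀ b, G.IsGeodesicSeq (P b) N
  left_eq : ∀ k ≤ l, P true k = P false k
  right_eq : ∀ k, r ≤ k → k ≤ N → P true k = P false k
  left_ed : ∀ k < l, ed true k = ed false k
  right_ed : ∀ k, r ≤ k → k < N → ed true k = ed false k
  ne_ed : ∀ k < N, ed false k ≠ ed true k₀
  visits_left : ∀ π : Walk G x y, π.Visits (G.near (P true l) D)
  visits_right : ∀ π : Walk G x y, π.Visits (G.near (P true r) D)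
  visits_first : ∀ t ∈ G.near (P true l) D, ∀ π : Walk G x t, π.Visits (G.near (P true 0) D)
  visits_last : ∀ t ∈ G.near (P true r) D, ∀ π : Walk G y t, π.Visits (G.near (P true N) D)
  visits_order : ∀ t ∈ G.near (P true r) D, ∀ π : Walk G x t, π.Visits (G.near (P true l) D)
  visits_edge_left : ∀ t ∈ G.boundary (ed true k₀), ∀ π : Walk G x t,
    π.Visits (G.near (P true l) D)
  visits_edge_right : ∀ t ∈ G.boundary (ed true k₀), ∀ π : Walk G y t,
    π.Visits (G.near (P true r) D)

namespace Tie

variable {x y : V} {D : ℕ} (τ : Tie G x y D)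

/-- The distinguished edge. -/
def e₀ : E := τ.ed true τ.k₀

/-- The edges touching the balls of radius `N` about the endpoints of the geodesics. -/
def region : Set E :=
  {e | ∃ v ∈ G.boundary e, G.dist (τ.P true 0) v ≤ τ.N ∨ G.dist (τ.P true τ.N) v ≤ τ.N}

open Classical in
/-- The prescribed weights: `a` on the common parts of the geodesics, `s` on their middle parts,
`b` elsewhere. -/
def target (a s b : ℝ≥0) (e : E) : ℝ≥0 :=
  if ∃ β k, k < τ.N ∧ e = τ.ed β k ∧ (k < τ.l ∨ τ.r ≤ k) then a
  else if ∃ β k, k < τ.N ∧ e = τ.ed β k then s else b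

lemma P_zero (β : Bool) : τ.P β 0 = τ.P true 0 := by
  cases β
  · exact (τ.left_eq 0 (Nat.zero_le _)).symm
  · rfl

lemma P_N (β : Bool) : τ.P β τ.N = τ.P true τ.N := by
  cases β
  · exact (τ.right_eq _ τ.r_le le_rfl).symm
  · rfl

lemma P_l (β : Bool) : τ.P β τ.l = τ.P true τ.l := by
  cases β
  · exact (τ.left_eq _ le_rfl).symm
  · rfl

lemma P_r (β : Bool) : τ.P β τ.r = τ.P true τ.r := by
  cases β
  · exact (τ.right_eq _ le_rfl τ.r_le).symm
  · rfl

lemma dist_P (β : Bool) {k : ℕ} (hk : k ≤ τ.N) : G.dist (τ.P true 0) (τ.P β k) = k := by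
  rw [← τ.P_zero β, τ.geodesic β 0 k (Nat.zero_le _) hk, Nat.sub_zero]

lemma dist_P' (β : Bool) {k : ℕ} (hk : k ≤ τ.N) :
    G.dist (τ.P true τ.N) (τ.P β k) = τ.N - k := by
  rw [← τ.P_N β, dist_comm, τ.geodesic β k _ hk le_rfl]

lemma ed_inj {β β' : Bool} {k k' : ℕ} (hk : k < τ.N) (hk' : k' < τ.N)
    (h : τ.ed β k = τ.ed β' k') : k = k' := by
  have h1 := τ.boundary_ed β k hk
  have h2 := τ.boundary_ed β' k' hk'
  rw [h, h2, Sym2.eq_iff] at h1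
  have d1 := τ.dist_P β (k := k) (by omega)
  have d2 := τ.dist_P β (k := k + 1) (by omega)
  have d3 := τ.dist_P β' (k := k') (by omega)
  have d4 := τ.dist_P β' (k := k' + 1) (by omega)
  rcases h1 with ⟨h1, h1'⟩ | ⟨h1, h1'⟩ <;> rw [h1] at d3 <;> rw [h1'] at d4 <;> omega

lemma target_ed_outer (a s b : ℝ≥0) {β : Bool} {k : ℕ} (hk : k < τ.N) (hk' : k < τ.l ∨ τ.r ≤ k) :
    τ.target a s b (τ.ed β k) = a :=
  if_pos ⟨β, k, hk, rfl, hk'⟩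

lemma target_ed_inner (a s b : ℝ≥0) {β : Bool} {k : ℕ} (hk : τ.l ≤ k) (hk' : k < τ.r) :
    τ.target a s b (τ.ed β k) = s := by
  have hN : k < τ.N := hk'.trans_le τ.r_le
  unfold target
  rw [if_neg, if_pos ⟨β, k, hN, rfl⟩]
  rintro ⟨β', k', hk'N, h, h'⟩
  have := τ.ed_inj hN hk'N h
  omega

lemma target_of_ne (a s b : ℝ≥0) {e : E} (h : ∀ β, ∀ k < τ.N, e ≠ τ.ed β k) :
    τ.target a s b e = b := by
  unfold target
  rw [if_neg, if_neg]
  · rintro ⟨β, k, hk, h'⟩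
    exact h β k hk h'
  · rintro ⟨β, k, hk, h', -⟩
    exact h β k hk h'

lemma target_e₀ (a s b : ℝ≥0) : τ.target a s b τ.e₀ = s :=
  τ.target_ed_inner a s b τ.l_le τ.lt_r

lemma ed_mem_region {β : Bool} {k : ℕ} (hk : k < τ.N) : τ.ed β k ∈ τ.region :=
  ⟨τ.P β k, by rw [τ.boundary_ed β k hk]; simp, Or.inl (by rw [τ.dist_P β hk.le]; omega)⟩

lemma e₀_mem_region : τ.e₀ ∈ τ.region := τ.ed_mem_region (τ.lt_r.trans_le τ.r_le)

end Tie

/-- The slopes of the potential. -/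
def Tie.slope {x y : V} {D : ℕ} (τ : Tie G x y D) (a s : ℝ≥0) (η : ℝ) (k : ℕ) : ℝ :=
  if τ.l ≤ k ∧ k < τ.r then max (s - η) 0 else max (a - η) 0

/-- The potential as a function of the distance from the beginning of the geodesics. -/
def Tie.height {x y : V} {D : ℕ} (τ : Tie G x y D) (a s : ℝ≥0) (η : ℝ) (k : ℕ) : ℝ :=
  ∑ i ∈ Finset.range (min k τ.N), τ.slope a s η i

namespace Tie

variable {x y : V} {D : ℕ} (τ : Tie G x y D) {a s b : ℝ≥0} {η : ℝ}

lemma slope_nonneg (k : ℕ) : 0 ≤ τ.slope a s η k := by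
  unfold slope; split_ifs <;> exact le_max_right _ _

lemma slope_le (hab : a ≤ b) (hsb : s ≤ b) (hη : 0 ≤ η) (k : ℕ) : τ.slope a s η k ≤ b := by
  have h1 : (a : ℝ) ≤ b := hab
  have h2 : (s : ℝ) ≤ b := hsb
  unfold slope
  split_ifs <;> exact max_le (by linarith) b.2

lemma height_succ {k : ℕ} (hk : k < τ.N) :
    τ.height a s η (k + 1) = τ.height a s η k + τ.slope a s η k := by
  unfold height
  rw [min_eq_left (by omega), min_eq_left hk.le, Finset.sum_range_succ]

lemma height_of_ge {k : ℕ} (hk : τ.N ≤ k) : τ.height a s η k = τ.height a s η τ.N := by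
  unfold height
  rw [min_eq_right hk, min_self]

lemma height_mono : Monotone (τ.height a s η) := by
  refine monotone_nat_of_le_succ fun k => ?_
  by_cases hk : k < τ.N
  · rw [τ.height_succ hk]
    linarith [τ.slope_nonneg (a := a) (s := s) (η := η) k]
  · rw [τ.height_of_ge (k := k) (by omega), τ.height_of_ge (k := k + 1) (by omega)]

lemma height_add_le (hab : a ≤ b) (hsb : s ≤ b) (hη : 0 ≤ η) (k m : ℕ) :
    τ.height a s η (k + m) ≤ τ.height a s η k + m * b := by
  induction m with
  | zero => simp
  | succ m ih =>
    rw [← add_assoc]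
    push_cast
    have hb : (0 : ℝ) ≤ b := b.2
    by_cases hk : k + m < τ.N
    · rw [τ.height_succ hk]
      linarith [τ.slope_le hab hsb hη (k + m)]
    · rw [τ.height_of_ge (k := k + m + 1) (by omega)]
      rw [τ.height_of_ge (k := k + m) (by omega)] at ih
      linarith

lemma height_le_of_outer (hη : 0 ≤ η) {i j : ℕ} (hij : i ≤ j) (hj : j ≤ τ.N)
    (h : ∀ k, i ≤ k → k < j → ¬ (τ.l ≤ k ∧ k < τ.r)) :
    τ.height a s η j ≤ τ.height a s η i + ((j : ℝ) - i) * a := by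
  induction j, hij using Nat.le_induction with
  | base => simp
  | succ j hij ih =>
    have h1 := ih (by omega) fun k hk hk' => h k hk (by omega)
    rw [τ.height_succ (by omega), slope, if_neg (h j hij (by omega))]
    have : max ((a : ℝ) - η) 0 ≤ a := max_le (by linarith) a.2
    push_cast
    linarith

/-- The weights are close to the prescribed ones. -/
def Favourable (ω : E → ℝ≥0) (a s b : ℝ≥0) (η : ℝ) : Prop :=
  ∀ e ∈ τ.region, |(ω e : ℝ) - τ.target a s b e| ≤ η

variable {τ} {ω : E → ℝ≥0}

lemma Favourable.update [DecidableEq E] (h : τ.Favourable ω a s b η) (hη : 0 ≤ η) :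
    τ.Favourable (Function.update ω τ.e₀ s) a s b η := by
  intro e he
  by_cases h' : e = τ.e₀
  · subst h'
    simpa [τ.target_e₀] using hη
  · rw [Function.update_of_ne h']
    exact h e he

lemma Favourable.slope_le_ed (h : τ.Favourable ω a s b η) {β : Bool} {k : ℕ} (hk : k < τ.N) :
    τ.slope a s η k ≤ ω (τ.ed β k) := by
  have h1 := abs_le.1 (h _ (τ.ed_mem_region (β := β) hk))
  unfold slope
  split_ifs with h'
  · rw [τ.target_ed_inner a s b h'.1 h'.2] at h1
    exact max_le (by linarith) (ω _).2
  · rw [τ.target_ed_outer a s b hk (by omega)] at h1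
    exact max_le (by linarith) (ω _).2

lemma Favourable.ed_le_slope (h : τ.Favourable ω a s b η) {β : Bool} {k : ℕ} (hk : k < τ.N) :
    ω (τ.ed β k) ≤ τ.slope a s η k + 2 * η := by
  have h1 := abs_le.1 (h _ (τ.ed_mem_region (β := β) hk))
  unfold slope
  split_ifs with h'
  · rw [τ.target_ed_inner a s b h'.1 h'.2] at h1
    linarith [le_max_left ((s : ℝ) - η) 0]
  · rw [τ.target_ed_outer a s b hk (by omega)] at h1
    linarith [le_max_left ((a : ℝ) - η) 0]

lemma Favourable.le_of_ne (h : τ.Favourable ω a s b η) {e : E} (he : e ∈ τ.region)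
    (hne : ∀ β, ∀ k < τ.N, e ≠ τ.ed β k) : b - η ≤ ω e := by
  have h1 := abs_le.1 (h _ he)
  rw [τ.target_of_ne a s b hne] at h1
  linarith

lemma Favourable.le_add (h : τ.Favourable ω a s b η) (hab : a ≤ b) (hsb : s ≤ b) {e : E}
    (he : e ∈ τ.region) : ω e ≤ b + η := by
  have h1 := abs_le.1 (h _ he)
  have h2 : τ.target a s b e ≤ b := by
    unfold target
    split_ifs
    exacts [hab, hsb, le_rfl]
  have h3 : (τ.target a s b e : ℝ) ≤ b := h2
  linarith

/-- The potential is dominated by the weights. -/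
lemma Favourable.potential_le (hG : G.IsConnected) (h : τ.Favourable ω a s b η) (hab : a ≤ b)
    (hsb : s ≤ b) (hη : η ≤ b) (e : E) (u v : V) (he : G.boundary e = s(u, v)) :
    |τ.height a s η (G.dist (τ.P true 0) v) - τ.height a s η (G.dist (τ.P true 0) u)| ≤ ω e := by
  wlog huv : G.dist (τ.P true 0) u ≤ G.dist (τ.P true 0) v generalizing u v
  · rw [abs_sub_comm]
    exact this v u (he.trans Sym2.eq_swap) (by omega)
  rw [abs_of_nonneg (sub_nonneg.2 (τ.height_mono huv))]
  have h1 := hG.dist_triangle (τ.P true 0) u v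
  have h2 := dist_le_one_of_boundary he
  rcases Nat.eq_or_lt_of_le huv with h3 | h3
  · rw [h3, sub_self]
    exact (ω e).2
  have h4 : G.dist (τ.P true 0) v = G.dist (τ.P true 0) u + 1 := by omega
  rw [h4]
  by_cases hN : G.dist (τ.P true 0) u < τ.N
  · rw [τ.height_succ hN, add_sub_cancel_left]
    by_cases hne : ∀ β, ∀ k < τ.N, e ≠ τ.ed β k
    · have h5 := h.le_of_ne ⟨u, by rw [he]; simp, Or.inl hN.le⟩ hne
      refine le_trans ?_ h5
      have h6 : (a : ℝ) ≤ b := hab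
      have h7 : (s : ℝ) ≤ b := hsb
      unfold slope
      split_ifs <;> exact max_le (by linarith) (by linarith)
    · push Not at hne
      obtain ⟨β, k, hk, rfl⟩ := hne
      have h5 := τ.boundary_ed β k hk
      rw [he, Sym2.eq_iff] at h5
      have d1 := τ.dist_P β (k := k) (by omega)
      have d2 := τ.dist_P β (k := k + 1) (by omega)
      have h6 : G.dist (τ.P true 0) u = k := by
        rcases h5 with ⟨h5, h5'⟩ | ⟨h5, h5'⟩
        · rw [h5, d1]
        · rw [← h5] at d2
          rw [← h5'] at d1
          omega
      rw [h6]
      exact h.slope_le_ed hk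
  · rw [τ.height_of_ge (by omega), τ.height_of_ge (k := G.dist (τ.P true 0) u) (by omega)]
    simp

/-- A truncated distance from an end of the geodesics is dominated by the weights of the edges
off the corridor at that end. -/
lemma Favourable.truncated_le (hG : G.IsConnected) (h : τ.Favourable ω a s b η) (hη : η ≤ b)
    {o : V} {m : ℕ} (hm : m ≤ τ.N) (ho : o = τ.P true 0 ∨ o = τ.P true τ.N) {e : E} {u v : V}
    (he : G.boundary e = s(u, v))
    (hne : ∀ β, ∀ k < τ.N, e = τ.ed β k → m ≤ G.dist o u ∧ m ≤ G.dist o v) :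
    ((b : ℝ) - η) * (min (G.dist o v) m : ℕ) - (b - η) * (min (G.dist o u) m : ℕ) ≤ ω e := by
  have h1 := hG.dist_triangle o u v
  have h2 := dist_le_one_of_boundary he
  have hb : 0 ≤ (b : ℝ) - η := by linarith
  have hω : (0 : ℝ) ≤ ω e := (ω e).2
  by_cases hu : m ≤ G.dist o u
  · have h3 : ((min (G.dist o v) m : ℕ) : ℝ) ≤ (min (G.dist o u) m : ℕ) := by
      exact_mod_cast (min_le_right _ _).trans (le_min hu le_rfl)
    nlinarith
  · have h3 : ((min (G.dist o v) m : ℕ) : ℝ) ≤ (min (G.dist o u) m : ℕ) + 1 := by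
      norm_cast
      omega
    have h4 : (b : ℝ) - η ≤ ω e := by
      refine h.le_of_ne ⟨u, by rw [he]; simp, ?_⟩ fun β k hk hek => hu (hne β k hk hek).1
      rcases ho with rfl | rfl
      · left; omega
      · right; omega
    nlinarith


/-- Each path from `x` to `y` can be compared with one that follows the common parts of the two
geodesics. -/
lemma Favourable.exists_walks (hG : G.IsConnected) (h : τ.Favourable ω a s b η) (hab : a ≤ b)
    (hsb : s ≤ b) (hη : 0 ≤ η) (hηb : 2 * η ≤ b - a) (hD : D < τ.l) (hD' : D < τ.N - τ.r)
    (hl : 10 * b * D ≤ ((b : ℝ) - a) * τ.l)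
    (hr : 10 * b * D ≤ ((b : ℝ) - a) * (τ.N - τ.r : ℕ)) (π : Walk G x y) :
    ∃ (ρ₁ : Walk G x (τ.P true τ.l)) (ρ₂ : Walk G (τ.P true τ.r) y),
      τ.e₀ ∉ ρ₁.edges ∧ τ.e₀ ∉ ρ₂.edges ∧
      (ρ₁.passageTime ω : ℝ) + ρ₂.passageTime ω + τ.height a s η τ.r - τ.height a s η τ.l ≤
        π.passageTime ω + 2 * τ.N * η := by
  classical
  have hrN := τ.r_le
  have hlk := τ.l_le
  have hkr := τ.lt_r
  have ha0 : (0 : ℝ) ≤ a := a.2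
  have hηb' : η ≤ b := by linarith
  set Φ : V → ℝ := fun v => τ.height a s η (G.dist (τ.P true 0) v) with hΦdef
  have hΦP : ∀ β, ∀ k ≤ τ.N, Φ (τ.P β k) = τ.height a s η k := fun β k hk => by
    simp only [hΦdef, τ.dist_P β hk]
  have hΦ : ∀ e u v, G.boundary e = s(u, v) → Φ v - Φ u ≤ ω e := fun e u v he =>
    (le_abs_self _).trans (h.potential_le hG hab hsb hηb' e u v he)
  have hΦ' : ∀ e u v, G.boundary e = s(u, v) → -Φ v - -Φ u ≤ ω e := fun e u v he => by
    have := (neg_le_abs _).trans (h.potential_le hG hab hsb hηb' e u v he)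
    simp only [hΦdef]
    linarith
  have hΦdist : ∀ u v, Φ v ≤ Φ u + G.dist u v * b := fun u v =>
    (τ.height_mono (hG.dist_triangle (τ.P true 0) u v)).trans
      (τ.height_add_le hab hsb hη _ _)
  have hdist₀ : ∀ t ∈ G.boundary τ.e₀, τ.k₀ ≤ G.dist (τ.P true 0) t ∧
      τ.N - (τ.k₀ + 1) ≤ G.dist (τ.P true τ.N) t := by
    intro t ht
    have hk₀ : τ.k₀ < τ.N := by omega
    rw [e₀, τ.boundary_ed true _ hk₀, Sym2.mem_iff] at ht
    rcases ht with rfl | rfl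
    · rw [τ.dist_P true hk₀.le, τ.dist_P' true hk₀.le]; omega
    · rw [τ.dist_P true (k := τ.k₀ + 1) (by omega), τ.dist_P' true (k := τ.k₀ + 1) (by omega)]
      omega
  have hbD : (0 : ℝ) ≤ D * (b + η) := by positivity
  -- short paths to the endpoints of the geodesics
  have hshort : ∀ o, (o = τ.P true 0 ∨ o = τ.P true τ.N) →
      (∀ t ∈ G.boundary τ.e₀, D < G.dist o t) → ∀ q ∈ G.near o D,
      ∃ p : Walk G q o, τ.e₀ ∉ p.edges ∧ (p.passageTime ω : ℝ) ≤ D * (b + η) := by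
    intro o ho hoe q hq
    obtain ⟨p, hp⟩ := hG.exists_length_eq q o
    have hpD : p.length ≤ D := hp.trans_le hq
    have hball : ∀ e ∈ p.edges, ∀ t ∈ G.boundary e, G.dist o t ≤ D := by
      intro e he t ht
      obtain ⟨_, rfl, -, h2⟩ := (p.mem_of_visits_edge he ht).exists_dist_le
      rw [dist_comm]
      omega
    refine ⟨p, fun hmem => ?_, ?_⟩
    · obtain ⟨t, ht⟩ : ∃ t, t ∈ G.boundary τ.e₀ := ⟨_, Sym2.out_fst_mem _⟩
      have h1 := hball _ hmem t ht
      have h2 := hoe t ht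
      omega
    · refine (p.passageTime_le_length_mul (B := b + η) fun e he => h.le_add hab hsb ?_).trans ?_
      · obtain ⟨t, ht⟩ : ∃ t, t ∈ G.boundary e := ⟨_, Sym2.out_fst_mem _⟩
        have h1 := hball e he t ht
        refine ⟨t, ht, ?_⟩
        rcases ho with rfl | rfl
        · left; omega
        · right; omega
      · have : (p.length : ℝ) ≤ D := by exact_mod_cast hpD
        have hb : (0 : ℝ) ≤ b + η := by positivity
        gcongr
  -- the first visit to the left and the last visit to the right neighbourhood
  obtain ⟨t₁, ht₁, π₁, π', rfl, hfirst⟩ := (τ.visits_left π).exists_first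
  have hπ' : π'.reverse.Visits (G.near (τ.P true τ.r) D) := by
    refine Walk.Visits.reverse ?_
    rcases Walk.visits_append.1 (τ.visits_right (π₁.append π')) with ⟨q, hq, p₁, p₂, rfl⟩ | h'
    · obtain ⟨q', hq', p₁₁, p₁₂, rfl⟩ := τ.visits_order q hq p₁
      have h1 := hfirst q' hq' p₁₁ (p₁₂.append p₂) (Walk.append_assoc _ _ _)
      rw [Walk.length_append] at h1
      obtain rfl := p₂.eq_of_length_eq_zero (by omega)
      exact Walk.visits_start _ hq
    · exact h'
  obtain ⟨t₂, ht₂, π₃, π₂, hsplit, hlast⟩ := hπ'.exists_first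
  obtain rfl : π' = π₂.reverse.append π₃.reverse := by
    rw [← Walk.reverse_append, ← hsplit, Walk.reverse_reverse]
  have he₁ : τ.e₀ ∉ π₁.edges := by
    intro hmem
    obtain ⟨u, v, huv, q₁, q₂, rfl⟩ := π₁.exists_split_of_mem_edges hmem
    obtain ⟨w, hw, q₁₁, q₁₂, rfl⟩ :=
      τ.visits_edge_left u (by rw [e₀] at huv; rw [huv]; simp) q₁
    have h1 := hfirst w hw q₁₁ (q₁₂.append (.cons _ huv q₂)) (Walk.append_assoc _ _ _)
    simp at h1
  have he₃ : τ.e₀ ∉ π₃.edges := by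
    intro hmem
    obtain ⟨u, v, huv, q₁, q₂, rfl⟩ := π₃.exists_split_of_mem_edges hmem
    obtain ⟨w, hw, q₁₁, q₁₂, rfl⟩ :=
      τ.visits_edge_right u (by rw [e₀] at huv; rw [huv]; simp) q₁
    have h1 := hlast w hw q₁₁ (q₁₂.append (.cons _ huv q₂)) (Walk.append_assoc _ _ _)
    simp at h1
  -- the left corridor
  obtain ⟨ρ₁, hρ₁, hρ₁ω⟩ := exists_corridor_walk ω τ.e₀ (τ.P true) (τ.ed true) τ.l
    (fun k hk => τ.boundary_ed true k (by omega))
    (fun k hk hk' => by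
      have := τ.ed_inj (β := true) (β' := true) (k := k) (k' := τ.k₀) (by omega) (by omega) hk'
      omega)
    Φ (fun v => (b - η) * (min (G.dist (τ.P true 0) v) τ.l : ℕ)) (2 * η) (D * (b + η))
    (by linarith) hΦ
    (fun k hk => by
      rw [hΦP _ _ (by omega), hΦP _ _ (by omega), τ.height_succ (by omega)]
      linarith [h.ed_le_slope (β := true) (k := k) (by omega)])
    (fun e u v hne he => h.truncated_le hG hηb' (by omega) (Or.inl rfl) he
      fun β k hk hek => by
        have hkl : τ.l ≤ k := by
          by_contra hlt
          push Not at hlt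
          refine hne k hlt (hek.trans ?_)
          cases β
          · exact (τ.left_ed k hlt).symm
          · rfl
        have h5 := τ.boundary_ed β k hk
        rw [← hek, he, Sym2.eq_iff] at h5
        have d1 := τ.dist_P β (k := k) (by omega)
        have d2 := τ.dist_P β (k := k + 1) (by omega)
        rcases h5 with ⟨rfl, rfl⟩ | ⟨rfl, rfl⟩ <;> omega)
    (G.near (τ.P true 0) D) (G.near (τ.P true τ.l) D)
    (hshort _ (Or.inl rfl) fun t ht => by have := (hdist₀ t ht).1; omega)
    (fun q hq t ht => by
      have h1 : Φ t ≤ τ.height a s η τ.l + D * b := by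
        refine (hΦdist (τ.P true τ.l) t).trans ?_
        rw [hΦP _ _ (by omega), dist_comm]
        have : (G.dist t (τ.P true τ.l) : ℝ) ≤ D := by exact_mod_cast ht
        gcongr
      have h2 : Φ (τ.P true 0) = τ.height a s η 0 := hΦP _ _ (by omega)
      have h3 := τ.height_le_of_outer (a := a) (s := s) hη (Nat.zero_le τ.l) (by omega)
        fun k _ hk => by omega
      have h4 : (min (G.dist (τ.P true 0) q) τ.l : ℕ) ≤ D := by
        have : G.dist q (τ.P true 0) ≤ D := hq
        rw [dist_comm] at this
        omega
      have h5 : τ.l ≤ (min (G.dist (τ.P true 0) t) τ.l : ℕ) + D := by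
        have h6 : G.dist t (τ.P true τ.l) ≤ D := ht
        have h7 := hG.dist_triangle (τ.P true 0) t (τ.P true τ.l)
        rw [τ.dist_P true (by omega)] at h7
        omega
      have h4' : ((min (G.dist (τ.P true 0) q) τ.l : ℕ) : ℝ) ≤ D := by exact_mod_cast h4
      have h5' : (τ.l : ℝ) ≤ (min (G.dist (τ.P true 0) t) τ.l : ℕ) + D := by exact_mod_cast h5
      have hbη : 0 ≤ (b : ℝ) - η := by linarith
      have h8 := mul_le_mul_of_nonneg_left h4' hbη
      have h9 := mul_le_mul_of_nonneg_left h5' hbη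
      have hDη : (D : ℝ) * η ≥ 0 := by positivity
      have hlη := mul_le_mul_of_nonneg_left hηb (Nat.cast_nonneg (α := ℝ) τ.l)
      simp only [Nat.cast_zero, sub_zero] at h3
      rw [h2]
      nlinarith)
    ht₁ π₁ (τ.visits_first t₁ ht₁ π₁) he₁
  -- the right corridor
  have hright := exists_corridor_walk ω τ.e₀ (fun k => τ.P true (τ.N - k))
    (fun k => τ.ed true (τ.N - (k + 1))) (τ.N - τ.r)
    (fun k hk => by
      rw [τ.boundary_ed true _ (by omega), show τ.N - (k + 1) + 1 = τ.N - k by omega,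
        Sym2.eq_swap])
    (fun k hk hk' => by
      have := τ.ed_inj (β := true) (β' := true) (k' := τ.k₀) (by omega) (by omega) hk'
      omega)
    (fun v => -Φ v) (fun v => (b - η) * (min (G.dist (τ.P true τ.N) v) (τ.N - τ.r) : ℕ))
    (2 * η) (D * (b + η)) (by linarith) hΦ'
    (fun k hk => by
      have h1 : τ.N - k = τ.N - (k + 1) + 1 := by omega
      rw [hΦP _ _ (by omega), hΦP _ _ (by omega), h1, τ.height_succ (by omega)]
      linarith [h.ed_le_slope (β := true) (k := τ.N - (k + 1)) (by omega)])
    (fun e u v hne he => h.truncated_le hG hηb' (by omega) (Or.inr rfl) he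
      fun β k hk hek => by
        have hkl : k < τ.r := by
          by_contra hlt
          push Not at hlt
          refine hne (τ.N - (k + 1)) (by omega) (hek.trans ?_)
          rw [show τ.N - (τ.N - (k + 1) + 1) = k by omega]
          cases β
          · exact (τ.right_ed k hlt hk).symm
          · rfl
        have h5 := τ.boundary_ed β k hk
        rw [← hek, he, Sym2.eq_iff] at h5
        have d1 := τ.dist_P' β (k := k) (by omega)
        have d2 := τ.dist_P' β (k := k + 1) (by omega)
        rcases h5 with ⟨rfl, rfl⟩ | ⟨rfl, rfl⟩ <;> omega)
    (G.near (τ.P true τ.N) D) (G.near (τ.P true τ.r) D)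
    (hshort _ (Or.inr rfl) fun t ht => by have := (hdist₀ t ht).2; omega)
    (fun q hq t ht => by
      have h1 : τ.height a s η τ.r ≤ Φ t + D * b := by
        have h0 := hΦdist t (τ.P true τ.r)
        rw [hΦP _ _ (by omega)] at h0
        refine h0.trans ?_
        have : (G.dist t (τ.P true τ.r) : ℝ) ≤ D := by exact_mod_cast ht
        gcongr
      have h2 : Φ (τ.P true (τ.N - 0)) = τ.height a s η τ.N := hΦP _ _ (by omega)
      have h3 := τ.height_le_of_outer (a := a) (s := s) hη hrN le_rfl
        fun k hk _ => by omega
      have h4 : (min (G.dist (τ.P true τ.N) q) (τ.N - τ.r) : ℕ) ≤ D := by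
        have : G.dist q (τ.P true τ.N) ≤ D := hq
        rw [dist_comm] at this
        omega
      have h5 : τ.N - τ.r ≤ (min (G.dist (τ.P true τ.N) t) (τ.N - τ.r) : ℕ) + D := by
        have h6 : G.dist t (τ.P true τ.r) ≤ D := ht
        have h7 := hG.dist_triangle (τ.P true τ.N) t (τ.P true τ.r)
        rw [τ.dist_P' true (by omega)] at h7
        omega
      have h4' : ((min (G.dist (τ.P true τ.N) q) (τ.N - τ.r) : ℕ) : ℝ) ≤ D := by exact_mod_cast h4
      have h5' : ((τ.N - τ.r : ℕ) : ℝ) ≤ (min (G.dist (τ.P true τ.N) t) (τ.N - τ.r) : ℕ) + D := by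
        exact_mod_cast h5
      have hbη : 0 ≤ (b : ℝ) - η := by linarith
      have h8 := mul_le_mul_of_nonneg_left h4' hbη
      have h9 := mul_le_mul_of_nonneg_left h5' hbη
      have hDη : (D : ℝ) * η ≥ 0 := by positivity
      have hlη := mul_le_mul_of_nonneg_left hηb (Nat.cast_nonneg (α := ℝ) (τ.N - τ.r))
      rw [← Nat.cast_sub hrN] at h3
      rw [h2]
      nlinarith)
    ht₂ π₃ (τ.visits_last t₂ ht₂ π₃) he₃
  have hNr : τ.N - (τ.N - τ.r) = τ.r := by omega
  beta_reduce at hright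
  rw [hNr] at hright
  obtain ⟨ρ₂, hρ₂, hρ₂ω⟩ := hright
  refine ⟨ρ₁, ρ₂.reverse, hρ₁, by simpa using hρ₂, ?_⟩
  have hmid := π₂.reverse.sub_le_passageTime ω Φ fun e _ => hΦ e
  rw [hΦP _ _ (by omega)] at hρ₁ω hρ₂ω
  simp only [Walk.passageTime_append, Walk.passageTime_reverse, NNReal.coe_add] at hmid ⊢
  have hlN : (τ.l : ℝ) + (τ.N - τ.r : ℕ) ≤ τ.N := by
    norm_cast
    omega
  have := mul_le_mul_of_nonneg_right hlN hη
  linarith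

/-- As a function of the weight of the distinguished edge, the passage time is, up to a small
error, a truncation of the identity at `s`. -/
lemma Favourable.exists_abs_sub_le [DecidableEq E] (hG : G.IsConnected)
    (h : τ.Favourable ω a s b η) (hab : a ≤ b)
    (hsb : s ≤ b) (hη : 0 ≤ η) (hηb : 2 * η ≤ b - a) (hD : D < τ.l) (hD' : D < τ.N - τ.r)
    (hl : 10 * b * D ≤ ((b : ℝ) - a) * τ.l)
    (hr : 10 * b * D ≤ ((b : ℝ) - a) * (τ.N - τ.r : ℕ)) :
    ∃ A : ℝ, ∀ t : ℝ≥0,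
      |(G.passageTime (Function.update ω τ.e₀ t) x y : ℝ) - (A + min t s)| ≤ 2 * τ.N * η := by
  have hrN := τ.r_le
  have hlk := τ.l_le
  have hkr := τ.lt_r
  set ωs := Function.update ω τ.e₀ s with hωs
  have hs : τ.Favourable ωs a s b η := h.update hη
  have key := hs.exists_walks hG hab hsb hη hηb hD hD' hl hr
  obtain ⟨π₀⟩ := hG x y
  obtain ⟨σ₁, σ₂, hσ₁, hσ₂, -⟩ := key π₀
  let F := {ρ : Walk G x (τ.P true τ.l) × Walk G (τ.P true τ.r) y //
    τ.e₀ ∉ ρ.1.edges ∧ τ.e₀ ∉ ρ.2.edges}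
  have hF : Nonempty F := ⟨⟨(σ₁, σ₂), hσ₁, hσ₂⟩⟩
  let f : F → ℝ := fun ρ => (ρ.1.1.passageTime ωs : ℝ) + ρ.1.2.passageTime ωs
  have hf : BddBelow (Set.range f) := ⟨0, by rintro _ ⟨ρ, rfl⟩; positivity⟩
  set H := τ.height a s η τ.r - τ.height a s η τ.l with hH
  refine ⟨(⨅ ρ, f ρ) + H - s, fun t => ?_⟩
  set ωt := Function.update ω τ.e₀ t with hωt
  have hne : ∀ e, e ≠ τ.e₀ → ωt e = ωs e := fun e he => by
    rw [hωt, hωs, Function.update_of_ne he, Function.update_of_ne he]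
  have htime : ∀ p : Walk G x y, (G.passageTime ωt x y : ℝ) ≤ p.passageTime ωt := fun p =>
    NNReal.coe_le_coe.2 (ciInf_le ⟨0, fun _ _ => zero_le⟩ p)
  set Φ : V → ℝ := fun v => τ.height a s η (G.dist (τ.P true 0) v) with hΦdef
  have hΦP : ∀ β, ∀ k ≤ τ.N, Φ (τ.P β k) = τ.height a s η k := fun β k hk => by
    simp only [hΦdef, τ.dist_P β hk]
  have hseg : ∀ β i j, i ≤ j → j ≤ τ.N →
      (∀ k, i ≤ k → k < j → τ.ed β k ≠ τ.e₀) →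
      ∃ p : Walk G (τ.P β i) (τ.P β j),
        (p.passageTime ωt : ℝ) ≤ τ.height a s η j - τ.height a s η i + ((j : ℝ) - i) * (2 * η) := by
    intro β i j hij hj hav
    obtain ⟨p, hp, hpω⟩ := exists_walk_of_potential ωs (τ.P β) (τ.ed β) Φ (2 * η) hij
      (fun k _ hk => τ.boundary_ed β k (by omega)) fun k _ hk => by
        rw [hΦP _ _ (by omega), hΦP _ _ (by omega), τ.height_succ (by omega)]
        linarith [hs.ed_le_slope (β := β) (k := k) (by omega)]
    rw [hΦP _ _ hj, hΦP _ _ (by omega)] at hpω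
    refine ⟨p, (le_of_eq ?_).trans hpω⟩
    rw [p.passageTime_congr fun e he => ?_]
    obtain ⟨k, hk, hk', rfl⟩ := hp e he
    exact hne _ (hav k hk hk')
  have hNη : 0 ≤ (τ.N : ℝ) * η := by positivity
  -- following either of the geodesics
  have hupper : ∀ (c : ℝ), (∃ q : Walk G (τ.P true τ.l) (τ.P true τ.r),
      (q.passageTime ωt : ℝ) ≤ c) → (G.passageTime ωt x y : ℝ) ≤ (⨅ ρ, f ρ) + c := by
    rintro c ⟨q, hq⟩
    rw [← sub_le_iff_le_add]
    refine le_ciInf fun ρ => ?_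
    have h1 := htime (ρ.1.1.append (q.append ρ.1.2))
    have h2 := ρ.1.1.passageTime_congr fun e he => hne e fun h' => ρ.2.1 (h' ▸ he)
    have h3 := ρ.1.2.passageTime_congr fun e he => hne e fun h' => ρ.2.2 (h' ▸ he)
    simp only [Walk.passageTime_append, NNReal.coe_add, h2, h3] at h1
    simp only [f]
    linarith
  have hup₁ : (G.passageTime ωt x y : ℝ) ≤ (⨅ ρ, f ρ) + (H + 2 * τ.N * η) := by
    refine hupper _ ?_
    have hq' := hseg false τ.l τ.r (by omega) hrN fun k _ hk => τ.ne_ed k (by omega)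
    rw [τ.P_l, τ.P_r] at hq'
    obtain ⟨q, hq⟩ := hq'
    refine ⟨q, hq.trans ?_⟩
    have h1 : (τ.r : ℝ) - τ.l ≤ τ.N := by
      have : (τ.r : ℝ) ≤ τ.N := by exact_mod_cast hrN
      linarith [Nat.cast_nonneg (α := ℝ) τ.l]
    have := mul_le_mul_of_nonneg_right h1 hη
    linarith
  have hup₂ : (G.passageTime ωt x y : ℝ) ≤ (⨅ ρ, f ρ) + (H - s + t + 2 * τ.N * η) := by
    refine hupper _ ?_
    obtain ⟨q₁, hq₁⟩ := hseg true τ.l τ.k₀ hlk (by omega) fun k _ hk h' => by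
      have := τ.ed_inj (β := true) (β' := true) (k := k) (k' := τ.k₀) (by omega) (by omega) h'
      omega
    obtain ⟨q₂, hq₂⟩ := hseg true (τ.k₀ + 1) τ.r hkr hrN fun k hk hk' h' => by
      have := τ.ed_inj (β := true) (β' := true) (k := k) (k' := τ.k₀) (by omega) (by omega) h'
      omega
    have he₀ : G.boundary τ.e₀ = s(τ.P true τ.k₀, τ.P true (τ.k₀ + 1)) :=
      τ.boundary_ed true τ.k₀ (by omega)
    refine ⟨q₁.append (.cons τ.e₀ he₀ q₂), ?_⟩
    have ht : ωt τ.e₀ = t := Function.update_self ..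
    have hslope : (s : ℝ) ≤ τ.slope a s η τ.k₀ + η := by
      rw [slope, if_pos ⟨hlk, hkr⟩]
      linarith [le_max_left ((s : ℝ) - η) 0]
    have hh := τ.height_succ (a := a) (s := s) (η := η) (k := τ.k₀) (by omega)
    simp only [Walk.passageTime_append, Walk.passageTime_cons, NNReal.coe_add, ht]
    push_cast at hq₂
    have h1 : (τ.r : ℝ) - τ.l ≤ τ.N := by
      have : (τ.r : ℝ) ≤ τ.N := by exact_mod_cast hrN
      linarith [Nat.cast_nonneg (α := ℝ) τ.l]
    have := mul_le_mul_of_nonneg_right h1 hη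
    linarith
  -- the lower bound
  simp only [NNReal.coe_min]
  have hlow : (⨅ ρ, f ρ) + H - s + min (t : ℝ) s - 2 * τ.N * η ≤ G.passageTime ωt x y := by
    have hnn : Nonempty (Walk G x y) := ⟨π₀⟩
    rw [passageTime, NNReal.coe_iInf]
    refine le_ciInf fun p => ?_
    obtain ⟨q, hq, hqp⟩ := p.exists_nodup
    refine le_trans ?_ (NNReal.coe_le_coe.2 (Walk.passageTime_le_of_sublist hqp ωt))
    obtain ⟨ρ₁, ρ₂, h₁, h₂, hρ⟩ := key q
    have h3 : (⨅ ρ, f ρ) ≤ f ⟨(ρ₁, ρ₂), h₁, h₂⟩ := ciInf_le hf _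
    have h4 := q.passageTime_update hq ω τ.e₀ t
    have h5 := q.passageTime_update hq ω τ.e₀ s
    rw [← hωt] at h4
    rw [← hωs] at h5
    have h6 : (q.passageTime ωs : ℝ) - s + min (t : ℝ) s ≤ q.passageTime ωt := by
      rw [h4, h5]
      have h7 : (min (t : ℝ) s) ≤ t := min_le_left _ _
      have h8 : (min (t : ℝ) s) ≤ s := min_le_right _ _
      split_ifs
      · push_cast; linarith
      · push_cast; linarith
    simp only [f] at h3
    linarith
  rw [abs_le]
  constructor
  · linarith
  · rcases le_total (t : ℝ) s with hts | hts
    · rw [min_eq_left hts]; linarith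
    · rw [min_eq_right hts]; linarith

end Tie

end Multigraph
end FPP

namespace FPP

/-- The gain of replacing the law `ν` of a weight, truncated at `s`, by `ν'`. -/
def truncationGain (ν ν' : Measure ℝ≥0) (s : ℝ≥0) : ℝ :=
  ∫ t : ℝ≥0, ((min t s : ℝ≥0) : ℝ) ∂ν - ∫ t : ℝ≥0, ((min t s : ℝ≥0) : ℝ) ∂ν'

lemma integrable_min (ν : Measure ℝ≥0) [IsProbabilityMeasure ν] (s : ℝ≥0) :
    Integrable (fun t : ℝ≥0 => ((min t s : ℝ≥0) : ℝ)) ν := by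
  refine Integrable.mono' (integrable_const (s : ℝ)) ?_ (ae_of_all _ fun t => ?_)
  · exact (measurable_id.min measurable_const).coe_nnreal_real.aestronglyMeasurable
  · rw [Real.norm_of_nonneg (NNReal.coe_nonneg _)]
    exact NNReal.coe_le_coe.2 (min_le_right _ _)

lemma MoreVariable.truncationGain_nonneg {ν ν' : Measure ℝ≥0} [IsProbabilityMeasure ν]
    [IsProbabilityMeasure ν'] (h : MoreVariable ν' ν) (s : ℝ≥0) : 0 ≤ truncationGain ν ν' s := by
  have := h (fun t => min t s) ((concaveOn_id convex_univ).inf (concaveOn_const _ convex_univ))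
    (fun a b hab => min_le_min_right _ hab)
  simp only [← NNReal.coe_min] at this
  exact sub_nonneg.2 (this (integrable_min ν' s) (integrable_min ν s))

section Product

variable {E : Type*} [DecidableEq E]

lemma infinitePi_eq_map_update (μ μ' : E → Measure ℝ≥0) [∀ i, IsProbabilityMeasure (μ i)]
    [∀ i, IsProbabilityMeasure (μ' i)] (e : E) (h : ∀ i, i ≠ e → μ' i = μ i) :
    Measure.infinitePi μ' = ((Measure.infinitePi μ).prod (μ' e)).map
      fun q => Function.update q.1 e q.2 := by
  have hm : Measurable fun q : (E → ℝ≥0) × ℝ≥0 => Function.update q.1 e q.2 := by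
    refine measurable_pi_lambda _ fun i => ?_
    by_cases hi : i = e
    · subst hi
      simpa using measurable_snd
    · simp only [Function.update_of_ne hi]
      exact (measurable_pi_apply i).comp measurable_fst
  refine (Measure.eq_infinitePi μ' fun s t ht => ?_).symm
  rw [Measure.map_apply hm (MeasurableSet.pi s.countable_toSet fun i _ => ht i)]
  have hpre : (fun q : (E → ℝ≥0) × ℝ≥0 => Function.update q.1 e q.2) ⁻¹' (s : Set E).pi t =
      ((s.erase e : Finset E) : Set E).pi t ×ˢ (if e ∈ s then t e else Set.univ) := by
    ext ⟨ω, r⟩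
    simp only [Set.mem_preimage, Set.mem_pi, Set.mem_prod, Finset.mem_coe, Finset.mem_erase]
    constructor
    · refine fun hq => ⟨fun i hi => ?_, ?_⟩
      · simpa [Function.update_of_ne hi.1] using hq i hi.2
      · split_ifs with he
        · simpa using hq e he
        · trivial
    · rintro ⟨h1, h2⟩ i hi
      by_cases hie : i = e
      · subst hie
        simpa [hi] using h2
      · simpa [Function.update_of_ne hie] using h1 i ⟨hie, hi⟩
  rw [hpre, Measure.prod_prod, Measure.infinitePi_pi _ fun i _ => ht i]
  have hprod : ∏ i ∈ s.erase e, μ i (t i) = ∏ i ∈ s.erase e, μ' i (t i) :=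
    Finset.prod_congr rfl fun i hi => by rw [h i (Finset.ne_of_mem_erase hi)]
  rw [hprod]
  split_ifs with he
  · rw [Finset.prod_erase_mul _ _ he]
  · rw [measure_univ, mul_one, Finset.erase_eq_of_notMem he]

end Product

namespace Multigraph

variable {V : Type*} {E : Type*} {G : Multigraph V E} {x y : V}

/-- The infimum of the passage times of a set of paths. -/
def infTime (F : Set (Walk G x y)) (ω : E → ℝ≥0) : ℝ≥0 := ⨅ p : F, p.1.passageTime ω

lemma infTime_le {F : Set (Walk G x y)} {p : Walk G x y} (hp : p ∈ F) (ω : E → ℝ≥0) :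
    infTime F ω ≤ p.passageTime ω :=
  ciInf_le ⟨0, fun _ _ => zero_le⟩ (⟨p, hp⟩ : F)

lemma infTime_anti {F F' : Set (Walk G x y)} (h : F ⊆ F') (hF : F.Nonempty) (ω : E → ℝ≥0) :
    infTime F' ω ≤ infTime F ω := by
  have := hF.to_subtype
  exact le_ciInf fun p => infTime_le (h p.2) ω

/-- The paths without repeated edges. -/
def trails (G : Multigraph V E) (x y : V) : Set (Walk G x y) := {p | p.edges.Nodup}

lemma IsConnected.trails_nonempty (hG : G.IsConnected) (x y : V) : (G.trails x y).Nonempty := by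
  obtain ⟨p⟩ := hG x y
  obtain ⟨q, hq, -⟩ := p.exists_nodup
  exact ⟨q, hq⟩

lemma IsConnected.passageTime_eq_infTime (hG : G.IsConnected) (ω : E → ℝ≥0) :
    G.passageTime ω x y = infTime (G.trails x y) ω := by
  have h1 := (hG.trails_nonempty x y).to_subtype
  have h2 := hG x y
  refine le_antisymm (le_ciInf fun p => ciInf_le ⟨0, fun _ _ => zero_le⟩ p.1) ?_
  refine le_ciInf fun p => ?_
  obtain ⟨q, hq, hqp⟩ := p.exists_nodup
  exact (infTime_le hq ω).trans (Walk.passageTime_le_of_sublist hqp ω)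

lemma Walk.measurable_passageTime (p : Walk G x y) :
    Measurable fun ω : E → ℝ≥0 => p.passageTime ω := by
  induction p with
  | nil => exact measurable_const
  | cons e he p ih =>
    simp only [Walk.passageTime_cons]
    exact (measurable_pi_apply e).add ih

lemma measurable_infTime [Countable E] (F : Set (Walk G x y)) :
    Measurable fun ω : E → ℝ≥0 => infTime F ω :=
  Measurable.iInf fun p => p.1.measurable_passageTime

section Integral

variable (μ : E → Measure ℝ≥0) [∀ i, IsProbabilityMeasure (μ i)]

lemma integrable_eval (hμ : ∀ i, HasFiniteMean (μ i)) (e : E) :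
    Integrable (fun ω : E → ℝ≥0 => (ω e : ℝ)) (Measure.infinitePi μ) :=
  (measurePreserving_eval_infinitePi μ e).integrable_comp_of_integrable (hμ e)

lemma Walk.integrable_passageTime (hμ : ∀ i, HasFiniteMean (μ i)) (p : Walk G x y) :
    Integrable (fun ω : E → ℝ≥0 => (p.passageTime ω : ℝ)) (Measure.infinitePi μ) := by
  induction p with
  | nil => simp
  | cons e he p ih =>
    simp only [Walk.passageTime_cons, NNReal.coe_add]
    exact (integrable_eval μ hμ e).add ih

lemma integrable_infTime [Countable E] (hμ : ∀ i, HasFiniteMean (μ i)) {F : Set (Walk G x y)}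
    (hF : F.Nonempty) :
    Integrable (fun ω : E → ℝ≥0 => (infTime F ω : ℝ)) (Measure.infinitePi μ) := by
  obtain ⟨p, hp⟩ := hF
  refine (p.integrable_passageTime μ hμ).mono'
    (measurable_infTime F).coe_nnreal_real.aestronglyMeasurable (ae_of_all _ fun ω => ?_)
  rw [Real.norm_of_nonneg (NNReal.coe_nonneg _)]
  exact NNReal.coe_le_coe.2 (infTime_le hp ω)

end Integral

section OneEdge

variable [DecidableEq E]

lemma measurable_infTime_update [Countable E] (F : Set (Walk G x y)) (ω : E → ℝ≥0) (e : E) :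
    Measurable fun t : ℝ≥0 => (infTime F (Function.update ω e t) : ℝ) :=
  ((measurable_infTime F).comp (measurable_update ω)).coe_nnreal_real

lemma integrable_infTime_update [Countable E] {F : Set (Walk G x y)} (hF : F.Nonempty)
    (hF' : F ⊆ G.trails x y) (ω : E → ℝ≥0) (e : E) {ν : Measure ℝ≥0} [IsProbabilityMeasure ν]
    (hν : HasFiniteMean ν) :
    Integrable (fun t : ℝ≥0 => (infTime F (Function.update ω e t) : ℝ)) ν := by
  obtain ⟨p, hp⟩ := hF
  refine ((integrable_const (p.passageTime (Function.update ω e 0) : ℝ)).add hν).mono'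
    (measurable_infTime_update F ω e).aestronglyMeasurable (ae_of_all _ fun t => ?_)
  rw [Real.norm_of_nonneg (NNReal.coe_nonneg _)]
  refine (NNReal.coe_le_coe.2 (infTime_le hp _)).trans ?_
  rw [p.passageTime_update (hF' hp)]
  simp only [Pi.add_apply]
  split_ifs <;> push_cast <;> linarith [t.2]

/-- The infimum of the passage times, as a function of the weight of one edge, extends to a
nondecreasing concave function. -/
lemma exists_concave_extension {F : Set (Walk G x y)} (hF : F.Nonempty)
    (hF' : F ⊆ G.trails x y) (ω : E → ℝ≥0) (e : E) :
    ∃ ψ : ℝ → ℝ, ConcaveOn ℝ Set.univ ψ ∧ Monotone ψ ∧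
      ∀ t : ℝ≥0, ψ t = infTime F (Function.update ω e t) := by
  have := hF.to_subtype
  let f : ℝ → F → ℝ := fun r p =>
    (p.1.passageTime (Function.update ω e 0) : ℝ) + if e ∈ p.1.edges then r else 0
  have hf : ∀ r, BddBelow (Set.range (f r)) := fun r => by
    refine ⟨-|r|, ?_⟩
    rintro _ ⟨p, rfl⟩
    have h1 : (0 : ℝ) ≤ p.1.passageTime (Function.update ω e 0) := NNReal.coe_nonneg _
    have h2 := neg_abs_le r
    have h3 := abs_nonneg r
    simp only [f]
    split_ifs <;> linarith
  refine ⟨fun r => ⨅ p, f r p, ⟨convex_univ, fun r _ r' _ α β hα hβ hαβ => ?_⟩,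
    fun r r' hr => ?_, fun t => ?_⟩
  · refine le_ciInf fun p => ?_
    have h1 := mul_le_mul_of_nonneg_left (ciInf_le (hf r) p) hα
    have h2 := mul_le_mul_of_nonneg_left (ciInf_le (hf r') p) hβ
    simp only [smul_eq_mul]
    refine (add_le_add h1 h2).trans (le_of_eq ?_)
    obtain rfl : β = 1 - α := by linarith
    simp only [f]
    split_ifs <;> ring
  · refine ciInf_mono (hf r) fun p => ?_
    simp only [f]
    split_ifs <;> linarith
  · rw [infTime, NNReal.coe_iInf]
    refine iInf_congr fun p => ?_
    rw [p.1.passageTime_update (hF' p.2)]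
    simp only [f]
    split_ifs <;> simp

lemma integral_infTime_update_le [Countable E] {F : Set (Walk G x y)} (hF : F.Nonempty)
    (hF' : F ⊆ G.trails x y) (ω : E → ℝ≥0) (e : E) {ν ν' : Measure ℝ≥0} [IsProbabilityMeasure ν]
    [IsProbabilityMeasure ν'] (hν : HasFiniteMean ν) (hν' : HasFiniteMean ν')
    (h : MoreVariable ν' ν) :
    ∫ t, (infTime F (Function.update ω e t) : ℝ) ∂ν' ≤
      ∫ t, (infTime F (Function.update ω e t) : ℝ) ∂ν := by
  obtain ⟨ψ, hψ, hψm, hψt⟩ := exists_concave_extension hF hF' ω e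
  simp only [← hψt]
  refine h ψ hψ hψm ?_ ?_
  · simpa only [hψt] using integrable_infTime_update hF hF' ω e hν'
  · simpa only [hψt] using integrable_infTime_update hF hF' ω e hν

lemma truncationGain_le_of_abs_sub_le [Countable E] {F : Set (Walk G x y)} (hF : F.Nonempty)
    (hF' : F ⊆ G.trails x y) (ω : E → ℝ≥0) (e : E) {ν ν' : Measure ℝ≥0} [IsProbabilityMeasure ν]
    [IsProbabilityMeasure ν'] (hν : HasFiniteMean ν) (hν' : HasFiniteMean ν') {A κ : ℝ} {s : ℝ≥0}
    (h : ∀ t : ℝ≥0, |(infTime F (Function.update ω e t) : ℝ) - (A + min t s)| ≤ κ) :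
    truncationGain ν ν' s - 2 * κ ≤ ∫ t, (infTime F (Function.update ω e t) : ℝ) ∂ν -
      ∫ t, (infTime F (Function.update ω e t) : ℝ) ∂ν' := by
  have h1 : ∫ t : ℝ≥0, ((A - κ) + ((min t s : ℝ≥0) : ℝ)) ∂ν ≤
      ∫ t, (infTime F (Function.update ω e t) : ℝ) ∂ν :=
    integral_mono ((integrable_const _).add (integrable_min ν s))
      (integrable_infTime_update hF hF' ω e hν) fun t => by
        have := (abs_le.1 (h t)).1
        simp only
        linarith
  have h2 : ∫ t, (infTime F (Function.update ω e t) : ℝ) ∂ν' ≤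
      ∫ t : ℝ≥0, ((A + κ) + ((min t s : ℝ≥0) : ℝ)) ∂ν' :=
    integral_mono (integrable_infTime_update hF hF' ω e hν')
      ((integrable_const _).add (integrable_min ν' s)) fun t => by
        have := (abs_le.1 (h t)).2
        simp only
        linarith
  rw [integral_add (integrable_const _) (integrable_min ν s)] at h1
  rw [integral_add (integrable_const _) (integrable_min ν' s)] at h2
  simp only [integral_const, probReal_univ, smul_eq_mul, one_mul] at h1 h2
  unfold truncationGain
  linarith

variable (μ μ' : E → Measure ℝ≥0) [∀ i, IsProbabilityMeasure (μ i)]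
  [∀ i, IsProbabilityMeasure (μ' i)]

lemma integral_infTime_eq [Countable E] (e : E) (h : ∀ i, i ≠ e → μ' i = μ i)
    (hμ' : ∀ i, HasFiniteMean (μ' i)) {F : Set (Walk G x y)} (hF : F.Nonempty) :
    Integrable (fun ω => ∫ t, (infTime F (Function.update ω e t) : ℝ) ∂μ' e)
      (Measure.infinitePi μ) ∧
    ∫ ω, (infTime F ω : ℝ) ∂Measure.infinitePi μ' =
      ∫ ω, (∫ t, (infTime F (Function.update ω e t) : ℝ) ∂μ' e) ∂Measure.infinitePi μ := by
  have hm : Measurable fun q : (E → ℝ≥0) × ℝ≥0 => Function.update q.1 e q.2 := by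
    refine measurable_pi_lambda _ fun i => ?_
    by_cases hi : i = e
    · subst hi
      simpa using measurable_snd
    · simp only [Function.update_of_ne hi]
      exact (measurable_pi_apply i).comp measurable_fst
  have hint := integrable_infTime μ' hμ' hF
  rw [infinitePi_eq_map_update μ μ' e h] at hint ⊢
  have hsm := (measurable_infTime F).coe_nnreal_real.aestronglyMeasurable
    (μ := ((Measure.infinitePi μ).prod (μ' e)).map fun q => Function.update q.1 e q.2)
  rw [integrable_map_measure hsm hm.aemeasurable] at hint
  rw [integral_map hm.aemeasurable hsm]
  exact ⟨hint.integral_prod_left, integral_prod _ hint⟩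

lemma integral_infTime_le_of_moreVariable [Countable E] (e : E) (h : ∀ i, i ≠ e → μ' i = μ i)
    (hμ : ∀ i, HasFiniteMean (μ i)) (hμ' : ∀ i, HasFiniteMean (μ' i))
    (hvar : MoreVariable (μ' e) (μ e)) {F : Set (Walk G x y)} (hF : F.Nonempty)
    (hF' : F ⊆ G.trails x y) :
    ∫ ω, (infTime F ω : ℝ) ∂Measure.infinitePi μ' ≤
      ∫ ω, (infTime F ω : ℝ) ∂Measure.infinitePi μ := by
  obtain ⟨h1, h2⟩ := integral_infTime_eq μ μ' e h hμ' hF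
  obtain ⟨h3, h4⟩ := integral_infTime_eq μ μ e (fun _ _ => rfl) hμ hF
  rw [h2, h4]
  exact integral_mono h1 h3 fun ω =>
    integral_infTime_update_le hF hF' ω e (hμ e) (hμ' e) hvar

/-- Replacing the law of one edge lowers the expectation at least by the gain on a given event. -/
lemma integral_infTime_add_le_of_moreVariable [Countable E] (e : E)
    (h : ∀ i, i ≠ e → μ' i = μ i) (hμ : ∀ i, HasFiniteMean (μ i))
    (hμ' : ∀ i, HasFiniteMean (μ' i)) (hvar : MoreVariable (μ' e) (μ e))
    {F : Set (Walk G x y)} (hF : F.Nonempty) (hF' : F ⊆ G.trails x y)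
    {S : Set (E → ℝ≥0)} (hS : MeasurableSet S) {c : ℝ}
    (hc : ∀ ω ∈ S, c ≤ ∫ t, (infTime F (Function.update ω e t) : ℝ) ∂μ e -
      ∫ t, (infTime F (Function.update ω e t) : ℝ) ∂μ' e) :
    ∫ ω, (infTime F ω : ℝ) ∂Measure.infinitePi μ' + (Measure.infinitePi μ).real S * c ≤
      ∫ ω, (infTime F ω : ℝ) ∂Measure.infinitePi μ := by
  obtain ⟨h1, h2⟩ := integral_infTime_eq μ μ' e h hμ' hF
  obtain ⟨h3, h4⟩ := integral_infTime_eq μ μ e (fun _ _ => rfl) hμ hF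
  have h5 : ∫ ω, S.indicator (fun _ => c) ω ∂Measure.infinitePi μ =
      (Measure.infinitePi μ).real S * c := by
    rw [integral_indicator_const _ hS, smul_eq_mul]
  have h6 : Integrable (S.indicator fun _ => c) (Measure.infinitePi μ) :=
    (integrable_const c).indicator hS
  rw [h2, h4, ← h5, ← integral_add h1 h6]
  refine integral_mono (h1.add h6) h3 fun ω => ?_
  by_cases hω : ω ∈ S
  · have := hc ω hω
    simp only [Set.indicator_of_mem hω]
    linarith
  · have := integral_infTime_update_le hF hF' ω e (hμ e) (hμ' e) hvar
    simpa [Set.indicator_of_notMem hω] using this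

end OneEdge

section Mixed

variable (ν ν' : Measure ℝ≥0)

open Classical in
/-- The weights on `S` have law `ν'`, the other ones have law `ν`. -/
def mixed (S : Set E) (e : E) : Measure ℝ≥0 := if e ∈ S then ν' else ν

instance [IsProbabilityMeasure ν] [IsProbabilityMeasure ν'] (S : Set E) (e : E) :
    IsProbabilityMeasure (mixed ν ν' S e) := by
  unfold mixed; split_ifs <;> infer_instance

variable {ν ν'}

lemma mixed_of_mem {S : Set E} {e : E} (h : e ∈ S) : mixed ν ν' S e = ν' := if_pos h

lemma mixed_of_notMem {S : Set E} {e : E} (h : e ∉ S) : mixed ν ν' S e = ν := if_neg h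

lemma hasFiniteMean_mixed (hν : HasFiniteMean ν) (hν' : HasFiniteMean ν') (S : Set E) (e : E) :
    HasFiniteMean (mixed ν ν' S e) := by
  unfold mixed; split_ifs <;> assumption

lemma mixed_insert_of_ne {S : Set E} {e i : E} (h : i ≠ e) :
    mixed ν ν' (insert e S) i = mixed ν ν' S i := by
  by_cases hi : i ∈ S
  · rw [mixed_of_mem (Set.mem_insert_of_mem _ hi), mixed_of_mem hi]
  · rw [mixed_of_notMem hi, mixed_of_notMem (by simp [h, hi])]

variable [IsProbabilityMeasure ν] [IsProbabilityMeasure ν']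

lemma integral_mixed_union_le [Countable E] (hν : HasFiniteMean ν) (hν' : HasFiniteMean ν')
    (hvar : MoreVariable ν' ν) {F : Set (Walk G x y)} (hF : F.Nonempty)
    (hF' : F ⊆ G.trails x y) (S : Set E) (B : Finset E) :
    ∫ ω, (infTime F ω : ℝ) ∂Measure.infinitePi (mixed ν ν' (S ∪ B)) ≤
      ∫ ω, (infTime F ω : ℝ) ∂Measure.infinitePi (mixed ν ν' S) := by
  classical
  induction B using Finset.induction_on with
  | empty => simp
  | insert e B he ih =>
    rw [Finset.coe_insert, Set.union_insert]
    by_cases h : e ∈ S ∪ (B : Set E)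
    · rwa [Set.insert_eq_of_mem h]
    · refine le_trans ?_ ih
      refine integral_infTime_le_of_moreVariable _ _ e (fun i hi => mixed_insert_of_ne hi)
        (hasFiniteMean_mixed hν hν' _) (hasFiniteMean_mixed hν hν' _) ?_ hF hF'
      rwa [mixed_of_mem (Set.mem_insert _ _), mixed_of_notMem h]

lemma integral_infTime_congr [Countable E] {F : Set (Walk G x y)}
    (B : Finset E) (hB : ∀ p ∈ F, ∀ e ∈ p.edges, e ∈ B) (μ μ' : E → Measure ℝ≥0)
    [∀ i, IsProbabilityMeasure (μ i)] [∀ i, IsProbabilityMeasure (μ' i)]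
    (h : ∀ e ∈ B, μ e = μ' e) :
    ∫ ω, (infTime F ω : ℝ) ∂Measure.infinitePi μ =
      ∫ ω, (infTime F ω : ℝ) ∂Measure.infinitePi μ' := by
  classical
  let ext : (B → ℝ≥0) → E → ℝ≥0 := fun v e => if h : e ∈ B then v ⟨e, h⟩ else 0
  have hext : Measurable ext := by
    refine measurable_pi_lambda _ fun e => ?_
    by_cases he : e ∈ B
    · simp only [ext, he, dite_true]
      exact measurable_pi_apply _
    · simp only [ext, he, dite_false]
      exact measurable_const
  let f : (B → ℝ≥0) → ℝ := fun v => infTime F (ext v)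
  have hf : Measurable f := ((measurable_infTime F).comp hext).coe_nnreal_real
  have hfω : ∀ ω : E → ℝ≥0, (infTime F ω : ℝ) = f (B.restrict ω) := fun ω => by
    simp only [f, infTime]
    congr 2
    refine funext fun p => p.1.passageTime_congr fun e he => ?_
    simp [ext, hB p.1 p.2 e he]
  simp only [hfω]
  rw [integral_restrict_infinitePi (X := fun _ : E => ℝ≥0) (μ := μ)
      hf.aestronglyMeasurable,
    integral_restrict_infinitePi (X := fun _ : E => ℝ≥0) (μ := μ')
      hf.aestronglyMeasurable]
  congr 2
  exact funext fun e => h e e.2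

/-- Replacing all the remaining laws does not increase the expected passage time. -/
lemma integral_mixed_univ_le [Countable E] (hG : G.IsConnected) (hν : HasFiniteMean ν)
    (hν' : HasFiniteMean ν') (hvar : MoreVariable ν' ν) (S : Set E) :
    ∫ ω, (infTime (G.trails x y) ω : ℝ) ∂Measure.infinitePi (fun _ : E => ν') ≤
      ∫ ω, (infTime (G.trails x y) ω : ℝ) ∂Measure.infinitePi (mixed ν ν' S) := by
  classical
  obtain ⟨p₀, hp₀⟩ := hG.trails_nonempty x y
  have : Nonempty (G.trails x y) := ⟨⟨p₀, hp₀⟩⟩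
  obtain ⟨f, hf⟩ := exists_surjective_nat (G.trails x y)
  let F : ℕ → Set (Walk G x y) := fun n => {p | ∃ k ≤ n, p = f k}
  have hmem : ∀ {k n}, k ≤ n → (f k).1 ∈ F n := fun {k n} hk => ⟨k, hk, rfl⟩
  have hFne : ∀ n, (F n).Nonempty := fun n => ⟨f 0, hmem (Nat.zero_le _)⟩
  have hFt : ∀ n, F n ⊆ G.trails x y := by
    rintro n _ ⟨k, -, rfl⟩
    exact (f k).2
  have hlim : Tendsto (fun n => ∫ ω, (infTime (F n) ω : ℝ) ∂Measure.infinitePi (mixed ν ν' S))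
      atTop (nhds (∫ ω, (infTime (G.trails x y) ω : ℝ) ∂Measure.infinitePi (mixed ν ν' S))) := by
    refine tendsto_integral_of_dominated_convergence
      (fun ω => ((f 0).1.passageTime ω : ℝ))
      (fun n => (measurable_infTime _).coe_nnreal_real.aestronglyMeasurable)
      ((f 0).1.integrable_passageTime _ (hasFiniteMean_mixed hν hν' S))
      (fun n => ae_of_all _ fun ω => ?_) (ae_of_all _ fun ω => ?_)
    · rw [Real.norm_of_nonneg (NNReal.coe_nonneg _)]
      exact NNReal.coe_le_coe.2 (infTime_le (hmem (Nat.zero_le n)) ω)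
    · have hanti : Antitone fun n => infTime (F n) ω := fun m n hmn =>
        infTime_anti (by rintro _ ⟨k, hk, rfl⟩; exact ⟨k, hk.trans hmn, rfl⟩) (hFne m) ω
      have h1 := tendsto_atTop_ciInf hanti ⟨0, fun _ _ => zero_le⟩
      have h2 : (⨅ n, infTime (F n) ω) = infTime (G.trails x y) ω := by
        refine le_antisymm (le_ciInf fun p => ?_) (le_ciInf fun n => infTime_anti (hFt n) (hFne n) ω)
        obtain ⟨k, rfl⟩ := hf p
        exact (ciInf_le ⟨0, fun _ _ => zero_le⟩ k).trans (infTime_le (hmem (le_refl k)) ω)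
      rw [h2] at h1
      exact (NNReal.continuous_coe.tendsto _).comp h1
  refine ge_of_tendsto' hlim fun n => ?_
  let B : Finset E := (Finset.range (n + 1)).biUnion fun k => (f k).1.edges.toFinset
  have hB : ∀ p ∈ F n, ∀ e ∈ p.edges, e ∈ B := by
    rintro _ ⟨k, hk, rfl⟩ e he
    exact Finset.mem_biUnion.2 ⟨k, Finset.mem_range.2 (by omega), by simpa using he⟩
  calc ∫ ω, (infTime (G.trails x y) ω : ℝ) ∂Measure.infinitePi (fun _ : E => ν')
      ≤ ∫ ω, (infTime (F n) ω : ℝ) ∂Measure.infinitePi (fun _ : E => ν') :=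
        integral_mono (integrable_infTime _ (fun _ => hν') ⟨p₀, hp₀⟩)
          (integrable_infTime _ (fun _ => hν') (hFne n))
          fun ω => NNReal.coe_le_coe.2 (infTime_anti (hFt n) (hFne n) ω)
    _ = ∫ ω, (infTime (F n) ω : ℝ) ∂Measure.infinitePi (mixed ν ν' (S ∪ B)) :=
        integral_infTime_congr B hB _ _ fun e he =>
          (mixed_of_mem (Or.inr (Finset.mem_coe.2 he))).symm
    _ ≤ _ := integral_mixed_union_le hν hν' hvar (hFne n) (hFt n) S B

end Mixed

end Multigraph
end FPP

namespace FPP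

lemma measureReal_Ioi_eq_of_truncation {ν ν' : Measure ℝ≥0} [IsProbabilityMeasure ν]
    [IsProbabilityMeasure ν'] (h : ∀ s, truncationGain ν ν' s = 0) (s : ℝ≥0) :
    ν.real (Set.Ioi s) = ν'.real (Set.Ioi s) := by
  let f : ℕ → ℝ≥0 → ℝ := fun n t =>
    ((n : ℝ) + 1) * (((min t (s + 1 / (n + 1)) : ℝ≥0) : ℝ) - ((min t s : ℝ≥0) : ℝ))
  have hint : ∀ (κ : Measure ℝ≥0) [IsProbabilityMeasure κ] n, ∫ t, f n t ∂κ =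
      ((n : ℝ) + 1) * (∫ t : ℝ≥0, ((min t (s + 1 / (n + 1)) : ℝ≥0) : ℝ) ∂κ -
        ∫ t : ℝ≥0, ((min t s : ℝ≥0) : ℝ) ∂κ) := fun κ _ n => by
    rw [integral_const_mul, integral_sub (integrable_min κ _) (integrable_min κ _)]
  have hbound : ∀ n t, ‖f n t‖ ≤ 1 := fun n t => by
    have h1 : ((min t s : ℝ≥0) : ℝ) ≤ ((min t (s + 1 / (n + 1)) : ℝ≥0) : ℝ) :=
      NNReal.coe_le_coe.2 (min_le_min_left _ le_self_add)
    have h2 : ((min t (s + 1 / (n + 1)) : ℝ≥0) : ℝ) ≤ ((min t s : ℝ≥0) : ℝ) + 1 / ((n : ℝ) + 1) := by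
      have : min t (s + 1 / ((n : ℝ≥0) + 1)) ≤ min t s + 1 / ((n : ℝ≥0) + 1) := by
        rw [min_add]
        exact min_le_min_right _ le_self_add
      exact_mod_cast this
    have hn : (0 : ℝ) < (n : ℝ) + 1 := by positivity
    rw [Real.norm_of_nonneg (mul_nonneg hn.le (sub_nonneg.2 h1))]
    calc ((n : ℝ) + 1) * _ ≤ ((n : ℝ) + 1) * (1 / ((n : ℝ) + 1)) :=
          mul_le_mul_of_nonneg_left (by linarith) hn.le
      _ = 1 := by field_simp
  have hptw : ∀ t, Tendsto (fun n => f n t) atTop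
      (nhds ((Set.Ioi s).indicator (fun _ => (1 : ℝ)) t)) := fun t => by
    by_cases ht : t ∈ Set.Ioi s
    · rw [Set.indicator_of_mem ht]
      rw [Set.mem_Ioi] at ht
      refine tendsto_const_nhds.congr' ?_
      obtain ⟨N, hN⟩ := exists_nat_one_div_lt (K := ℝ) (sub_pos.2 (NNReal.coe_lt_coe.2 ht))
      filter_upwards [eventually_ge_atTop N] with n hn
      have hn0 : (0 : ℝ) < (n : ℝ) + 1 := by positivity
      have h1 : 1 / ((n : ℝ) + 1) ≤ 1 / ((N : ℝ) + 1) := one_div_le_one_div_of_le (by positivity)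
        (by have : (N : ℝ) ≤ n := by exact_mod_cast hn
            linarith)
      have h2 : s + 1 / ((n : ℝ≥0) + 1) ≤ t := by
        rw [← NNReal.coe_le_coe]
        push_cast
        linarith
      simp only [f]
      rw [min_eq_right h2, min_eq_right ht.le]
      push_cast
      field_simp
      ring
    · rw [Set.indicator_of_notMem ht]
      refine tendsto_const_nhds.congr fun n => ?_
      rw [Set.mem_Ioi, not_lt] at ht
      simp only [f]
      rw [min_eq_left ht, min_eq_left (ht.trans le_self_add), sub_self, mul_zero]
  have hlim : ∀ (κ : Measure ℝ≥0) [IsProbabilityMeasure κ],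
      Tendsto (fun n => ∫ t, f n t ∂κ) atTop (nhds (κ.real (Set.Ioi s))) := fun κ _ => by
    have h1 := tendsto_integral_of_dominated_convergence (μ := κ) (F := f)
      (f := (Set.Ioi s).indicator fun _ => (1 : ℝ)) (fun _ => 1)
      (fun n => (((integrable_min κ _).sub (integrable_min κ _)).const_mul _).aestronglyMeasurable)
      (integrable_const _) (fun n => ae_of_all _ (hbound n)) (ae_of_all _ hptw)
    rwa [integral_indicator_const _ measurableSet_Ioi, smul_eq_mul, mul_one] at h1
  refine tendsto_nhds_unique (hlim ν) ((hlim ν').congr fun n => ?_)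
  have h1 := h (s + 1 / (n + 1))
  have h2 := h s
  unfold truncationGain at h1 h2
  rw [hint, hint, sub_eq_zero.1 h1, sub_eq_zero.1 h2]

lemma eq_of_truncationGain_eq_zero {ν ν' : Measure ℝ≥0} [IsProbabilityMeasure ν]
    [IsProbabilityMeasure ν'] (h : ∀ s, truncationGain ν ν' s = 0) : ν = ν' := by
  refine Measure.ext_of_Iic _ _ fun s => ?_
  have h1 := measureReal_Ioi_eq_of_truncation h s
  rw [measureReal_def, measureReal_def, ENNReal.toReal_eq_toReal_iff' (measure_ne_top _ _)
    (measure_ne_top _ _)] at h1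
  rw [← Set.compl_Ioi, prob_compl_eq_one_sub measurableSet_Ioi,
    prob_compl_eq_one_sub measurableSet_Ioi, h1]

lemma truncationGain_le_of_ae {ν ν' : Measure ℝ≥0} [IsProbabilityMeasure ν]
    [IsProbabilityMeasure ν'] {s c d : ℝ≥0} {α β : ℝ}
    (h1 : ∀ᵐ t ∂ν, ((min t s : ℝ≥0) : ℝ) = α * (min t c : ℝ≥0) + β * (min t d : ℝ≥0))
    (h2 : ∀ t, α * ((min t c : ℝ≥0) : ℝ) + β * (min t d : ℝ≥0) ≤ (min t s : ℝ≥0)) :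
    truncationGain ν ν' s ≤ α * truncationGain ν ν' c + β * truncationGain ν ν' d := by
  have h3 := integral_mono (μ := ν') (((integrable_min ν' c).const_mul α).add
    ((integrable_min ν' d).const_mul β)) (integrable_min ν' s) h2
  have h4 := integral_congr_ae h1
  simp only [Pi.add_apply] at h3
  rw [integral_add ((integrable_min ν' c).const_mul α) ((integrable_min ν' d).const_mul β),
    integral_const_mul, integral_const_mul] at h3
  rw [integral_add ((integrable_min ν c).const_mul α) ((integrable_min ν d).const_mul β),
    integral_const_mul, integral_const_mul] at h4
  unfold truncationGain
  linarith

/-- If `ν'` is strictly more variable than `ν`, then some truncation at a point of the support of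
`ν` detects this. -/
lemma StrictlyMoreVariable.exists_mem_support {ν ν' : Measure ℝ≥0} [IsProbabilityMeasure ν]
    [IsProbabilityMeasure ν'] (h : StrictlyMoreVariable ν' ν) :
    ∃ s ∈ ν.support, 0 < truncationGain ν ν' s := by
  by_contra! hcon
  refine h.2 (eq_of_truncationGain_eq_zero fun s =>
    le_antisymm ?_ (h.1.truncationGain_nonneg s)).symm
  have h0 : truncationGain ν ν' 0 = 0 := by simp [truncationGain]
  let K : Set ℝ≥0 := insert 0 ν.support ∩ Set.Iic s
  have hclosed : IsClosed (insert 0 ν.support) := by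
    rw [Set.insert_eq]
    exact isClosed_singleton.union Measure.isClosed_support
  have hKne : K.Nonempty := ⟨0, Set.mem_insert _ _, Set.mem_Iic.2 zero_le⟩
  have hKbdd : BddAbove K := ⟨s, fun _ h => h.2⟩
  have hc : sSup K ∈ K := (hclosed.inter isClosed_Iic).csSup_mem hKne hKbdd
  set c := sSup K
  have hcs : c ≤ s := hc.2
  have hgc : truncationGain ν ν' c ≤ 0 := by
    rcases hc.1 with h' | h'
    · rw [h', h0]
    · exact hcon c h'
  have hle : ∀ t ∈ ν.support, t ≤ s → t ≤ c := fun t ht hts =>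
    le_csSup hKbdd ⟨Set.mem_insert_of_mem _ ht, hts⟩
  have hae : ∀ᵐ t ∂ν, t ∈ ν.support := Measure.support_mem_ae
  by_cases hne : (ν.support ∩ Set.Ici s).Nonempty
  · have hd : sInf (ν.support ∩ Set.Ici s) ∈ ν.support ∩ Set.Ici s :=
      (Measure.isClosed_support.inter isClosed_Ici).csInf_mem hne (OrderBot.bddBelow _)
    have hge : ∀ t ∈ ν.support, s ≤ t → sInf (ν.support ∩ Set.Ici s) ≤ t := fun t ht hts =>
      csInf_le (OrderBot.bddBelow _) ⟨ht, hts⟩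
    set d := sInf (ν.support ∩ Set.Ici s)
    have hsd : s ≤ d := hd.2
    have hgd : truncationGain ν ν' d ≤ 0 := hcon d hd.1
    rcases hcs.eq_or_lt with hcs' | hcs'
    · rwa [← hcs']
    have hcd : (c : ℝ) < d := NNReal.coe_lt_coe.2 (hcs'.trans_le hsd)
    have hcsR : (c : ℝ) ≤ s := hcs
    have hsdR : (s : ℝ) ≤ d := hsd
    have hpos : 0 < (d : ℝ) - c := by linarith
    obtain ⟨β, hβ⟩ : ∃ β : ℝ, β = ((s : ℝ) - c) / (d - c) := ⟨_, rfl⟩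
    have hβ0 : 0 ≤ β := hβ ▸ div_nonneg (by linarith) hpos.le
    have hβ1 : β ≤ 1 := by rw [hβ, div_le_one hpos]; linarith
    have hs : (s : ℝ) = (1 - β) * c + β * d := by
      rw [hβ]
      field_simp
      ring
    refine (truncationGain_le_of_ae (c := c) (d := d) (α := 1 - β) (β := β) ?_ fun t => ?_).trans ?_
    · filter_upwards [hae] with t ht
      rcases le_total t s with hts | hts
      · have h1 := hle t ht hts
        rw [min_eq_left hts, min_eq_left h1, min_eq_left (hts.trans hsd)]
        ring
      · have h1 := hge t ht hts
        rw [min_eq_right hts, min_eq_right (hcs.trans hts), min_eq_right h1, hs]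
    · push_cast
      refine le_min ?_ ?_
      · have h1 := mul_le_mul_of_nonneg_left (min_le_left (t : ℝ) c) (sub_nonneg.2 hβ1)
        have h2 := mul_le_mul_of_nonneg_left (min_le_left (t : ℝ) d) hβ0
        linarith
      · have h1 := mul_le_mul_of_nonneg_left (min_le_right (t : ℝ) c) (sub_nonneg.2 hβ1)
        have h2 := mul_le_mul_of_nonneg_left (min_le_right (t : ℝ) d) hβ0
        linarith
    · have h1 := mul_nonpos_of_nonneg_of_nonpos (sub_nonneg.2 hβ1) hgc
      have h2 := mul_nonpos_of_nonneg_of_nonpos hβ0 hgd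
      linarith
  · refine (truncationGain_le_of_ae (c := c) (d := c) (α := 1) (β := 0) ?_ fun t => ?_).trans ?_
    · filter_upwards [hae] with t ht
      have hts : t ≤ s := by
        by_contra hts
        exact hne ⟨t, ht, (not_le.1 hts).le⟩
      rw [min_eq_left hts, min_eq_left (hle t ht hts)]
      ring
    · rw [one_mul, zero_mul, add_zero]
      exact NNReal.coe_le_coe.2 (min_le_min_left _ hcs)
    · linarith

/-- An exponential-subcritical law is not concentrated at one point. -/
lemma Multigraph.ExpSubcritical.nontrivial_support {V E : Type*} {G : Multigraph V E}
    {ν : Measure ℝ≥0} [IsProbabilityMeasure ν] (h : G.ExpSubcritical ν) :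
    ν.support.Nontrivial := by
  by_contra hcon
  rw [Set.not_nontrivial_iff] at hcon
  obtain ⟨s, hs⟩ := ν.nonempty_support (IsProbabilityMeasure.ne_zero ν)
  have hsupp : ν.support = {s} := hcon.eq_singleton_of_mem hs
  have hone : ν.real {s} = 1 := by
    rw [← hsupp, measureReal_def, (mem_ae_iff_prob_eq_one Measure.isClosed_support.measurableSet).1
      Measure.support_mem_ae, ENNReal.toReal_one]
  unfold Multigraph.ExpSubcritical at h
  rw [hsupp, csInf_singleton] at h
  rcases h with ⟨rfl, h⟩ | ⟨-, h⟩
  · rw [hone] at h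
    exact absurd h (not_lt.2 G.expThreshold.2.2)
  · rw [hone] at h
    exact absurd h (not_lt.2 G.expGeodesicThreshold.2.2)

end FPP

namespace FPP

/-- The lengths of intervals in the recursive search for two disjoint subintervals on which a
bounded monotone function of intervals takes the value of the whole interval. -/
def nestedLength (L r g : ℕ) : ℕ → ℕ
  | 0 => r
  | m + 1 => 2 * L + 2 * nestedLength L r g m + g

lemma le_nestedLength (L r g m : ℕ) : r ≤ nestedLength L r g m := by
  induction m with
  | zero => exact le_rfl
  | succ m ih => rw [nestedLength]; omega

/-- A bounded integer-valued function of intervals that is antitone under inclusion takes equal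
values on some interval and on two disjoint subintervals of it. -/
lemma exists_equal_subintervals (L r g : ℕ) (c : ℕ → ℕ → ℤ) (D : ℤ) (m s : ℕ)
    (hmono : ∀ i' i j j', s ≤ i' → i' ≤ i → i ≤ j → j ≤ j' → j' ≤ s + nestedLength L r g m →
      c i' j' ≤ c i j)
    (hD : ∀ i j, s ≤ i → i ≤ j → j ≤ s + nestedLength L r g m → c i j ≤ D)
    (hm : D < c s (s + nestedLength L r g m) + m) :
    ∃ i₀ i j i' j' j₀, s ≤ i₀ ∧ i₀ + L ≤ i ∧ i + r ≤ j ∧ j + g ≤ i' ∧ i' + r ≤ j' ∧ j' + L ≤ j₀ ∧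
      j₀ ≤ s + nestedLength L r g m ∧ c i₀ j₀ = c i j ∧ c i₀ j₀ = c i' j' := by
  induction m generalizing s with
  | zero =>
    have := hD s (s + nestedLength L r g 0) le_rfl (by omega) le_rfl
    push_cast at hm
    omega
  | succ m ih =>
    obtain ⟨w, hw⟩ : ∃ w, w = nestedLength L r g m := ⟨_, rfl⟩
    have hW : nestedLength L r g (m + 1) = 2 * L + 2 * w + g := by rw [nestedLength, hw]
    have hrw : r ≤ w := hw ▸ le_nestedLength L r g m
    rw [hW] at hmono hD hm ⊢
    rw [← hw] at ih
    have h1 := hmono s (s + L) (s + L + w) (s + (2 * L + 2 * w + g)) (by omega) (by omega)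
      (by omega) (by omega) (by omega)
    have h2 := hmono s (s + L + w + g) (s + L + w + g + w) (s + (2 * L + 2 * w + g)) (by omega)
      (by omega) (by omega) (by omega) (by omega)
    push_cast at hm
    by_cases e1 : c s (s + (2 * L + 2 * w + g)) = c (s + L) (s + L + w)
    · by_cases e2 : c s (s + (2 * L + 2 * w + g)) = c (s + L + w + g) (s + L + w + g + w)
      · exact ⟨s, s + L, s + L + w, s + L + w + g, s + L + w + g + w, s + (2 * L + 2 * w + g),
          le_rfl, le_rfl, by omega, le_rfl, by omega, by omega, le_rfl, e1, e2⟩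
      · obtain ⟨i₀, i, j, i', j', j₀, h⟩ := ih (s + L + w + g)
          (fun i' i j j' a1 a2 a3 a4 a5 => hmono i' i j j' (by omega) a2 a3 a4 (by omega))
          (fun i j a1 a2 a3 => hD i j (by omega) a2 (by omega)) (by omega)
        exact ⟨i₀, i, j, i', j', j₀, by omega, h.2.1, h.2.2.1, h.2.2.2.1, h.2.2.2.2.1,
          h.2.2.2.2.2.1, by omega, h.2.2.2.2.2.2.2⟩
    · obtain ⟨i₀, i, j, i', j', j₀, h⟩ := ih (s + L)
        (fun i' i j j' a1 a2 a3 a4 a5 => hmono i' i j j' (by omega) a2 a3 a4 (by omega))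
        (fun i j a1 a2 a3 => hD i j (by omega) a2 (by omega)) (by omega)
      exact ⟨i₀, i, j, i', j', j₀, by omega, h.2.1, h.2.2.1, h.2.2.2.1, h.2.2.2.2.1,
        h.2.2.2.2.2.1, by omega, h.2.2.2.2.2.2.2⟩

namespace Multigraph

variable {V : Type*} {E : Type*} {G : Multigraph V E}

/-- Each path between the endpoints of a geodesic passes within distance `D` of each of the
vertices of the geodesic. -/
def HasBottlenecks (G : Multigraph V E) (D : ℕ) : Prop :=
  ∀ (c : ℕ → V) (n : ℕ), G.IsGeodesicSeq c n → ∀ i ≤ n, ∀ π : Walk G (c 0) (c n),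
    π.Visits (G.near (c i) D)

/-- A fixed point free isometry of finite order with bounded displacement. -/
structure IsTorsionTranslation (G : Multigraph V E) (z : V → V) (D m : ℕ) : Prop where
  dist_map : ∀ u v, G.dist (z u) (z v) = G.dist u v
  dist_le : ∀ v, G.dist v (z v) ≤ D
  ne : ∀ v, z v ≠ v
  iterate : z^[m] = id
  pos : 0 < m

lemma IsGeodesicSeq.reverse {c : ℕ → V} {n : ℕ} (h : G.IsGeodesicSeq c n) :
    G.IsGeodesicSeq (fun k => c (n - k)) n := by
  intro i j hij hj
  rw [dist_comm, h _ _ (by omega) (by omega)]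
  omega

lemma IsGeodesicSeq.exists_walk (hG : G.IsConnected) {c : ℕ → V} {n : ℕ}
    (h : G.IsGeodesicSeq c n) {i : ℕ} (hi : i ≤ n) :
    ∃ p : Walk G (c i) (c n), ∀ A, p.Visits A → ∃ k, i ≤ k ∧ k ≤ n ∧ c k ∈ A := by
  refine exists_walk_of_adj c hi fun k _ hk => hG.adj_of_dist_eq_one ?_
  rw [h k (k + 1) (by omega) (by omega)]
  omega

lemma HasBottlenecks.visits (hG : G.IsConnected) {D : ℕ} (hB : G.HasBottlenecks D) {c : ℕ → V}
    {n : ℕ} (hc : G.IsGeodesicSeq c n) {p q M : ℕ} (hq : q ≤ n) (hpq : p + M + D < q) {t : V}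
    (ht : G.dist t (c q) ≤ M) (π : Walk G (c 0) t) : π.Visits (G.near (c p) D) := by
  obtain ⟨σ₀, hσ₀⟩ := hG.exists_length_eq t (c q)
  obtain ⟨ρ, hρ⟩ := hc.exists_walk hG hq
  have h := hB c n hc p (by omega) (π.append (σ₀.append ρ))
  rw [Walk.visits_append, Walk.visits_append] at h
  rcases h with h | h | h
  · exact h
  · obtain ⟨s, hs, -, h2⟩ := h.exists_dist_le
    have h3 : G.dist s (c p) ≤ D := hs
    have h4 := hG.dist_triangle (c p) s (c q)
    rw [hc p q (by omega) hq, dist_comm (c p)] at h4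
    omega
  · obtain ⟨k, hk, hkn, h3⟩ := hρ _ h
    have h3 : G.dist (c k) (c p) ≤ D := h3
    rw [dist_comm, hc p k (by omega) hkn] at h3
    omega

lemma HasBottlenecks.visits_reverse (hG : G.IsConnected) {D : ℕ} (hB : G.HasBottlenecks D)
    {c : ℕ → V} {n : ℕ} (hc : G.IsGeodesicSeq c n) {p q M : ℕ} (hp : p ≤ n)
    (hpq : q + M + D < p) {t : V}
    (ht : G.dist t (c q) ≤ M) (π : Walk G (c n) t) : π.Visits (G.near (c p) D) := by
  have h := hB.visits hG hc.reverse (p := n - p) (q := n - q) (M := M) (by omega) (by omega)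
    (t := t) (by rwa [show n - (n - q) = q by omega])
  simp only [Nat.sub_zero, show n - (n - p) = p by omega] at h
  exact h π

/-- The edge joining two adjacent vertices. -/
def edgeOf (G : Multigraph V E) [Nonempty E] (u v : V) : E :=
  Classical.epsilon fun e => G.boundary e = s(u, v)

lemma Adj.boundary_edgeOf [Nonempty E] {u v : V} (h : G.Adj u v) :
    G.boundary (G.edgeOf u v) = s(u, v) :=
  Classical.epsilon_spec h

/-- The sequence that follows `c₁` up to time `m`, then `c₂` for time `q`, then `c₃`. -/
def splice (c₁ c₂ c₃ : ℕ → V) (m q k : ℕ) : V :=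
  if k ≤ m then c₁ k else if k ≤ m + q then c₂ (k - m) else c₃ (k - m - q)

lemma splice_of_le {c₁ c₂ c₃ : ℕ → V} {m q k : ℕ} (h : k ≤ m) : splice c₁ c₂ c₃ m q k = c₁ k :=
  if_pos h

lemma splice_of_ge {c₁ c₂ c₃ : ℕ → V} {m q k : ℕ} (h0 : c₁ m = c₂ 0) (h1 : c₂ q = c₃ 0)
    (h : m + q ≤ k) : splice c₁ c₂ c₃ m q k = c₃ (k - m - q) := by
  unfold splice
  split_ifs with h2 h3
  · obtain rfl : k = m := by omega
    obtain rfl : q = 0 := by omega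
    rw [h0, h1]
    simp
  · obtain rfl : k = m + q := by omega
    simp [h1]
  · rfl

lemma splice_mid {c₁ c₂ c₃ : ℕ → V} {m q k : ℕ} (h0 : c₁ m = c₂ 0)
    (h : m ≤ k) (h' : k ≤ m + q) : splice c₁ c₂ c₃ m q k = c₂ (k - m) := by
  unfold splice
  split_ifs with h2
  · obtain rfl : k = m := by omega
    simp [h0]
  · rfl

/-- Splicing parts of geodesics yields a geodesic if the total length is right. -/
lemma IsConnected.isGeodesicSeq_splice (hG : G.IsConnected) {c₁ c₂ c₃ : ℕ → V} {m q l : ℕ}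
    (h0 : c₁ m = c₂ 0) (h1 : c₂ q = c₃ 0) (hc₁ : G.IsGeodesicSeq c₁ m)
    (hc₂ : G.IsGeodesicSeq c₂ q) (hc₃ : G.IsGeodesicSeq c₃ l)
    (h : m + q + l ≤ G.dist (c₁ 0) (c₃ l)) :
    G.IsGeodesicSeq (splice c₁ c₂ c₃ m q) (m + q + l) := by
  refine hG.isGeodesicSeq (fun k hk => ?_) ?_
  · rcases lt_or_ge k m with hkm | hkm
    · rw [splice_of_le hkm.le, splice_of_le hkm, hc₁ k (k + 1) (by omega) (by omega)]
      omega
    rcases lt_or_ge k (m + q) with hkq | hkq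
    · rw [splice_mid h0 hkm hkq.le, splice_mid h0 (by omega) hkq, hc₂ _ _ (by omega) (by omega)]
      omega
    · rw [splice_of_ge h0 h1 hkq, splice_of_ge h0 h1 (by omega), hc₃ _ _ (by omega) (by omega)]
      omega
  · rw [splice_of_le (Nat.zero_le _), splice_of_ge h0 h1 (by omega)]
    rwa [show m + q + l - m - q = l by omega]

/-- A torsion translation does not act on a long part of a geodesic as a shift. -/
lemma IsTorsionTranslation.exists_ne_shift {z : V → V} {D m : ℕ}
    (hz : G.IsTorsionTranslation z D m) {c : ℕ → V} {n : ℕ} (hc : G.IsGeodesicSeq c n)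
    {κ : ℤ} (hκ : |κ| ≤ D) {a b : ℕ} (hb : b + D ≤ n) (hab : a + 2 * m * D ≤ b) :
    ∃ k k' : ℕ, a ≤ k ∧ k ≤ b ∧ (k' : ℤ) = k - κ ∧ z (c k') ≠ c k := by
  by_contra! hcon
  obtain ⟨hκ1, hκ2⟩ := abs_le.1 hκ
  have hmD : ∀ t ≤ m, |(t : ℤ) * κ| ≤ m * D := fun t ht => by
    rw [abs_mul]
    have : |(t : ℤ)| ≤ m := by rw [Nat.abs_cast]; exact_mod_cast ht
    exact mul_le_mul this hκ (abs_nonneg _) (by positivity)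
  have key : ∀ t ≤ m, ∀ k : ℕ, (k : ℤ) = a + m * D - t * κ → z^[t] (c k) = c (a + m * D) := by
    intro t
    induction t with
    | zero =>
      intro _ k hk
      obtain rfl : k = a + m * D := by push_cast at hk; zify; linarith
      rfl
    | succ t ih =>
      intro ht k hk
      have h1 := abs_le.1 (hmD t (by omega))
      obtain ⟨k₀, hk₀⟩ : ∃ k₀ : ℕ, (k₀ : ℤ) = a + m * D - t * κ :=
        ⟨(a + m * D - t * κ : ℤ).toNat, Int.toNat_of_nonneg (by
          have : (0 : ℤ) ≤ a := by positivity
          linarith [h1.2])⟩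
      have h2 : z (c k) = c k₀ := by
        refine hcon k₀ k ?_ ?_ ?_
        · zify; rw [hk₀]; linarith [h1.2]
        · zify at hab ⊢; rw [hk₀]; linarith [h1.1]
        · rw [hk, hk₀]; push_cast; ring
      rw [Function.iterate_succ_apply, h2]
      exact ih (by omega) k₀ hk₀
  have h1 := abs_le.1 (hmD m le_rfl)
  obtain ⟨k₀, hk₀⟩ : ∃ k₀ : ℕ, (k₀ : ℤ) = a + m * D - m * κ :=
    ⟨(a + m * D - m * κ : ℤ).toNat, Int.toNat_of_nonneg (by
      have : (0 : ℤ) ≤ a := by positivity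
      linarith [h1.2])⟩
  have h2 := key m le_rfl k₀ hk₀
  rw [hz.iterate, id] at h2
  have h3 : k₀ ≤ n := by zify at hab hb ⊢; rw [hk₀]; linarith [h1.1]
  have h4 : a + m * D ≤ n := by
    have : (0 : ℤ) ≤ m * D := by positivity
    zify at hab hb ⊢; linarith
  have h5 : k₀ = a + m * D := by
    rcases le_total k₀ (a + m * D) with h | h
    · have := hc _ _ h h4
      rw [h2, dist_self] at this
      omega
    · have := hc _ _ h h3
      rw [h2, dist_self] at this
      omega
  have h6 : κ = 0 := by
    rw [h5] at hk₀
    push_cast at hk₀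
    have : (m : ℤ) * κ = 0 := by linarith
    rcases mul_eq_zero.1 this with h | h
    · have := hz.pos
      omega
    · exact h
  have h7 := hcon (a + m * D) (a + m * D) (by omega) (by zify at hab ⊢; linarith [h1.1, h1.2])
    (by rw [h6]; simp)
  exact hz.ne _ h7

/-- Along each long piece of a geodesic there are two geodesics forming a tie. -/
lemma exists_tie (hG : G.IsConnected) {D D₀ m : ℕ} (hB : G.HasBottlenecks D) {z : V → V}
    (hz : G.IsTorsionTranslation z D₀ m) (L : ℕ) :
    ∃ R : ℕ, ∀ (c : ℕ → V) (n s : ℕ), G.IsGeodesicSeq c n → s + R ≤ n →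
      ∃ τ : Tie G (c 0) (c n) (D + D₀), L ≤ τ.l ∧ L ≤ τ.N - τ.r ∧ τ.N ≤ R + D₀ ∧
        ∀ e ∈ τ.region, ∃ v ∈ G.boundary e, G.dist (c s) v ≤ 2 * R + 2 * D₀ := by
  obtain ⟨r₀, hr₀⟩ : ∃ r₀, r₀ = 4 * D + 8 * D₀ + 10 := ⟨_, rfl⟩
  obtain ⟨g, hg⟩ : ∃ g, g = 2 * m * D₀ + 2 * D₀ + 2 := ⟨_, rfl⟩
  obtain ⟨R, hR⟩ : ∃ R, R = nestedLength (L + r₀) r₀ g (2 * D₀ + 1) := ⟨_, rfl⟩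
  refine ⟨R, fun c n s hc hs => ?_⟩
  have hzc : G.IsGeodesicSeq (fun k => z (c k)) n := fun i j hij hj => by
    rw [hz.dist_map, hc i j hij hj]
  have hup : ∀ i j, i ≤ j → j ≤ n → G.dist (c i) (z (c j)) ≤ j - i + D₀ := fun i j hij hj => by
    have h1 := hG.dist_triangle (c i) (c j) (z (c j))
    have h2 := hz.dist_le (c j)
    rw [hc i j hij hj] at h1
    omega
  have hlo : ∀ i j, i ≤ j → j ≤ n → j - i ≤ G.dist (c i) (z (c j)) + D₀ := fun i j hij hj => by
    have h1 := hG.dist_triangle (c i) (z (c j)) (c j)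
    have h2 := hz.dist_le (c j)
    rw [hc i j hij hj, dist_comm (z (c j))] at h1
    omega
  obtain ⟨i₀, i, j, i', j', j₀, h1, h2, h3, h4, h5, h6, h7, h8, h9⟩ :=
    exists_equal_subintervals (L + r₀) r₀ g
      (fun i j => (G.dist (c i) (z (c j)) : ℤ) - ((j : ℤ) - i)) D₀ (2 * D₀ + 1) s
      (fun i' i j j' a1 a2 a3 a4 a5 => by
        rw [← hR] at a5
        have b1 := hG.dist_triangle (c i') (c i) (z (c j'))
        have b2 := hG.dist_triangle (c i) (z (c j)) (z (c j'))
        rw [hc i' i a2 (by omega)] at b1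
        rw [hz.dist_map, hc j j' a4 (by omega)] at b2
        omega)
      (fun i j a1 a2 a3 => by
        rw [← hR] at a3
        have := hup i j a2 (by omega)
        omega)
      (by
        rw [← hR]
        have := hlo s (s + R) (by omega) hs
        push_cast
        omega)
  rw [← hR] at h7
  clear hR
  obtain ⟨κ, hκ⟩ : ∃ κ : ℤ, κ = (G.dist (c i₀) (z (c j₀)) : ℤ) - ((j₀ : ℤ) - i₀) := ⟨_, rfl⟩
  obtain ⟨q, hq⟩ : ∃ q, q = G.dist (c i) (z (c j)) := ⟨_, rfl⟩
  obtain ⟨q', hq'⟩ : ∃ q', q' = G.dist (c i') (z (c j')) := ⟨_, rfl⟩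
  obtain ⟨N, hN⟩ : ∃ N, N = G.dist (c i₀) (z (c j₀)) := ⟨_, rfl⟩
  rw [← hκ, ← hq] at h8
  rw [← hκ, ← hq'] at h9
  rw [← hN] at hκ
  have hκD : |κ| ≤ D₀ := by
    have a1 := hup i₀ j₀ (by omega) (by omega)
    have a2 := hlo i₀ j₀ (by omega) (by omega)
    rw [abs_le]
    omega
  have hκ1 := (abs_le.1 hκD).1
  have hκ2 := (abs_le.1 hκD).2
  obtain ⟨k, k', hk1, hk2, hk3, hk4⟩ := hz.exists_ne_shift hc hκD (a := j + D₀) (b := i' - D₀)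
    (by omega) (by omega)
  obtain ⟨d, hd0, hdq, hd⟩ := hG.exists_geodesicSeq (c i) (z (c j))
  rw [← hq] at hdq hd
  obtain ⟨d', hd0', hdq', hd'⟩ := hG.exists_geodesicSeq (c i') (z (c j'))
  rw [← hq'] at hdq' hd'
  let P : Bool → ℕ → V := fun β => bif β then
      splice (fun k => c (i₀ + k)) d (fun k => z (c (j + k))) (i - i₀) q
    else splice (fun k => c (i₀ + k)) d' (fun k => z (c (j' + k))) (i' - i₀) q'
  have e0 : c (i₀ + (i - i₀)) = d 0 := by rw [hd0]; congr 1; omega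
  have e1 : d q = z (c (j + 0)) := by rw [hdq]; rfl
  have e0' : c (i₀ + (i' - i₀)) = d' 0 := by rw [hd0']; congr 1; omega
  have e1' : d' q' = z (c (j' + 0)) := by rw [hdq']; rfl
  have hPt₁ : ∀ k ≤ i - i₀, P true k = c (i₀ + k) := fun k hk =>
    splice_of_le (c₁ := fun k => c (i₀ + k)) (c₂ := d) (c₃ := fun k => z (c (j + k))) (q := q) hk
  have hPt₂ : ∀ k, i - i₀ + q ≤ k → P true k = z (c (j + (k - (i - i₀) - q))) :=
    fun k hk => splice_of_ge (c₁ := fun k => c (i₀ + k)) (c₃ := fun k => z (c (j + k))) e0 e1 hk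
  have hPf₁ : ∀ k ≤ i' - i₀, P false k = c (i₀ + k) := fun k hk =>
    splice_of_le (c₁ := fun k => c (i₀ + k)) (c₂ := d') (c₃ := fun k => z (c (j' + k))) (q := q') hk
  have hPf₂ : ∀ k, i' - i₀ + q' ≤ k → P false k = z (c (j' + (k - (i' - i₀) - q'))) :=
    fun k hk => splice_of_ge (c₁ := fun k => c (i₀ + k)) (c₃ := fun k => z (c (j' + k))) e0' e1' hk
  have hsub : ∀ a l, a + l ≤ n → G.IsGeodesicSeq (fun k => c (a + k)) l :=
    fun a l hal u v huv hv => by rw [hc _ _ (by omega) (by omega)]; omega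
  have hsubz : ∀ a l, a + l ≤ n → G.IsGeodesicSeq (fun k => z (c (a + k))) l :=
    fun a l hal u v huv hv => by rw [hzc _ _ (by omega) (by omega)]; omega
  have hgeo : ∀ β, G.IsGeodesicSeq (P β) N := by
    rintro (_ | _)
    · have := hG.isGeodesicSeq_splice (c₁ := fun k => c (i₀ + k)) (c₃ := fun k => z (c (j' + k)))
        (m := i' - i₀) (q := q') (l := j₀ - j') e0' e1' (hsub _ _ (by omega)) hd'
        (hsubz _ _ (by omega)) (by
          rw [show j' + (j₀ - j') = j₀ by omega, Nat.add_zero, ← hN]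
          omega)
      rwa [show i' - i₀ + q' + (j₀ - j') = N by omega] at this
    · have := hG.isGeodesicSeq_splice (c₁ := fun k => c (i₀ + k)) (c₃ := fun k => z (c (j + k)))
        (m := i - i₀) (q := q) (l := j₀ - j) e0 e1 (hsub _ _ (by omega)) hd
        (hsubz _ _ (by omega)) (by
          rw [show j + (j₀ - j) = j₀ by omega, Nat.add_zero, ← hN]
          omega)
      rwa [show i - i₀ + q + (j₀ - j) = N by omega] at this
  have hE : Nonempty E := by
    obtain ⟨e, -⟩ := hG.adj_of_dist_eq_one (hc 0 1 (by omega) (by omega))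
    exact ⟨e⟩
  have hadj : ∀ β, ∀ k < N, G.boundary (G.edgeOf (P β k) (P β (k + 1))) =
      s(P β k, P β (k + 1)) := fun β k hk => by
    refine (hG.adj_of_dist_eq_one ?_).boundary_edgeOf
    rw [hgeo β k (k + 1) (by omega) (by omega)]
    omega
  have hleft : ∀ k ≤ i - i₀, P true k = P false k := fun k hk => by
    rw [hPt₁ k hk, hPf₁ k (by omega)]
  have hright : ∀ k, i' - i₀ + q' ≤ k → k ≤ N → P true k = P false k := fun k hk hkN => by
    rw [hPt₂ k (by omega), hPf₂ k hk]
    congr 2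
    omega
  have hPl : P true (i - i₀) = c i := by
    rw [hPt₁ _ le_rfl]
    congr 1
    omega
  have hPr : P true (i' - i₀ + q') = z (c j') := by
    rw [hPt₂ _ (by omega)]
    congr 2
    omega
  have hP0 : P true 0 = c i₀ := hPt₁ 0 (by omega)
  have hPN : P true N = z (c j₀) := by
    rw [hPt₂ _ (by omega)]
    congr 2
    omega
  have hPk : P true (k - i₀) = z (c k') := by
    rw [hPt₂ _ (by omega)]
    congr 2
    omega
  have hPk1 : P true (k - i₀ + 1) = z (c (k' + 1)) := by
    rw [hPt₂ _ (by omega)]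
    congr 2
    omega
  have hPfk : P false (k - i₀) = c k := by
    rw [hPf₁ _ (by omega)]
    congr 1
    omega
  have hnear : ∀ v u, G.near v D ⊆ G.near u (D + D₀) ∨ D₀ < G.dist v u := fun v u => by
    by_cases h : D₀ < G.dist v u
    · exact Or.inr h
    · refine Or.inl fun t ht => ?_
      have a1 := hG.dist_triangle t v u
      have a2 : G.dist t v ≤ D := ht
      exact a1.trans (by omega)
  have hnear₁ : ∀ v, G.near v D ⊆ G.near v (D + D₀) := fun v =>
    (hnear v v).resolve_right (by simp)
  have hnear₂ : ∀ v, G.near v D ⊆ G.near (z v) (D + D₀) := fun v =>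
    (hnear v (z v)).resolve_right (by have := hz.dist_le v; omega)
  have hback : ∀ v t, t ∈ G.near (z v) (D + D₀) → G.dist t v ≤ D + 2 * D₀ := fun v t ht => by
    have a1 := hG.dist_triangle t (z v) v
    have a2 := hz.dist_le v
    have a3 : G.dist t (z v) ≤ D + D₀ := ht
    rw [dist_comm (z v)] at a1
    omega
  have hkN : k - i₀ < N := by omega
  have hedge : ∀ t ∈ G.boundary (G.edgeOf (P true (k - i₀)) (P true (k - i₀ + 1))),
      ∃ k'', k' ≤ k'' ∧ k'' ≤ k' + 1 ∧ G.dist t (c k'') ≤ D₀ := by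
    intro t ht
    rw [hadj true _ hkN, hPk, hPk1, Sym2.mem_iff] at ht
    rcases ht with rfl | rfl
    · exact ⟨k', le_rfl, by omega, by rw [dist_comm]; exact hz.dist_le _⟩
    · exact ⟨k' + 1, by omega, le_rfl, by rw [dist_comm]; exact hz.dist_le _⟩
  let τ : Tie G (c 0) (c n) (D + D₀) :=
    { N := N
      l := i - i₀
      r := i' - i₀ + q'
      k₀ := k - i₀
      P := P
      ed := fun β k => G.edgeOf (P β k) (P β (k + 1))
      l_le := by omega
      lt_r := by omega
      r_le := by omega
      boundary_ed := hadj
      geodesic := hgeo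
      left_eq := hleft
      right_eq := hright
      left_ed := fun k hk => by rw [hleft k hk.le, hleft (k + 1) hk]
      right_ed := fun k hk hk' => by rw [hright k hk hk'.le, hright (k + 1) (by omega) hk']
      ne_ed := fun t ht h => by
        have a1 := hadj false t ht
        rw [h, hadj true _ hkN, Sym2.eq_iff] at a1
        have a2 := hgeo false 0 t (by omega) ht.le
        have a3 := hgeo false 0 (t + 1) (by omega) ht
        have a4 := hgeo true 0 _ (by omega) hkN.le
        have a5 := hgeo true 0 (k - i₀ + 1) (by omega) hkN
        rw [← hleft 0 (by omega)] at a2 a3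
        rcases a1 with ⟨a1, a1'⟩ | ⟨a1, a1'⟩
        · rw [← a1, a4] at a2
          obtain rfl : k - i₀ = t := by omega
          rw [hPk, hPfk] at a1
          exact hk4 a1
        · rw [← a1', a5] at a2
          rw [← a1, a4] at a3
          omega
      visits_left := fun π => by
        rw [hPl]
        exact (hB c n hc i (by omega) π).mono (hnear₁ _)
      visits_right := fun π => by
        rw [hPr]
        exact (hB c n hc j' (by omega) π).mono (hnear₂ _)
      visits_first := fun t ht π => by
        rw [hPl] at ht
        rw [hP0]
        exact (hB.visits hG hc (q := i) (M := D + D₀) (by omega) (by omega) ht π).mono (hnear₁ _)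
      visits_last := fun t ht π => by
        rw [hPr] at ht
        rw [hPN]
        exact (hB.visits_reverse hG hc (q := j') (M := D + 2 * D₀) (by omega) (by omega)
          (hback _ _ ht) π).mono (hnear₂ _)
      visits_order := fun t ht π => by
        rw [hPr] at ht
        rw [hPl]
        exact (hB.visits hG hc (q := j') (M := D + 2 * D₀) (by omega) (by omega)
          (hback _ _ ht) π).mono (hnear₁ _)
      visits_edge_left := fun t ht π => by
        obtain ⟨k'', b1, b2, b3⟩ := hedge t ht
        rw [hPl]
        exact (hB.visits hG hc (q := k'') (M := D₀) (by omega) (by omega) b3 π).mono (hnear₁ _)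
      visits_edge_right := fun t ht π => by
        obtain ⟨k'', b1, b2, b3⟩ := hedge t ht
        rw [hPr]
        exact (hB.visits_reverse hG hc (q := k'') (M := D₀) (by omega) (by omega) b3 π).mono
          (hnear₂ _) }
  refine ⟨τ, show L ≤ i - i₀ by omega, show L ≤ N - (i' - i₀ + q') by omega,
    show N ≤ R + D₀ by omega, fun e he => ?_⟩
  obtain ⟨v, hv, hv'⟩ := he
  have hv' : G.dist (P true 0) v ≤ N ∨ G.dist (P true N) v ≤ N := hv'
  rw [hP0, hPN] at hv'
  refine ⟨v, hv, ?_⟩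
  rcases hv' with hv' | hv'
  · have a1 := hG.dist_triangle (c s) (c i₀) v
    rw [hc s i₀ h1 (by omega)] at a1
    omega
  · have a1 := hG.dist_triangle (c s) (z (c j₀)) v
    have a2 := hup s j₀ (by omega) (by omega)
    omega

end Multigraph
end FPP

namespace FPP
namespace Multigraph

variable {V : Type*} {E : Type*} {G : Multigraph V E}

lemma measurableSet_abs_sub_le (u : ℝ≥0) (η : ℝ) :
    MeasurableSet {w : ℝ≥0 | |(w : ℝ) - u| ≤ η} :=
  (isClosed_le (by fun_prop) continuous_const).measurableSet

lemma measureReal_abs_sub_le_pos {ν : Measure ℝ≥0} [IsProbabilityMeasure ν] {u : ℝ≥0}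
    (hu : u ∈ ν.support) {η : ℝ} (hη : 0 < η) : 0 < ν.real {w : ℝ≥0 | |(w : ℝ) - u| ≤ η} := by
  refine ENNReal.toReal_pos (ne_of_gt ?_) (measure_ne_top _ _)
  refine Measure.mem_support_iff_forall u |>.1 hu _ ?_
  filter_upwards [Metric.closedBall_mem_nhds u hη] with w hw
  rwa [Metric.mem_closedBall, NNReal.dist_eq] at hw

section

variable {x y : V} {D : ℕ} (τ : Tie G x y D) {a s b : ℝ≥0} {η : ℝ}

lemma Tie.setOf_favourable_eq (hfin : τ.region.Finite) :
    {ω | τ.Favourable ω a s b η} = (hfin.toFinset : Set E).pi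
      fun e => {w : ℝ≥0 | |(w : ℝ) - τ.target a s b e| ≤ η} := by
  ext ω
  simp [Tie.Favourable, Set.mem_pi]

lemma Tie.measurableSet_favourable (hfin : τ.region.Finite) :
    MeasurableSet {ω | τ.Favourable ω a s b η} := by
  rw [τ.setOf_favourable_eq hfin]
  exact MeasurableSet.pi (Finset.countable_toSet _) fun e _ => measurableSet_abs_sub_le _ _

/-- Favourable weights occur with a probability bounded below. -/
lemma Tie.pow_le_measureReal_favourable {ν ν' : Measure ℝ≥0} [IsProbabilityMeasure ν]
    [IsProbabilityMeasure ν'] (hfin : τ.region.Finite) {S : Set E}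
    (hS : Disjoint τ.region S) {K : ℕ} (hK : τ.region.ncard ≤ K) {p : ℝ} (hp : 0 ≤ p)
    (hp1 : p ≤ 1) (ha : p ≤ ν.real {w : ℝ≥0 | |(w : ℝ) - a| ≤ η})
    (hs : p ≤ ν.real {w : ℝ≥0 | |(w : ℝ) - s| ≤ η})
    (hb : p ≤ ν.real {w : ℝ≥0 | |(w : ℝ) - b| ≤ η}) :
    p ^ K ≤ (Measure.infinitePi (mixed ν ν' S)).real {ω | τ.Favourable ω a s b η} := by
  rw [τ.setOf_favourable_eq hfin, measureReal_def,
    Measure.infinitePi_pi _ fun e _ => measurableSet_abs_sub_le _ _, ENNReal.toReal_prod]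
  calc p ^ K ≤ p ^ hfin.toFinset.card :=
        pow_le_pow_of_le_one hp hp1 (by rwa [← Set.ncard_eq_toFinset_card _ hfin])
    _ = ∏ _e ∈ hfin.toFinset, p := (Finset.prod_const _).symm
    _ ≤ _ := Finset.prod_le_prod (fun _ _ => hp) fun e he => by
        rw [mixed_of_notMem (Set.disjoint_left.1 hS (hfin.mem_toFinset.1 he)),
          ← measureReal_def]
        unfold Tie.target
        split_ifs <;> assumption

end

/-- The gain obtained by changing the law of the distinguished edge of a tie. -/
lemma Tie.integral_add_le [Countable E] (hG : G.IsConnected) {x y : V} {D : ℕ}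
    (τ : Tie G x y D) {a s b : ℝ≥0} {η : ℝ} {ν ν' : Measure ℝ≥0}
    [IsProbabilityMeasure ν] [IsProbabilityMeasure ν'] (hν : HasFiniteMean ν)
    (hν' : HasFiniteMean ν') (hvar : MoreVariable ν' ν) (hab : a ≤ b) (hsb : s ≤ b)
    (hη : 0 ≤ η) (hηb : 2 * η ≤ b - a) (hD : D < τ.l) (hD' : D < τ.N - τ.r)
    (hl : 10 * b * D ≤ ((b : ℝ) - a) * τ.l)
    (hr : 10 * b * D ≤ ((b : ℝ) - a) * (τ.N - τ.r : ℕ))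
    (hfin : τ.region.Finite) {S : Set E} (hS : Disjoint τ.region S) :
    ∫ ω, (infTime (G.trails x y) ω : ℝ) ∂Measure.infinitePi (mixed ν ν' (insert τ.e₀ S)) +
      (Measure.infinitePi (mixed ν ν' S)).real {ω | τ.Favourable ω a s b η} *
        (truncationGain ν ν' s - 2 * (2 * τ.N * η)) ≤
      ∫ ω, (infTime (G.trails x y) ω : ℝ) ∂Measure.infinitePi (mixed ν ν' S) := by
  classical
  have he₀ : τ.e₀ ∉ S := Set.disjoint_left.1 hS τ.e₀_mem_region
  refine integral_infTime_add_le_of_moreVariable _ _ τ.e₀ (fun i hi => mixed_insert_of_ne hi)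
    (hasFiniteMean_mixed hν hν' _) (hasFiniteMean_mixed hν hν' _) ?_ (hG.trails_nonempty x y)
    subset_rfl (τ.measurableSet_favourable hfin) fun ω hω => ?_
  · rwa [mixed_of_mem (Set.mem_insert _ _), mixed_of_notMem he₀]
  · rw [mixed_of_mem (Set.mem_insert _ _), mixed_of_notMem he₀]
    obtain ⟨A, hA⟩ := Tie.Favourable.exists_abs_sub_le hG hω hab hsb hη hηb hD hD' hl hr
    simp only [hG.passageTime_eq_infTime] at hA
    exact truncationGain_le_of_abs_sub_le (hG.trails_nonempty x y) subset_rfl ω τ.e₀ hν hν' hA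

/-- A connected graph with bottlenecks, balls of bounded size and a torsion translation has the
van den Berg-Kesten property. -/
theorem vdBK_of_isTorsionTranslation [Countable E] (hG : G.IsConnected) {D D₀ m : ℕ}
    (hB : G.HasBottlenecks D) {z : V → V} (hz : G.IsTorsionTranslation z D₀ m)
    (hdeg : ∀ ρ : ℕ, ∃ K : ℕ, ∀ v, {e | ∃ u ∈ G.boundary e, G.dist v u ≤ ρ}.Finite ∧
      {e | ∃ u ∈ G.boundary e, G.dist v u ≤ ρ}.ncard ≤ K) : G.VdBK := by
  intro ν ν' _ _ hν hν' hsub hvar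
  obtain ⟨s, hs, hgain⟩ := hvar.exists_mem_support
  obtain ⟨a, ha, b, hb, hab, hsb⟩ : ∃ a ∈ ν.support, ∃ b ∈ ν.support, a < b ∧ s ≤ b := by
    obtain ⟨s', hs', hne⟩ := hsub.nontrivial_support.exists_ne s
    rcases lt_or_gt_of_ne hne with h | h
    · exact ⟨s', hs', s, hs, h, le_rfl⟩
    · exact ⟨s, hs, s', hs', h, h.le⟩
  have hab' : (0 : ℝ) < b - a := sub_pos.2 hab
  obtain ⟨L₀, hL₀⟩ := exists_nat_ge (10 * b * ((D + D₀ : ℕ) : ℝ) / ((b : ℝ) - a))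
  obtain ⟨L, hL⟩ : ∃ L, L = L₀ + D + D₀ + 1 := ⟨_, rfl⟩
  have hLb : ∀ k : ℕ, L ≤ k → 10 * b * ((D + D₀ : ℕ) : ℝ) ≤ ((b : ℝ) - a) * k := fun k hk => by
    rw [div_le_iff₀ hab'] at hL₀
    have : (L₀ : ℝ) ≤ k := by exact_mod_cast (by omega : L₀ ≤ k)
    nlinarith
  obtain ⟨R, hR⟩ := exists_tie hG hB hz L
  obtain ⟨ρ, hρ⟩ : ∃ ρ, ρ = 2 * R + 2 * D₀ := ⟨_, rfl⟩
  obtain ⟨K, hK⟩ := hdeg ρ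
  obtain ⟨η, hη, hηb, hηg⟩ : ∃ η : ℝ, 0 < η ∧ 2 * η ≤ b - a ∧
      2 * (2 * ((R + D₀ : ℕ) : ℝ) * η) ≤ truncationGain ν ν' s / 2 := by
    refine ⟨min (((b : ℝ) - a) / 2) (truncationGain ν ν' s / (8 * ((R + D₀ : ℕ) + 1))),
      by positivity, ?_, ?_⟩
    · linarith [min_le_left (((b : ℝ) - a) / 2)
        (truncationGain ν ν' s / (8 * ((R + D₀ : ℕ) + 1)))]
    · have h1 := min_le_right (((b : ℝ) - a) / 2)
        (truncationGain ν ν' s / (8 * ((R + D₀ : ℕ) + 1)))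
      have h2 : (0 : ℝ) ≤ ((R + D₀ : ℕ) : ℝ) := by positivity
      rw [le_div_iff₀ (by positivity)] at h1
      have h3 : 0 < min (((b : ℝ) - a) / 2)
        (truncationGain ν ν' s / (8 * ((R + D₀ : ℕ) + 1))) := by positivity
      nlinarith
  obtain ⟨p, hp, hp1, hpa, hps, hpb⟩ : ∃ p : ℝ, 0 < p ∧ p ≤ 1 ∧
      p ≤ ν.real {w : ℝ≥0 | |(w : ℝ) - a| ≤ η} ∧ p ≤ ν.real {w : ℝ≥0 | |(w : ℝ) - s| ≤ η} ∧
      p ≤ ν.real {w : ℝ≥0 | |(w : ℝ) - b| ≤ η} :=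
    ⟨min (ν.real {w : ℝ≥0 | |(w : ℝ) - a| ≤ η}) (min (ν.real {w : ℝ≥0 | |(w : ℝ) - s| ≤ η})
      (ν.real {w : ℝ≥0 | |(w : ℝ) - b| ≤ η})),
      lt_min (measureReal_abs_sub_le_pos ha hη) (lt_min (measureReal_abs_sub_le_pos hs hη)
        (measureReal_abs_sub_le_pos hb hη)),
      (min_le_left _ _).trans measureReal_le_one, min_le_left _ _,
      (min_le_right _ _).trans (min_le_left _ _), (min_le_right _ _).trans (min_le_right _ _)⟩
  obtain ⟨δ, hδ⟩ : ∃ δ, δ = p ^ K * (truncationGain ν ν' s / 2) := ⟨_, rfl⟩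
  have hδ0 : 0 < δ := by rw [hδ]; positivity
  obtain ⟨W, hW⟩ : ∃ W, W = 2 * ρ + R + 2 := ⟨_, rfl⟩
  have key : ∀ x y, ((G.dist x y / W : ℕ) : ℝ) * δ ≤
      G.expectedPassageTime ν x y - G.expectedPassageTime ν' x y := by
    intro x y
    obtain ⟨c, rfl, hcy, hc⟩ := hG.exists_geodesicSeq x y
    obtain ⟨n, hn⟩ : ∃ n, n = G.dist (c 0) y := ⟨_, rfl⟩
    rw [← hn] at hcy hc ⊢
    subst hcy
    have step : ∀ k ≤ n / W, ∃ S : Set E,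
        (∀ e ∈ S, ∃ v ∈ G.boundary e, ∃ i < k, G.dist (c (i * W)) v ≤ ρ) ∧
        ∫ ω, (infTime (G.trails (c 0) (c n)) ω : ℝ) ∂Measure.infinitePi (mixed ν ν' S) + k * δ ≤
          ∫ ω, (infTime (G.trails (c 0) (c n)) ω : ℝ) ∂Measure.infinitePi (mixed ν ν' ∅) := by
      intro k
      induction k with
      | zero => exact fun _ => ⟨∅, by simp, by simp⟩
      | succ k ih =>
        intro hk
        obtain ⟨S, hS, hSk⟩ := ih (by omega)
        have hkW : (k + 1) * W ≤ n := (Nat.mul_le_mul_right W hk).trans (Nat.div_mul_le_self n W)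
        have hkW' : (k + 1) * W = k * W + W := by ring
        obtain ⟨τ, h1, h2, h3, h4⟩ := hR c n (k * W) hc (by omega)
        rw [← hρ] at h4
        have hregion : τ.region ⊆ {e | ∃ u ∈ G.boundary e, G.dist (c (k * W)) u ≤ ρ} := h4
        have hfin : τ.region.Finite := (hK _).1.subset hregion
        have hcard : τ.region.ncard ≤ K :=
          (Set.ncard_le_ncard hregion (hK _).1).trans (hK _).2
        have hdisj : Disjoint τ.region S := by
          refine Set.disjoint_left.2 fun e he heS => ?_
          obtain ⟨u, hu, hu'⟩ := h4 e he
          obtain ⟨v, hv, i, hi, hv'⟩ := hS e heS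
          have h5 : G.dist u v ≤ 1 := by
            by_cases huv : u = v
            · simp [huv]
            · exact dist_le_one_of_boundary ((Sym2.mem_and_mem_iff huv).1 ⟨hu, hv⟩)
          have h6 : (i + 1) * W ≤ k * W := Nat.mul_le_mul_right W hi
          have h7 : (i + 1) * W = i * W + W := by ring
          have h8 := hc (i * W) (k * W) (by omega) (by omega)
          have h9 := hG.dist_triangle (c (i * W)) v (c (k * W))
          have h10 := hG.dist_triangle v u (c (k * W))
          rw [dist_comm v u, dist_comm u (c _)] at h10
          omega
        refine ⟨insert τ.e₀ S, ?_, ?_⟩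
        · rintro e (rfl | he)
          · obtain ⟨u, hu, hu'⟩ := h4 _ τ.e₀_mem_region
            exact ⟨u, hu, k, by omega, hu'⟩
          · obtain ⟨v, hv, i, hi, hv'⟩ := hS e he
            exact ⟨v, hv, i, by omega, hv'⟩
        · have h5 := τ.integral_add_le hG hν hν' hvar.1 hab.le hsb hη.le hηb (by omega) (by omega)
            (hLb _ h1) (hLb _ h2) hfin hdisj
          have h6 := τ.pow_le_measureReal_favourable (ν := ν) (ν' := ν') (S := S) (a := a)
            (s := s) (b := b) (η := η) hfin hdisj hcard hp.le hp1 hpa hps hpb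
          have h7 : truncationGain ν ν' s / 2 ≤ truncationGain ν ν' s - 2 * (2 * τ.N * η) := by
            have h8 : (τ.N : ℝ) ≤ (R + D₀ : ℕ) := by exact_mod_cast h3
            nlinarith
          have h8 := mul_le_mul h6 h7 (by positivity) measureReal_nonneg
          rw [← hδ] at h8
          push_cast
          linarith
    obtain ⟨S, -, hS⟩ := step _ le_rfl
    have hmixed : (mixed ν ν' (∅ : Set E)) = fun _ => ν :=
      funext fun e => mixed_of_notMem (Set.notMem_empty e)
    have h1 := integral_mixed_univ_le (x := c 0) (y := c n) hG hν hν' hvar.1 S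
    rw [hmixed] at hS
    simp only [expectedPassageTime, hG.passageTime_eq_infTime]
    linarith
  have hW0 : (0 : ℝ) < W := by rw [hW]; positivity
  refine lt_of_lt_of_le (b := ((δ / (2 * W) : ℝ) : EReal))
    (EReal.coe_pos.2 (div_pos hδ0 (by linarith))) ?_
  refine le_liminf_of_le (by isBoundedDefault) ?_
  filter_upwards [preimage_mem_comap (Ici_mem_atTop W)] with q hq
  have hq : W ≤ G.dist q.1 q.2 := hq
  refine EReal.coe_le_coe_iff.2 ?_
  have hn0 : (0 : ℝ) < G.dist q.1 q.2 := lt_of_lt_of_le hW0 (by exact_mod_cast hq)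
  rw [le_div_iff₀ hn0]
  refine le_trans ?_ (key q.1 q.2)
  have h1 : G.dist q.1 q.2 ≤ 2 * W * (G.dist q.1 q.2 / W) := by
    have h2 := Nat.div_add_mod (G.dist q.1 q.2) W
    have h3 := Nat.mod_lt (G.dist q.1 q.2) (show 0 < W by omega)
    have h4 : 1 ≤ G.dist q.1 q.2 / W := (Nat.one_le_div_iff (by omega)).2 hq
    nlinarith
  have h1' : (G.dist q.1 q.2 : ℝ) ≤ 2 * W * (G.dist q.1 q.2 / W : ℕ) := by exact_mod_cast h1
  rw [div_mul_eq_mul_div, div_le_iff₀ (by positivity)]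
  nlinarith

end Multigraph
end FPP

namespace FreeGroup

variable {α : Type*}

section LastLetter

variable [DecidableEq α]

/-- The last letter of the reduced word of an element of a free group. -/
def lastLetter (g : FreeGroup α) : Option (α × Bool) := g.toWord.getLast?

lemma exists_lastLetter {g : FreeGroup α} (hg : g ≠ 1) : ∃ x, g.lastLetter = some x := by
  rw [lastLetter, ← Option.isSome_iff_exists, List.getLast?_isSome]
  simpa using hg

lemma toWord_letter_mul (x : α × Bool) (g : FreeGroup α) :
    (mk [x] * g).toWord = reduce (x :: g.toWord) := by
  conv_lhs => rw [← mk_toWord (x := g), mul_mk, toWord_mk]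
  rfl

lemma lastLetter_letter_mul (x : α × Bool) {g : FreeGroup α} (hg : g ≠ 1) (hxg : mk [x] * g ≠ 1) :
    (mk [x] * g).lastLetter = g.lastLetter := by
  have h : (mk [x] * g).toWord ≠ [] := by simpa using hxg
  rw [lastLetter, lastLetter]
  rw [toWord_letter_mul, reduce.cons, reduce_toWord] at h ⊢
  have hg' : g.toWord ≠ [] := by simpa using hg
  cases hw : g.toWord with
  | nil => exact absurd hw hg'
  | cons y L =>
    rw [hw] at h
    simp only at h ⊢
    split_ifs at h ⊢
    · exact (List.getLast?_cons_of_ne_nil h).symm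
    · exact List.getLast?_cons_of_ne_nil (by simp)

lemma norm_le_norm_mul_add (s g : FreeGroup α) : g.norm ≤ (s * g).norm + s.norm := by
  have h := norm_mul_le s⁻¹ (s * g)
  rw [inv_mul_cancel_left, norm_inv_eq] at h
  omega

lemma lastLetter_mul_of_length_lt (L : List (α × Bool)) {g : FreeGroup α} (h : L.length < g.norm) :
    (mk L * g).lastLetter = g.lastLetter := by
  induction L with
  | nil => rw [← one_eq_mk, one_mul]
  | cons x L ih =>
    rw [List.length_cons] at h
    have h1 : (mk (x :: L) : FreeGroup α) = mk [x] * mk L := by simp [mul_mk]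
    have h2 := norm_le_norm_mul_add (mk L) g
    have h3 := norm_le_norm_mul_add (mk (x :: L)) g
    have h4 : (mk L : FreeGroup α).norm ≤ L.length := norm_mk_le
    have h5 : (mk (x :: L) : FreeGroup α).norm ≤ L.length + 1 := norm_mk_le
    rw [h1, mul_assoc] at *
    rw [lastLetter_letter_mul, ih (by omega)]
    · rw [Ne, ← norm_eq_zero]
      omega
    · rw [Ne, ← norm_eq_zero]
      omega

lemma lastLetter_mul_of_norm_lt {s g : FreeGroup α} (h : s.norm < g.norm) :
    (s * g).lastLetter = g.lastLetter := by
  rw [← mk_toWord (x := s)]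
  exact lastLetter_mul_of_length_lt _ h

lemma norm_mul_inv_letter {g : FreeGroup α} {x : α × Bool} (h : g.lastLetter = some x) :
    (g * (mk [x])⁻¹).norm + 1 ≤ g.norm := by
  obtain ⟨L, hL⟩ := List.getLast?_eq_some_iff.1 h
  have h1 : g = mk L * mk [x] := by rw [mul_mk, ← hL, mk_toWord]
  have h2 : g.norm = L.length + 1 := by rw [norm, hL, List.length_append, List.length_singleton]
  rw [h2]
  conv_lhs => rw [h1, mul_inv_cancel_right]
  have h3 : (mk L : FreeGroup α).norm ≤ L.length := norm_mk_le
  omega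

lemma norm_mul_inv_letter_le (g : FreeGroup α) (x : α × Bool) :
    (g * (mk [x])⁻¹).norm ≤ g.norm + 1 := by
  refine (norm_mul_le _ _).trans ?_
  have h3 : (mk [x] : FreeGroup α).norm ≤ 1 := norm_mk_le
  rw [norm_inv_eq]
  omega

/-- Medians in the Cayley tree of a free group: any two of three given elements different from the
median lie in different components of the complement of the median. -/
lemma exists_median (a b t : FreeGroup α) : ∃ m : FreeGroup α,
    ∀ g ∈ ({(a, b), (a, t), (t, b)} : Set (FreeGroup α × FreeGroup α)),
      g.1 * m⁻¹ = 1 ∨ g.2 * m⁻¹ = 1 ∨ (g.1 * m⁻¹).lastLetter ≠ (g.2 * m⁻¹).lastLetter := by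
  obtain ⟨F, hF⟩ : ∃ F : FreeGroup α → ℕ,
      F = fun m => (a * m⁻¹).norm + (b * m⁻¹).norm + (t * m⁻¹).norm := ⟨_, rfl⟩
  refine ⟨Function.argmin F, ?_⟩
  have hm (x : α × Bool) := Function.argmin_le F (mk [x] * Function.argmin F)
  generalize Function.argmin F = m at hm
  have key (u v w : FreeGroup α)
      (huvw : F = fun m => (u * m⁻¹).norm + (v * m⁻¹).norm + (w * m⁻¹).norm) :
      u * m⁻¹ = 1 ∨ v * m⁻¹ = 1 ∨ (u * m⁻¹).lastLetter ≠ (v * m⁻¹).lastLetter := by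
    by_contra! h
    obtain ⟨x, hx⟩ := exists_lastLetter h.1
    have h1 := hm x
    simp only [huvw, mul_inv_rev, ← mul_assoc] at h1
    have h2 := norm_mul_inv_letter hx
    have h3 := norm_mul_inv_letter (h.2.2 ▸ hx)
    have h4 := norm_mul_inv_letter_le (w * m⁻¹) x
    omega
  rintro g (rfl | rfl | rfl)
  · exact key _ _ t hF
  · exact key _ _ b (hF.trans (funext fun _ => by ring))
  · exact key _ _ a (hF.trans (funext fun _ => by ring))

lemma toWord_mul_letter {g : FreeGroup α} {x : α × Bool} (h : g.lastLetter ≠ some (x.1, !x.2)) :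
    (g * mk [x]).toWord = g.toWord ++ [x] := by
  conv_lhs => rw [← mk_toWord (x := g), mul_mk, toWord_mk]
  refine IsReduced.reduce_eq (List.isChain_append.2 ⟨isReduced_toWord, List.isChain_singleton _, ?_⟩)
  rintro y hy _ ⟨⟩ h1
  by_contra h2
  refine h ?_
  rw [lastLetter, Option.mem_def.1 hy, ← h1]
  congr 1
  ext
  · rfl
  · simpa using Bool.eq_not_of_ne h2

lemma finite_norm_le [Finite α] (r : ℕ) : {g : FreeGroup α | g.norm ≤ r}.Finite :=
  (List.finite_length_le (α × Bool) r).preimage toWord_injective.injOn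

end LastLetter

/-- A free group with nontrivial center has at most one generator. -/
lemma subsingleton_of_forall_commute {y : FreeGroup α} (hy : y ≠ 1) (h : ∀ g, Commute g y) :
    Subsingleton α := by
  classical
  obtain ⟨l, hl⟩ := exists_lastLetter hy
  have key (x : α × Bool) : l.1 = x.1 := by
    by_contra hx
    have h1 : y.lastLetter ≠ some (x.1, !x.2) := by
      rw [hl]
      rintro ⟨⟩
      exact hx rfl
    have h2 := toWord_mul_letter h1
    have h3 : mk [x] * y ≠ 1 := by
      rw [(h _).eq, Ne, ← toWord_eq_nil_iff, h2]
      simp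
    have h4 := lastLetter_letter_mul x hy h3
    rw [(h _).eq, lastLetter, h2, List.getLast?_concat, hl] at h4
    obtain ⟨⟩ := h4
    exact hx rfl
  exact ⟨fun a b => (key (a, true)).symm.trans (key (b, true))⟩

/-- A finitely generated free group has finitely many free generators. -/
lemma finite_of_fg [Group.FG (FreeGroup α)] : Finite α := by
  obtain ⟨S, hS⟩ := (Group.fg_def.1 ‹Group.FG (FreeGroup α)›)
  have h1 : Function.Injective
      fun (φ : FreeGroup α →* Multiplicative (ZMod 2)) (s : S) => φ s := fun φ ψ h =>
    MonoidHom.eq_of_eqOn_dense hS fun s hs => congrFun h ⟨s, hs⟩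
  have := Finite.of_injective _ (h1.comp (FreeGroup.lift (α := α)).injective)
  classical
  refine Finite.of_injective
    (fun (a b : α) => (Multiplicative.ofAdd (if a = b then 1 else 0 : ZMod 2))) fun a b h => ?_
  have h2 := congrFun h b
  by_contra hab
  simp only [hab, if_false, if_true] at h2
  exact absurd h2 (by decide)

end FreeGroup

namespace FPP
namespace Multigraph

section Bottleneck

variable {V E α : Type*} {G : Multigraph V E} [DecidableEq α]

lemma lastLetter_eq_of_not_visits {k : V → FreeGroup α} {C : ℕ}
    (hk : ∀ u v, G.Adj u v → (k u * (k v)⁻¹).norm ≤ C) (m : FreeGroup α) {x y : V}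
    (π : Walk G x y) (h : ¬ π.Visits {g | (k g * m⁻¹).norm ≤ C}) :
    (k x * m⁻¹).lastLetter = (k y * m⁻¹).lastLetter := by
  induction π with
  | nil u => rfl
  | @cons u v w e he p ih =>
    rw [Walk.visits_cons, not_or] at h
    rw [← ih h.2]
    have h1 : ¬ p.Visits {g | (k g * m⁻¹).norm ≤ C} := h.2
    have h2 : ¬ (k v * m⁻¹).norm ≤ C := fun h3 => h1 (Walk.visits_start p h3)
    have h3 : k u * m⁻¹ = (k u * (k v)⁻¹) * (k v * m⁻¹) := by group
    rw [h3]
    exact FreeGroup.lastLetter_mul_of_norm_lt ((hk u v ⟨e, he⟩).trans_lt (by omega))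

/-- A graph with a map to a free group which is a quasi-isometric embedding for the right-invariant
word metric has bottlenecks. -/
lemma IsConnected.hasBottlenecks (hG : G.IsConnected) {k : V → FreeGroup α} {C K : ℕ}
    (hk : ∀ u v, G.Adj u v → (k u * (k v)⁻¹).norm ≤ C)
    (hK : ∀ u v, (k u * (k v)⁻¹).norm ≤ 2 * C → G.dist u v ≤ K) : G.HasBottlenecks (2 * K) := by
  intro c n hc i hi π
  obtain ⟨m, hm⟩ := FreeGroup.exists_median (k (c 0)) (k (c n)) (k (c i))
  have hvis (u v : V) (hmem : (k u, k v) ∈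
      ({(k (c 0), k (c n)), (k (c 0), k (c i)), (k (c i), k (c n))} :
        Set (FreeGroup α × FreeGroup α))) (p : Walk G u v) :
      p.Visits {g | (k g * m⁻¹).norm ≤ C} := by
    rcases hm _ hmem with h | h | h
    · exact Walk.visits_start p (by simp only [Set.mem_ofPred_eq]; rw [h]; simp)
    · exact Walk.visits_end p (by simp only [Set.mem_ofPred_eq]; rw [h]; simp)
    · by_contra hp
      exact h (lastLetter_eq_of_not_visits hk m p hp)
  have hclose (u v : V) (hu : (k u * m⁻¹).norm ≤ C) (hv : (k v * m⁻¹).norm ≤ C) :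
      G.dist u v ≤ K := by
    refine hK u v ?_
    have h1 : k u * (k v)⁻¹ = (k u * m⁻¹) * (k v * m⁻¹)⁻¹ := by group
    rw [h1]
    refine (FreeGroup.norm_mul_le _ _).trans ?_
    rw [FreeGroup.norm_inv_eq]
    omega
  obtain ⟨p, hp⟩ := hG.exists_length_eq (c 0) (c i)
  obtain ⟨q, hq⟩ := hG.exists_length_eq (c i) (c n)
  obtain ⟨v, hv, p₁, p₂, rfl⟩ := hvis _ _ (by simp) p
  obtain ⟨w, hw, q₁, q₂, rfl⟩ := hvis _ _ (by simp) q
  rw [Walk.length_append] at hp hq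
  have hp₁ := dist_le p₁
  have hp₂ := dist_le p₂
  have hq₁ := dist_le q₁
  have hq₂ := dist_le q₂
  refine (hvis _ _ (by simp) π).mono fun g hg => ?_
  have h1 := hclose v w hv hw
  have h2 := hclose g v hg hv
  have h3 := hG.dist_triangle (c 0) v (c n)
  have h4 := hG.dist_triangle v w (c n)
  have h5 := hG.dist_triangle g v (c i)
  have h9 := hG.dist_triangle v (c i) w
  have h6 := hc 0 i (by omega) hi
  have h7 := hc i n hi le_rfl
  have h8 := hc 0 n (by omega) le_rfl
  change G.dist g (c i) ≤ 2 * K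
  omega

end Bottleneck

section Cayley

variable {Γ S E : Type*} [Group Γ] {f : S → Γ} {G : Multigraph Γ E}

/-- `G` is a Cayley graph for the family `f` of generators: every edge joins some `g` to some
`g * f s`, with edges labelled injectively by pairs `(g, s)`. -/
structure IsCayley (G : Multigraph Γ E) (f : S → Γ) : Prop where
  adj : ∀ g s, G.Adj g (g * f s)
  exists_label : ∃ l : E → Γ × S, Function.Injective l ∧
    ∀ e, G.boundary e = s((l e).1, (l e).1 * f (l e).2)

namespace IsCayley

lemma exists_of_adj (hG : G.IsCayley f) {u v : Γ} (h : G.Adj u v) :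
    ∃ s, v = u * f s ∨ u = v * f s := by
  obtain ⟨e, he⟩ := h
  obtain ⟨l, -, hl⟩ := hG.exists_label
  rw [hl e, Sym2.eq_iff] at he
  obtain ⟨h1, h2⟩ | ⟨h1, h2⟩ := he
  · exact ⟨(l e).2, .inl (by rw [← h1, ← h2])⟩
  · exact ⟨(l e).2, .inr (by rw [← h1, ← h2])⟩

lemma adj_mul (hG : G.IsCayley f) (g : Γ) {u v : Γ} (h : G.Adj u v) : G.Adj (g * u) (g * v) := by
  obtain ⟨s, rfl | rfl⟩ := hG.exists_of_adj h
  · rw [← mul_assoc]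
    exact hG.adj _ s
  · rw [← mul_assoc]
    exact (hG.adj _ s).symm

lemma exists_walk_mul (hG : G.IsCayley f) (g : Γ) {u v : Γ} (p : Walk G u v) :
    ∃ q : Walk G (g * u) (g * v), q.length = p.length := by
  induction p with
  | nil u => exact ⟨.nil _, rfl⟩
  | cons e he p ih =>
    obtain ⟨q, hq⟩ := ih
    obtain ⟨e', he'⟩ := hG.adj_mul g ⟨e, he⟩
    exact ⟨.cons e' he' q, by simp [hq]⟩

lemma isConnected (hG : G.IsCayley f) (hf : Subgroup.closure (Set.range f) = ⊤) :
    G.IsConnected := by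
  intro u v
  have h (g : Γ) : Nonempty (Walk G 1 g) := by
    have hg : g ∈ Subgroup.closure (Set.range f) := hf ▸ Subgroup.mem_top g
    induction hg using Subgroup.closure_induction with
    | mem g hg =>
      obtain ⟨s, rfl⟩ := hg
      obtain ⟨e, he⟩ := hG.adj 1 s
      rw [one_mul] at he
      exact ⟨.cons e he (.nil _)⟩
    | one => exact ⟨.nil _⟩
    | mul g h _ _ hg hh =>
      obtain ⟨q, -⟩ := hG.exists_walk_mul g hh.some
      rw [mul_one] at q
      exact ⟨hg.some.append q⟩
    | inv g _ hg =>
      obtain ⟨q, -⟩ := hG.exists_walk_mul g⁻¹ hg.some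
      rw [mul_one, inv_mul_cancel] at q
      exact ⟨q.reverse⟩
  obtain ⟨q, -⟩ := hG.exists_walk_mul u (h (u⁻¹ * v)).some
  rw [mul_one, mul_inv_cancel_left] at q
  exact ⟨q⟩

lemma dist_mul (hG : G.IsCayley f) (hc : G.IsConnected) (g u v : Γ) :
    G.dist (g * u) (g * v) = G.dist u v := by
  have h (g u v : Γ) : G.dist (g * u) (g * v) ≤ G.dist u v := by
    obtain ⟨p, hp⟩ := hc.exists_length_eq u v
    obtain ⟨q, hq⟩ := hG.exists_walk_mul g p
    have := Multigraph.dist_le q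
    omega
  refine le_antisymm (h g u v) ?_
  have h1 := h g⁻¹ (g * u) (g * v)
  rwa [inv_mul_cancel_left, inv_mul_cancel_left] at h1

lemma dist_eq (hG : G.IsCayley f) (hc : G.IsConnected) (u v : Γ) :
    G.dist u v = G.dist 1 (u⁻¹ * v) := by
  rw [← hG.dist_mul hc u⁻¹, inv_mul_cancel]

lemma finite_adj [Finite S] (hG : G.IsCayley f) (u : Γ) : {v | G.Adj u v}.Finite := by
  refine ((Set.finite_range fun s => u * f s).union (Set.finite_range fun s => u * (f s)⁻¹)).subset
    fun v hv => ?_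
  obtain ⟨s, h | h⟩ := hG.exists_of_adj hv
  · exact .inl ⟨s, h.symm⟩
  · exact .inr ⟨s, by simp [h]⟩

lemma finite_length_eq [Finite S] (hG : G.IsCayley f) (n : ℕ) (u : Γ) :
    {v | ∃ p : Walk G u v, p.length = n}.Finite := by
  induction n generalizing u with
  | zero =>
    refine (Set.finite_singleton u).subset ?_
    rintro v ⟨p, hp⟩
    exact (p.eq_of_length_eq_zero hp).symm
  | succ n ih =>
    refine ((hG.finite_adj u).biUnion fun w _ => ih w).subset ?_
    rintro v ⟨p, hp⟩
    cases p with
    | nil => simp at hp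
    | cons e he p =>
      rw [Walk.length_cons] at hp
      exact Set.mem_biUnion (show _ ∈ {v | G.Adj u v} from ⟨e, he⟩) ⟨p, by omega⟩

lemma finite_ball [Finite S] (hG : G.IsCayley f) (hc : G.IsConnected) (u : Γ) (r : ℕ) :
    {v | G.dist u v ≤ r}.Finite := by
  refine ((Set.finite_Iic r).biUnion fun n _ => hG.finite_length_eq n u).subset fun v hv => ?_
  obtain ⟨p, hp⟩ := hc.exists_length_eq u v
  exact Set.mem_biUnion (show G.dist u v ∈ Set.Iic r from hv) ⟨p, hp⟩

lemma exists_ncard_le [Finite S] (hG : G.IsCayley f) (hc : G.IsConnected) (ρ : ℕ) :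
    ∃ K : ℕ, ∀ v, {e | ∃ u ∈ G.boundary e, G.dist v u ≤ ρ}.Finite ∧
      {e | ∃ u ∈ G.boundary e, G.dist v u ≤ ρ}.ncard ≤ K := by
  obtain ⟨l, hl, hlb⟩ := hG.exists_label
  refine ⟨({v | G.dist 1 v ≤ ρ + 1} ×ˢ (Set.univ : Set S)).ncard, fun v => ?_⟩
  have hmaps : Set.MapsTo (fun e => (v⁻¹ * (l e).1, (l e).2))
      {e | ∃ u ∈ G.boundary e, G.dist v u ≤ ρ}
      ({v | G.dist 1 v ≤ ρ + 1} ×ˢ (Set.univ : Set S)) := by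
    rintro e ⟨u, hu, hvu⟩
    refine ⟨?_, trivial⟩
    change G.dist 1 (v⁻¹ * (l e).1) ≤ ρ + 1
    rw [← hG.dist_eq hc]
    have h1 := hc.dist_triangle v u (l e).1
    have h2 : G.dist u (l e).1 ≤ 1 := by
      rw [hlb, Sym2.mem_iff] at hu
      obtain rfl | rfl := hu
      · simp
      · exact dist_le_one_of_boundary ((hlb e).trans Sym2.eq_swap)
    omega
  have hinj : Function.Injective fun e => (v⁻¹ * (l e).1, (l e).2) := fun e e' h => by
    simp only [Prod.mk.injEq, mul_right_inj] at h
    exact hl (Prod.ext h.1 h.2)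
  have hfin := (hG.finite_ball hc 1 (ρ + 1)).prod (Set.finite_univ (α := S))
  exact ⟨Set.Finite.of_injOn hmaps hinj.injOn hfin, Set.ncard_le_ncard_of_injOn _ hmaps hinj.injOn hfin⟩

lemma isTorsionTranslation (hG : G.IsCayley f) (hc : G.IsConnected) {z : Γ} (hz : z ≠ 1)
    (hord : IsOfFinOrder z) (hconj : (Set.range fun g => g⁻¹ * z * g).Finite) :
    ∃ D, G.IsTorsionTranslation (z * ·) D (orderOf z) := by
  obtain ⟨D, hD⟩ := (hconj.image fun g => G.dist 1 g).bddAbove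
  refine ⟨D, fun u v => hG.dist_mul hc z u v, fun v => ?_, fun v => by simpa using hz, ?_,
    hord.orderOf_pos⟩
  · rw [hG.dist_eq hc, ← mul_assoc]
    exact hD ⟨_, ⟨v, rfl⟩, rfl⟩
  · rw [mul_left_iterate, pow_orderOf_eq_one]
    exact funext one_mul

end IsCayley
end Cayley
end Multigraph

lemma isCayley_unreducedCayley {Γ S : Type*} [Group Γ] (f : S → Γ) (hf : ∀ s, f s ≠ 1) :
    (unreducedCayley f hf).IsCayley f where
  adj g s := ⟨(g, s), rfl⟩
  exists_label := ⟨id, Function.injective_id, fun _ => rfl⟩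

lemma isCayley_reducedCayley {Γ S : Type*} [Group Γ] (f : S → Γ) (hf : ∀ s, f s ≠ 1) :
    (reducedCayley f).IsCayley f where
  adj g s := ⟨⟨s(g, g * f s), by simpa [eq_comm] using hf s, g, _, rfl, s, .inl rfl⟩, rfl⟩
  exists_label := by
    have h (e : {e : Sym2 Γ // ¬ e.IsDiag ∧
        ∃ v w : Γ, e = s(v, w) ∧ ∃ s : S, w = v * f s ∨ w = v * (f s)⁻¹}) :
        ∃ p : Γ × S, e.1 = s(p.1, p.1 * f p.2) := by
      obtain ⟨e, -, v, w, rfl, s, rfl | rfl⟩ := e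
      · exact ⟨(v, s), rfl⟩
      · exact ⟨(v * (f s)⁻¹, s), by simp [Sym2.eq_swap]⟩
    choose l hl using h
    exact ⟨l, fun e e' hee => Subtype.ext ((hl e).trans (hee ▸ (hl e').symm)), hl⟩

end FPP

namespace FPP

lemma _root_.IsFreeGroup.finite_generators_of_fg (H : Type*) [Group H] [IsFreeGroup H]
    [Group.FG H] : Finite (IsFreeGroup.Generators H) :=
  have : Group.FG (FreeGroup (IsFreeGroup.Generators H)) :=
    Group.fg_of_surjective (f := (IsFreeGroup.toFreeGroup H).toMonoidHom)
      (IsFreeGroup.toFreeGroup H).surjective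
  FreeGroup.finite_of_fg

lemma Multigraph.IsCayley.exists_hasBottlenecks {Γ S E : Type*} [Group Γ] [Finite S] {f : S → Γ}
    {G : Multigraph Γ E} (hG : G.IsCayley f) (hf : Subgroup.closure (Set.range f) = ⊤)
    (hΓ : VirtuallyFree Γ) : ∃ D, G.HasBottlenecks D := by
  classical
  have hc := hG.isConnected hf
  obtain ⟨H, hH, hfree⟩ := hΓ
  have hfg : Group.FG Γ := Group.fg_iff.2 ⟨_, hf, Set.finite_range f⟩
  have := Subgroup.fg_of_index_ne_zero H
  have := IsFreeGroup.finite_generators_of_fg H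
  obtain ⟨φ⟩ : Nonempty (H ≃* FreeGroup (IsFreeGroup.Generators H)) :=
    ⟨IsFreeGroup.toFreeGroup H⟩
  have : Finite (Γ ⧸ H) := Subgroup.finite_quotient_of_finiteIndex
  obtain ⟨R, hR⟩ : ∃ R : Set Γ, R = Set.range fun q : Γ ⧸ H => q.out := ⟨_, rfl⟩
  have hRfin : R.Finite := hR ▸ Set.finite_range _
  have hrep (g : Γ) : ∃ r ∈ R, r⁻¹ * g⁻¹ ∈ H := by
    obtain ⟨h, hh⟩ := QuotientGroup.mk_out_eq_mul H g⁻¹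
    refine ⟨((g⁻¹ : Γ) : Γ ⧸ H).out, hR ▸ ⟨_, rfl⟩, ?_⟩
    rw [hh]
    simp
  choose r hrR hrH using hrep
  obtain ⟨k, hk⟩ : ∃ k : Γ → FreeGroup (IsFreeGroup.Generators H),
      k = fun g => φ ⟨(r g)⁻¹ * g⁻¹, hrH g⟩ := ⟨_, rfl⟩
  have hquot (u v : Γ) : ((φ.symm (k u * (k v)⁻¹) : H) : Γ) = (r u)⁻¹ * (u⁻¹ * v) * r v := by
    simp only [hk, map_mul, map_inv, MulEquiv.symm_apply_apply, Subgroup.coe_mul,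
      Subgroup.coe_inv]
    group
  have hfin₁ := (((hRfin.prod (hG.finite_adj 1)).prod hRfin).image
    fun p : (Γ × Γ) × Γ => p.1.1⁻¹ * p.1.2 * p.2).preimage (f := fun x => ((φ.symm x : H) : Γ))
      (Subtype.val_injective.comp φ.symm.injective).injOn
  obtain ⟨C, hC⟩ := (hfin₁.image FreeGroup.norm).bddAbove
  have hfin₂ := ((hRfin.prod ((FreeGroup.finite_norm_le (α := IsFreeGroup.Generators H)
    (2 * C)).image fun x => ((φ.symm x : H) : Γ))).prod hRfin).image
    fun p : (Γ × Γ) × Γ => p.1.1 * p.1.2 * p.2⁻¹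
  obtain ⟨K, hK⟩ := (hfin₂.image (G.dist 1)).bddAbove
  refine ⟨2 * K, hc.hasBottlenecks (k := k) (C := C) (fun u v huv => ?_) fun u v huv => ?_⟩
  · refine hC ⟨_, ⟨((r u, u⁻¹ * v), r v), ⟨⟨hrR u, ?_⟩, hrR v⟩, (hquot u v).symm⟩, rfl⟩
    have := hG.adj_mul u⁻¹ huv
    rwa [inv_mul_cancel] at this
  · rw [hG.dist_eq hc]
    refine hK ⟨_, ⟨((r u, _), r v), ⟨⟨hrR u, _, huv, rfl⟩, hrR v⟩, rfl⟩, ?_⟩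
    congr 1
    simp only [hquot]
    group

lemma Multigraph.IsCayley.vdBK {Γ S E : Type*} [Group Γ] [Finite S] {f : S → Γ}
    {G : Multigraph Γ E} (hG : G.IsCayley f) (hf : Subgroup.closure (Set.range f) = ⊤)
    (hΓ : VirtuallyFree Γ) {z : Γ} (hz : z ≠ 1) (hord : IsOfFinOrder z)
    (hconj : (Set.range fun g => g⁻¹ * z * g).Finite) : G.VdBK := by
  have hc := hG.isConnected hf
  have : Countable Γ := by
    refine Set.countable_univ_iff.1 ((Set.countable_iUnion fun r =>
      (hG.finite_ball hc 1 r).countable).mono fun g _ => ?_)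
    exact Set.mem_iUnion.2 ⟨_, le_refl (G.dist 1 g)⟩
  obtain ⟨l, hl, -⟩ := hG.exists_label
  have : Countable E := hl.countable
  obtain ⟨D, hD⟩ := hG.exists_hasBottlenecks hf hΓ
  obtain ⟨D₀, hD₀⟩ := hG.isTorsionTranslation hc hz hord hconj
  exact vdBK_of_isTorsionTranslation hc hD hD₀ (hG.exists_ncard_le hc)

/-- The van den Berg-Kesten property for virtually free groups with a nontrivial element of finite
order that has only finitely many conjugates. -/
theorem everyCayleyGraphVdBK_of_finite_conjugates {Γ : Type u} [Group Γ] (hΓ : VirtuallyFree Γ)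
    {z : Γ} (hz : z ≠ 1) (hord : IsOfFinOrder z)
    (hconj : (Set.range fun g => g⁻¹ * z * g).Finite) : EveryCayleyGraphVdBK.{u, v} Γ :=
  fun _ _ f hf hcl =>
    ⟨(isCayley_unreducedCayley f hf).vdBK hcl hΓ hz hord hconj,
      (isCayley_reducedCayley f hf).vdBK hcl hΓ hz hord hconj⟩

end FPP

section VirtuallyCyclic

variable {Γ : Type*} [Group Γ]

lemma finite_range_conj_of_commute (K : Subgroup Γ) [K.FiniteIndex] {z : Γ}
    (h : ∀ k ∈ K, Commute k z) : (Set.range fun g => g⁻¹ * z * g).Finite := by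
  have : Finite (Γ ⧸ K) := Subgroup.finite_quotient_of_finiteIndex
  refine (Set.finite_range fun q : Γ ⧸ K => q.out * z * q.out⁻¹).subset ?_
  rintro _ ⟨g, rfl⟩
  refine ⟨((g⁻¹ : Γ) : Γ ⧸ K), ?_⟩
  obtain ⟨k, hk⟩ := QuotientGroup.mk_out_eq_mul K g⁻¹
  simp only [hk]
  have h1 := (h k k.2).eq
  calc g⁻¹ * k * z * (g⁻¹ * k)⁻¹ = g⁻¹ * (k * z) * (k : Γ)⁻¹ * g := by group
    _ = g⁻¹ * z * g := by rw [h1]; group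

/-- A torsion-free group with a central cyclic subgroup of finite index is cyclic. -/
lemma isCyclic_of_le_center (C : Subgroup Γ) [C.FiniteIndex] [IsCyclic C]
    (hC : C ≤ Subgroup.center Γ) (htf : ∀ g : Γ, IsOfFinOrder g → g = 1) : IsCyclic Γ := by
  let : CommGroup C := IsCyclic.commGroup
  have key (g : Γ) (k : ℕ) (g₀ : Γ) (h : g₀⁻¹ * g ^ k * g₀ ∈ C) : g₀⁻¹ * g ^ k * g₀ = g ^ k := by
    have h1 := Subgroup.mem_center_iff.1 (hC h) g₀
    rw [← mul_assoc, ← mul_assoc, mul_inv_cancel, one_mul] at h1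
    exact (mul_right_cancel h1).symm
  refine isCyclic_of_injective (MonoidHom.transfer (MonoidHom.id C)) ?_
  refine (injective_iff_map_eq_one _).2 fun g hg => htf g ?_
  rw [MonoidHom.transfer_eq_pow _ g (key g), MonoidHom.id_apply, Subtype.ext_iff] at hg
  exact isOfFinOrder_iff_pow_eq_one.2 ⟨_, Nat.pos_of_ne_zero Subgroup.FiniteIndex.index_ne_zero, hg⟩

lemma zpow_mul_of_inverts {g t : Γ} (ht : t * t = 1) (hg : t * g * t = g⁻¹) (n : ℤ) :
    g ^ n * t = t * g ^ (-n) := by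
  have ht' : t⁻¹ = t := inv_eq_of_mul_eq_one_left ht
  have h := conj_zpow (i := -n) (a := t) (b := g)
  rw [ht', hg, inv_zpow', neg_neg] at h
  rw [h, mul_assoc, ht, mul_one]

/-- The homomorphism from the group with two elements given by an involution. -/
def involutionHom (t : Γ) (ht : t * t = 1) : Multiplicative (ZMod 2) →* Γ where
  toFun x := if x = 1 then 1 else t
  map_one' := by simp
  map_mul' := by
    have h : ∀ x : Multiplicative (ZMod 2), x = 1 ∨ x = Multiplicative.ofAdd 1 := by decide
    have h1 : (Multiplicative.ofAdd 1 : Multiplicative (ZMod 2)) ≠ 1 := by decide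
    have h2 : (Multiplicative.ofAdd 1 : Multiplicative (ZMod 2)) * Multiplicative.ofAdd 1 = 1 := by
      decide
    intro x y
    rcases h x with rfl | rfl <;> rcases h y with rfl | rfl <;> simp [h1, h2, ht]

/-- Recognition of the infinite dihedral group. -/
lemma nonempty_mulEquiv_coprod {g t : Γ} (hg : ¬ IsOfFinOrder g) (htt : t * t = 1)
    (htg : t * g * t = g⁻¹) (ht : t ∉ Subgroup.zpowers g)
    (hcover : ∀ x, x ∈ Subgroup.zpowers g ∨ t * x ∈ Subgroup.zpowers g) :
    Nonempty (Γ ≃* Monoid.Coprod (Multiplicative (ZMod 2)) (Multiplicative (ZMod 2))) := by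
  obtain ⟨a, ha⟩ : ∃ a : Monoid.Coprod (Multiplicative (ZMod 2)) (Multiplicative (ZMod 2)),
    a = Monoid.Coprod.inl (Multiplicative.ofAdd 1) := ⟨_, rfl⟩
  obtain ⟨b, hb⟩ : ∃ b : Monoid.Coprod (Multiplicative (ZMod 2)) (Multiplicative (ZMod 2)),
    b = Monoid.Coprod.inr (Multiplicative.ofAdd 1) := ⟨_, rfl⟩
  have h2 : (Multiplicative.ofAdd 1 : Multiplicative (ZMod 2)) * Multiplicative.ofAdd 1 = 1 := by
    decide
  have haa : a * a = 1 := by rw [ha, ← map_mul, h2, map_one]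
  have hbb : b * b = 1 := by rw [hb, ← map_mul, h2, map_one]
  have had : a * (a * b) * a = (a * b)⁻¹ := by
    rw [mul_inv_rev, inv_eq_of_mul_eq_one_left haa, inv_eq_of_mul_eq_one_left hbb, ← mul_assoc,
      haa, one_mul]
  have hform (x : Monoid.Coprod (Multiplicative (ZMod 2)) (Multiplicative (ZMod 2))) :
      ∃ n : ℤ, x = (a * b) ^ n ∨ x = a * (a * b) ^ n := by
    have h : ∀ x : Multiplicative (ZMod 2), x = 1 ∨ x = Multiplicative.ofAdd 1 := by decide
    induction x using Monoid.Coprod.induction_on with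
    | inl x =>
      rcases h x with rfl | rfl
      · exact ⟨0, .inl (by simp)⟩
      · exact ⟨0, .inr (by simp [ha])⟩
    | inr x =>
      rcases h x with rfl | rfl
      · exact ⟨0, .inl (by simp)⟩
      · exact ⟨1, .inr (by rw [zpow_one, ← mul_assoc, haa, one_mul, hb])⟩
    | mul x y hx hy =>
      obtain ⟨n, rfl | rfl⟩ := hx <;> obtain ⟨m, rfl | rfl⟩ := hy
      · exact ⟨n + m, .inl (zpow_add _ _ _).symm⟩
      · refine ⟨-n + m, .inr ?_⟩
        rw [← mul_assoc, zpow_mul_of_inverts haa had, mul_assoc, zpow_add]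
      · exact ⟨n + m, .inr (by rw [zpow_add, mul_assoc])⟩
      · refine ⟨-n + m, .inl ?_⟩
        rw [mul_assoc, ← mul_assoc (_ ^ n), zpow_mul_of_inverts haa had, ← mul_assoc, ← mul_assoc,
          haa, one_mul, zpow_add]
  have htg' : t * g * (t * g) = 1 := by rw [← mul_assoc, htg, inv_mul_cancel]
  obtain ⟨F, hF⟩ : ∃ F : Monoid.Coprod (Multiplicative (ZMod 2)) (Multiplicative (ZMod 2)) →* Γ,
    F = Monoid.Coprod.lift (involutionHom t htt) (involutionHom (t * g) htg') := ⟨_, rfl⟩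
  have h1 : (Multiplicative.ofAdd 1 : Multiplicative (ZMod 2)) ≠ 1 := by decide
  have hFa : F a = t := by simp [hF, ha, involutionHom, h1]
  have hFd : F (a * b) = g := by
    rw [map_mul, hFa]
    simp [hF, hb, involutionHom, h1, ← mul_assoc, htt]
  refine ⟨(MulEquiv.ofBijective F ⟨(injective_iff_map_eq_one _).2 fun x hx => ?_, fun x => ?_⟩).symm⟩
  · obtain ⟨n, rfl | rfl⟩ := hform x
    · rw [map_zpow, hFd] at hx
      rw [injective_zpow_iff_not_isOfFinOrder.2 hg (hx.trans (zpow_zero g).symm), zpow_zero]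
    · rw [map_mul, map_zpow, hFd, hFa] at hx
      refine absurd ⟨-n, ?_⟩ ht
      simp only [zpow_neg]
      exact (eq_inv_of_mul_eq_one_left hx).symm
  · rcases hcover x with ⟨n, rfl⟩ | ⟨n, hn⟩
    · exact ⟨(a * b) ^ n, by rw [map_zpow, hFd]⟩
    · refine ⟨a * (a * b) ^ n, ?_⟩
      simp only at hn
      rw [map_mul, map_zpow, hFd, hFa, hn, ← mul_assoc, htt, one_mul]

/-- An infinite virtually cyclic group without nontrivial elements of finite order centralizing a
cyclic normal subgroup of finite index is infinite cyclic or infinite dihedral. -/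
lemma nonempty_mulEquiv_of_isCyclic [Infinite Γ] (C : Subgroup Γ) [C.Normal] [C.FiniteIndex]
    [IsCyclic C] (htf : ∀ z : Γ, IsOfFinOrder z → (∀ c ∈ C, Commute c z) → z = 1) :
    Nonempty (Γ ≃* Multiplicative ℤ) ∨
      Nonempty (Γ ≃* Monoid.Coprod (Multiplicative (ZMod 2)) (Multiplicative (ZMod 2))) := by
  obtain ⟨P, hP⟩ : ∃ P, P = Subgroup.centralizer (C : Set Γ) := ⟨_, rfl⟩
  have hmem (x : Γ) : x ∈ P ↔ ∀ c ∈ C, Commute c x := by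
    rw [hP, Subgroup.mem_centralizer_iff]
    rfl
  have hCP : C ≤ P := fun x hx => (hmem x).2 fun c hc => by
    let : CommGroup C := IsCyclic.commGroup
    exact congrArg Subtype.val (mul_comm (⟨c, hc⟩ : C) ⟨x, hx⟩)
  have hPn : P.Normal := hP ▸ inferInstance
  have hcyc : IsCyclic P := by
    have : IsCyclic (C.subgroupOf P) :=
      isCyclic_of_injective (Subgroup.subgroupOfEquivOfLe hCP).toMonoidHom
        (Subgroup.subgroupOfEquivOfLe hCP).injective
    refine isCyclic_of_le_center (C.subgroupOf P) (fun c hc => ?_) fun x hx => ?_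
    · rw [Subgroup.mem_center_iff]
      exact fun x => Subtype.ext ((hmem _).1 x.2 c hc).eq.symm
    · exact Subtype.ext (htf x (P.subtype.isOfFinOrder hx) ((hmem _).1 x.2))
  obtain ⟨g, hgP, hg⟩ : ∃ g ∈ P, P = Subgroup.zpowers g := by
    obtain ⟨⟨g, hg⟩, h⟩ := hcyc.exists_generator
    refine ⟨g, hg, le_antisymm (fun x hx => ?_) (by simpa using hg)⟩
    obtain ⟨n, hn⟩ := h ⟨x, hx⟩
    exact ⟨n, congrArg Subtype.val hn⟩
  have hginf : ¬ IsOfFinOrder g := by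
    intro h
    have h1 := htf g h ((hmem g).1 hgP)
    rw [h1, Subgroup.zpowers_one_eq_bot] at hg
    have h2 : C = ⊥ := le_bot_iff.1 (hg ▸ hCP)
    have h3 := Subgroup.FiniteIndex.index_ne_zero (H := C)
    rw [h2, Subgroup.index_bot] at h3
    exact h3 Nat.card_eq_zero_of_infinite
  have hinj := injective_zpow_iff_not_isOfFinOrder.2 hginf
  by_cases htop : P = ⊤
  · exact .inl ⟨(intEquivOfZPowersEqTop g (hg ▸ htop)).symm⟩
  · right
    have hcomm (x : Γ) (hx : x * g * x⁻¹ = g) : x ∈ P := by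
      refine (hmem x).2 fun c hc => ?_
      obtain ⟨n, rfl⟩ : c ∈ Subgroup.zpowers g := hg ▸ hCP hc
      exact (show Commute x g from mul_inv_eq_iff_eq_mul.1 hx).symm.zpow_left n
    have hinv (x : Γ) (hx : x ∉ P) : x * g * x⁻¹ = g⁻¹ := by
      obtain ⟨a, ha⟩ : x * g * x⁻¹ ∈ Subgroup.zpowers g := hg ▸ hPn.conj_mem g hgP x
      obtain ⟨b, hb⟩ : x⁻¹ * g * x⁻¹⁻¹ ∈ Subgroup.zpowers g := hg ▸ hPn.conj_mem g hgP x⁻¹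
      simp only at ha hb
      have h1 : g ^ (a * b) = g ^ (1 : ℤ) := by
        rw [zpow_mul, ha, conj_zpow, hb]
        group
      rcases Int.eq_one_or_neg_one_of_mul_eq_one (hinj h1) with rfl | rfl
      · exact absurd (hcomm x (by rw [← ha, zpow_one])) hx
      · rw [← ha, zpow_neg_one]
    obtain ⟨t, ht⟩ : ∃ t, t ∉ P := by
      by_contra! h
      exact htop (eq_top_iff.2 fun x _ => h x)
    have hmul (x : Γ) (hx : x ∉ P) : t * x ∈ P := by
      refine hcomm _ ?_
      calc t * x * g * (t * x)⁻¹ = t * (x * g * x⁻¹) * t⁻¹ := by group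
        _ = (t * g * t⁻¹)⁻¹ := by rw [hinv x hx]; group
        _ = g := by rw [hinv t ht, inv_inv]
    have htt : t * t = 1 := by
      obtain ⟨j, hj⟩ : t * t ∈ Subgroup.zpowers g := hg ▸ hmul t ht
      simp only at hj
      have h1 : g ^ (-j) = g ^ j := by
        rw [zpow_neg, ← inv_zpow, ← hinv t ht, conj_zpow, hj]
        group
      have h2 := hinj h1
      obtain rfl : j = 0 := by omega
      rw [← hj, zpow_zero]
    refine nonempty_mulEquiv_coprod (t := t) hginf htt ?_ (hg ▸ ht) fun x => ?_
    · rw [← hinv t ht, inv_eq_of_mul_eq_one_left htt]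
    · rw [← hg]
      by_cases hx : x ∈ P
      · exact .inl hx
      · exact .inr (hmul x hx)

end VirtuallyCyclic

lemma FreeGroup.isCyclic_of_subsingleton {α : Type*} [Subsingleton α] : IsCyclic (FreeGroup α) := by
  rcases isEmpty_or_nonempty α with h | ⟨⟨a⟩⟩
  · exact inferInstance
  · have : Unique α := uniqueOfSubsingleton a
    exact isCyclic_of_surjective FreeGroup.mulEquivIntOfUnique.symm.toMonoidHom
      FreeGroup.mulEquivIntOfUnique.symm.surjective

namespace FPP

variable {Γ : Type u} [Group Γ]

/-- A free subgroup is cyclic if some nontrivial element of it commutes with a subgroup of finite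
index. -/
lemma isCyclic_of_commute {L H : Subgroup Γ} [IsFreeGroup L] [H.FiniteIndex] {y : Γ} (hyL : y ∈ L)
    (hy : y ≠ 1) (hyH : ∀ h ∈ H, Commute h y) : IsCyclic L := by
  let φ : L ≃* FreeGroup (IsFreeGroup.Generators L) := IsFreeGroup.toFreeGroup L
  have hy' : φ ⟨y, hyL⟩ ≠ 1 := by
    rw [Ne, EmbeddingLike.map_eq_one_iff, Subtype.ext_iff]
    exact hy
  have hcomm (g : FreeGroup (IsFreeGroup.Generators L)) : Commute g (φ ⟨y, hyL⟩) := by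
    obtain ⟨n, hn, -, hnH⟩ := Subgroup.exists_pow_mem_of_index_ne_zero
      (Subgroup.FiniteIndex.index_ne_zero (H := H)) ((φ.symm g : L) : Γ)
    have h1 : Commute (φ.symm g ^ n) ⟨y, hyL⟩ := Subtype.ext (hyH _ hnH).eq
    have h2 := h1.map φ
    rw [map_pow, MulEquiv.apply_symm_apply] at h2
    have h3 : φ ⟨y, hyL⟩ * g * (φ ⟨y, hyL⟩)⁻¹ = g := by
      refine IsMulTorsionFree.pow_left_injective hn.ne' ?_
      simp only
      rw [conj_pow, ← h2.eq, mul_inv_cancel_right]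
    exact (show Commute (φ ⟨y, hyL⟩) g from mul_inv_eq_iff_eq_mul.1 h3).symm
  have := FreeGroup.subsingleton_of_forall_commute hy' hcomm
  have := FreeGroup.isCyclic_of_subsingleton (α := IsFreeGroup.Generators L)
  exact isCyclic_of_injective φ.toMonoidHom φ.injective

lemma everyCayleyGraphVdBK_of_nontrivial_center [Infinite Γ] (hΓ : VirtuallyFree Γ)
    (hZ : IsEmpty (Γ ≃* Multiplicative ℤ))
    (hD : IsEmpty (Γ ≃* Monoid.Coprod (Multiplicative (ZMod 2)) (Multiplicative (ZMod 2))))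
    (H : Subgroup Γ) [H.FiniteIndex] [Nontrivial (Subgroup.center H)] :
    EveryCayleyGraphVdBK.{u, v} Γ := by
  obtain ⟨⟨⟨z, hzH⟩, hzc⟩, hz⟩ := exists_ne (1 : Subgroup.center H)
  have hz1 : z ≠ 1 := fun h => hz (Subtype.ext (Subtype.ext h))
  have hcomm : ∀ h ∈ H, Commute h z := fun h hh =>
    congrArg Subtype.val (Subgroup.mem_center_iff.1 hzc ⟨h, hh⟩)
  by_cases hord : IsOfFinOrder z
  · exact everyCayleyGraphVdBK_of_finite_conjugates hΓ hz1 hord (finite_range_conj_of_commute H hcomm)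
  · have hΓ' := hΓ
    obtain ⟨L, hL, hLfree⟩ := hΓ'
    obtain ⟨n, hn, -, hnL⟩ := Subgroup.exists_pow_mem_of_index_ne_zero
      (Subgroup.FiniteIndex.index_ne_zero (H := L)) z
    have := isCyclic_of_commute (H := H) hnL
      (fun h => hord (isOfFinOrder_iff_pow_eq_one.2 ⟨n, hn, h⟩)) fun h hh => (hcomm h hh).pow_right n
    have : IsCyclic L.normalCore :=
      isCyclic_of_injective (Subgroup.inclusion L.normalCore_le) (Subgroup.inclusion_injective _)
    by_cases htf : ∀ w : Γ, IsOfFinOrder w → (∀ c ∈ L.normalCore, Commute c w) → w = 1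
    · rcases nonempty_mulEquiv_of_isCyclic L.normalCore htf with ⟨⟨e⟩⟩ | ⟨⟨e⟩⟩
      · exact hZ.elim e
      · exact hD.elim e
    · push Not at htf
      obtain ⟨w, hw, hwc, hw1⟩ := htf
      exact everyCayleyGraphVdBK_of_finite_conjugates hΓ hw1 hw
        (finite_range_conj_of_commute L.normalCore hwc)

lemma everyCayleyGraphVdBK_of_finite_normal (hΓ : VirtuallyFree Γ) (N : Subgroup Γ) [N.Normal]
    [Finite N] [Nontrivial N] : EveryCayleyGraphVdBK.{u, v} Γ := by
  obtain ⟨⟨z, hzN⟩, hz⟩ := exists_ne (1 : N)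
  refine everyCayleyGraphVdBK_of_finite_conjugates hΓ (z := z) (fun h => hz (Subtype.ext h))
    (N.subtype.isOfFinOrder (isOfFinOrder_of_finite (⟨z, hzN⟩ : N)))
    ((Set.toFinite (N : Set Γ)).subset ?_)
  rintro _ ⟨g, rfl⟩
  simpa using Subgroup.Normal.conj_mem ‹N.Normal› z hzN g⁻¹

lemma isFreeGroup_range {ι : Type*} {f : FreeGroup ι →* Γ} (hf : Function.Injective f) :
    IsFreeGroup f.range :=
  IsFreeGroup.ofMulEquiv (MonoidHom.ofInjective hf)

lemma everyCayleyGraphVdBK_of_prod {ι F : Type*} [Group F] [Finite F] [Nontrivial F]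
    (H : Subgroup Γ) [H.FiniteIndex] (e : H ≃* FreeGroup ι × F) :
    EveryCayleyGraphVdBK.{u, v} Γ := by
  obtain ⟨j, hj⟩ : ∃ j : FreeGroup ι × F →* Γ, j = H.subtype.comp e.symm.toMonoidHom := ⟨_, rfl⟩
  have hjinj : Function.Injective j := hj ▸ Subtype.val_injective.comp e.symm.injective
  obtain ⟨K, hK⟩ : ∃ K : Subgroup Γ, K = (j.comp (MonoidHom.inl (FreeGroup ι) F)).range := ⟨_, rfl⟩
  have hKfree : IsFreeGroup K := hK ▸ isFreeGroup_range
    (hjinj.comp fun _ _ h => (Prod.mk.inj h).1)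
  have hKfin : K.FiniteIndex := by
    refine ⟨?_⟩
    have h1 : K = ((MonoidHom.inl (FreeGroup ι) F).range.map e.symm.toMonoidHom).map H.subtype := by
      rw [hK, hj, MonoidHom.range_comp, Subgroup.map_map]
    have h2 : (MonoidHom.inl (FreeGroup ι) F).range = (MonoidHom.snd (FreeGroup ι) F).ker := by
      ext ⟨x, y⟩
      simp [Subgroup.mem_prod, eq_comm]
    rw [h1, Subgroup.index_map_subtype]
    refine mul_ne_zero ?_ Subgroup.FiniteIndex.index_ne_zero
    have h3 := Subgroup.index_map_equiv (MonoidHom.inl (FreeGroup ι) F).range e.symm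
    change (Subgroup.map (e.symm : FreeGroup ι × F →* H) _).index ≠ 0
    rw [h3, h2, Subgroup.index_ker]
    exact Nat.card_pos.ne'
  obtain ⟨y, hy⟩ := exists_ne (1 : F)
  refine everyCayleyGraphVdBK_of_finite_conjugates ⟨K, hKfin, hKfree⟩ (z := j (1, y)) ?_ ?_
    (finite_range_conj_of_commute K ?_)
  · rw [Ne, ← map_one j, hjinj.eq_iff]
    exact fun h => hy (Prod.mk.inj h).2
  · exact (j.comp (MonoidHom.inr (FreeGroup ι) F)).isOfFinOrder (isOfFinOrder_of_finite y)
  · rw [hK]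
    rintro _ ⟨x, rfl⟩
    refine Commute.map (f := j) (x := (x, 1)) (y := (1, y)) ?_
    exact Prod.ext (by simp) (by simp)

lemma everyCayleyGraphVdBK_of_semidirectProduct {ι F : Type*} [Group F] [Finite F] [Nontrivial F]
    {φ : FreeGroup ι →* MulAut F} (e : Γ ≃* F ⋊[φ] FreeGroup ι) :
    EveryCayleyGraphVdBK.{u, v} Γ := by
  obtain ⟨K, hK⟩ : ∃ K : Subgroup Γ,
    K = (e.symm.toMonoidHom.comp (SemidirectProduct.inr (φ := φ))).range := ⟨_, rfl⟩
  obtain ⟨p, hp⟩ : ∃ p : Γ →* FreeGroup ι, p = SemidirectProduct.rightHom.comp e.toMonoidHom :=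
    ⟨_, rfl⟩
  have hKfree : IsFreeGroup K := hK ▸ isFreeGroup_range
    (e.symm.injective.comp SemidirectProduct.inr_injective)
  have hKfin : K.FiniteIndex := by
    have : Finite (Γ ⧸ K) := by
      refine Finite.of_surjective
        (fun y : F => ((e.symm (SemidirectProduct.inl y) : Γ) : Γ ⧸ K)) fun q => ?_
      obtain ⟨g, rfl⟩ := QuotientGroup.mk_surjective q
      refine ⟨(e g).left, QuotientGroup.eq.2 ?_⟩
      rw [hK]
      refine ⟨(e g).right, ?_⟩
      have h := SemidirectProduct.inl_left_mul_inr_right (e g)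
      have h1 : g = e.symm (SemidirectProduct.inl (e g).left) *
          e.symm (SemidirectProduct.inr (e g).right) := by
        rw [← map_mul, h, e.symm_apply_apply]
      rw [eq_inv_mul_iff_mul_eq]
      exact h1.symm
    exact Subgroup.finiteIndex_of_finite_quotient
  obtain ⟨N, hN⟩ : ∃ N : Subgroup Γ, N = p.ker := ⟨_, rfl⟩
  have hNn : N.Normal := hN ▸ inferInstance
  obtain ⟨i, hi⟩ : ∃ i : F →* Γ, i = e.symm.toMonoidHom.comp (SemidirectProduct.inl (φ := φ)) :=
    ⟨_, rfl⟩
  have hiinj : Function.Injective i := hi ▸ e.symm.injective.comp SemidirectProduct.inl_injective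
  have hNi : N = i.range := by
    ext g
    rw [hN, hi, hp, MonoidHom.mem_ker, MonoidHom.comp_apply, ← MonoidHom.mem_ker,
      ← SemidirectProduct.range_inl_eq_ker_rightHom]
    constructor
    · rintro ⟨y, hy⟩
      exact ⟨y, by simp [hy]⟩
    · rintro ⟨y, rfl⟩
      exact ⟨y, by simp⟩
  let E : F ≃* N := (MonoidHom.ofInjective hiinj).trans (MulEquiv.subgroupCongr hNi.symm)
  have : Finite N := Finite.of_surjective E E.surjective
  have : Nontrivial N := E.injective.nontrivial
  exact everyCayleyGraphVdBK_of_finite_normal ⟨K, hKfin, hKfree⟩ N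

end FPP

end

theorem theorem4 (Γ : Type u) [Group Γ] :
    -- the main assertion
    (Infinite Γ → FPP.VirtuallyFree Γ →
      IsEmpty (Γ ≃* Multiplicative ℤ) →
      IsEmpty (Γ ≃* Monoid.Coprod (Multiplicative (ZMod 2)) (Multiplicative (ZMod 2))) →
      ((∃ H : Subgroup Γ, H.FiniteIndex ∧ Nontrivial (Subgroup.center H)) ∨
        (∃ N : Subgroup Γ, N.Normal ∧ Finite N ∧ Nontrivial N)) →
      FPP.EveryCayleyGraphVdBK.{u, v} Γ) ∧
    -- groups containing `F_k × F` with finite index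
    (∀ (k : ℕ) (F : Type w) [Group F] [Finite F] [Nontrivial F], 1 ≤ k →
      (∃ H : Subgroup Γ, H.FiniteIndex ∧ Nonempty (H ≃* FreeGroup (Fin k) × F)) →
      FPP.EveryCayleyGraphVdBK.{u, v} Γ) ∧
    -- semidirect products `F ⋊ F_k`
    (∀ (k : ℕ) (F : Type w) [Group F] [Finite F] [Nontrivial F]
      (φ : FreeGroup (Fin k) →* MulAut F), 1 ≤ k →
      Nonempty (Γ ≃* F ⋊[φ] FreeGroup (Fin k)) →
      FPP.EveryCayleyGraphVdBK.{u, v} Γ) := by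
  refine ⟨?_, ?_, ?_⟩
  · rintro _ hΓ hZ hD (⟨H, _, _⟩ | ⟨N, _, _, _⟩)
    · exact FPP.everyCayleyGraphVdBK_of_nontrivial_center hΓ hZ hD H
    · exact FPP.everyCayleyGraphVdBK_of_finite_normal hΓ N
  · rintro k F _ _ _ - ⟨H, _, ⟨e⟩⟩
    exact FPP.everyCayleyGraphVdBK_of_prod H e
  · rintro k F _ _ _ φ - ⟨e⟩
    exact FPP.everyCayleyGraphVdBK_of_semidirectProduct e
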